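/- For $s\in\mathbb C$ let $$\mathcal R(s)=\int_{0\swarrow 1}\frac{x^{-s}e^{\pi i x^2}}{e^{\pi i x}-e^{-\pi i x}}\,dx$$ be Riemann's auxiliary function, where $x^{-s}$ is the principal branch on the plane slit along the negative real axis and the path $0\swarrow1$ is the line of direction $e^{i\pi/4}$ that crosses the real axis at $\tfrac12$, run from the upper right to the lower left. Theorem. $\mathcal R$ is an entire function of order exactly $1$. The zeros of $\mathcal R$ other than $-2,-4,-6,\dots$, repeated according to multiplicity, can be listed as $(\varrho_n)_{n\in\mathbb Z}$ with $\operatorname{Im}\varrho_n>0$ for $n\ge1$ and $\operatorname{Im}\varrho_n\le0$ for $n\le0$ (in particular there are infinitely many of each kind, and none is $0$). There is a constant $a\in\mathbb C$ such that for every such listing $$\mathcal R(s)=-\frac{e^{as}}{2\,\Gamma(1+\frac s2)}\prod_{n\in\mathbb Z}\Bigl(1-\frac{s}{\varrho_n}\Bigr)e^{s/\varrho_n}\qquad(s\in\mathbb C),$$ where the product converges unconditionally and locally uniformly on $\mathbb C$, and $1/\Gamma$ denotes the entire reciprocal of the Gamma function (equal to $0$ at $0,-1,-2,\dots$). Here the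 order of an entire function $f$ is the infimum of the $\mu\ge0$ with $f(z)=O(e^{|z|^\mu})$ as $|z|\to\infty$. -/

import Mathlib

open scoped ENNReal NNReal

/-- The integrand `x ^ (-s) e^{π i x²} / (e^{π i x} - e^{-π i x})`, with the principal branch
`x ^ (-s) = exp (-s log x)` on the plane slit along the negative real axis. -/
noncomputable def auxIntegrand (s x : ℂ) : ℂ :=
  x ^ (-s) * Complex.exp (Real.pi * Complex.I * x ^ 2) /
    (Complex.exp (Real.pi * Complex.I * x) - Complex.exp (-(Real.pi * Complex.I * x)))

/-- Riemann's auxiliary function `R(s) = ∫_{0↙1} x^{-s} e^{πix²} / (e^{πix} - e^{-πix}) dx`.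
The path `0↙1` is the line of direction `e^{iπ/4}` that crosses the real axis between `0` and `1`
(here at `1/2`), run from the upper right to the lower left: `x = 1/2 + u e^{iπ/4}` with `u`
decreasing from `+∞` to `-∞`, which accounts for the minus sign. The line meets neither the
branch cut nor an integer. -/
noncomputable def riemannAux (s : ℂ) : ℂ :=
  -∫ u : ℝ, auxIntegrand s (1 / 2 + u * Complex.exp (Real.pi * Complex.I / 4)) *
    Complex.exp (Real.pi * Complex.I / 4)

/-- The order of growth of an entire function `f`: the infimum of the `μ ≥ 0` such that
`f(z) = O(exp(|z|^μ))` as `|z| → ∞` (it is `∞` if there is no such `μ`). -/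
noncomputable def entireOrder (f : ℂ → ℂ) : ℝ≥0∞ :=
  ⨅ (μ : ℝ≥0) (_ : f =O[Filter.cocompact ℂ] fun z => Real.exp (‖z‖ ^ (μ : ℝ))), (μ : ℝ≥0∞)

/-- The points `-2, -4, -6, …`, the trivial zeros of `riemannAux`. -/
def trivialZeros : Set ℂ := {z | ∃ k : ℕ, z = -2 * ((k : ℂ) + 1)}

/-- `ρ` lists the zeros of `riemannAux` other than `-2, -4, …`, each as often as its multiplicity
says, those in the open upper half plane at the indices `n ≥ 1`, the others at `n ≤ 0`. -/
structure IsZeroEnumeration (ρ : ℤ → ℂ) : Prop where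
  ne_trivial : ∀ n, ρ n ∉ trivialZeros
  multiplicity : ∀ z ∉ trivialZeros, {n | ρ n = z}.encard = analyticOrderAt riemannAux z
  im_pos : ∀ n, 1 ≤ n → 0 < (ρ n).im
  im_nonpos : ∀ n, n ≤ 0 → (ρ n).im ≤ 0

/-! The factorization is Hadamard's theorem in genus one for the zeros of $\mathcal R$, with the
product over $-2,-4,\dots$ recognised as a Gamma factor. On the lines of slope $1$ the factor
$e^{\pi i x^2}$ has Gaussian decay. This makes $\mathcal R$ entire and bounds it by
$e^{O(|s|\log|s|)}$, hence by $e^{O(1+|s|^{3/2})}$, so $\sum|\varrho|^{-2}<\infty$ and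
`eq_mul_exp_mul_tprod_of_growth` applies. Since $\mathcal R(0)=-\frac12$ (`riemannAux_zero`), no
power of $s$ occurs. The order is not below $1$ because the trivial zeros alone have linear density
(`one_le_of_isBigO_riemannAux`).

The trivial zeros must be exactly simple, since the Gamma factor absorbs each of them once. At
$s=-2k-2$ the integrand has no branch, and the line of integration can be moved to the origin, where
it is odd: this gives the zero. The derivative carries an extra $\log x$, whose jump $\pi i$ between
opposite rays leaves the integral of $y^{2k+2}e^{-\pi y^2}/(e^{\pi i\omega y}-e^{-\pi i\omega y})$
over $y>0$, $\omega=e^{i\pi/4}$. It does not vanish, because its leading term $-e^{\pi i\omega y}$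
oscillates slowly against a concentrated density and outweighs the rest
(`integral_gauss_div_sin_ne_zero`).

For the infinitude of zeros in each half plane, move the line across the pole at $1$: the residue is
$1$ and the remaining line stays at distance more than $1$ from $0$, so $\mathcal R\to1$
exponentially as $\operatorname{Re}s\to\infty$ in horizontal strips. If only finitely many zeros lay
above the real axis, then $\mathcal R'/\mathcal R$ would be polynomially bounded in some half plane
and exponentially small along a horizontal ray in it. By Phragmén–Lindelöf it would vanish, and
$\mathcal R$ would be constant (`infinite_zeros_upper_half_plane`). Conjugation gives the lower half
plane. -/

/-! ### Division by finitely many zeros, and zero counting by the maximum principle. -/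

open Filter Topology in
theorem analyticOrderAt_one_sub_div {a : ℂ} (ha : a ≠ 0) (z : ℂ) :
    analyticOrderAt (fun w : ℂ => 1 - w / a) z = if z = a then 1 else 0 := by
  have han : AnalyticAt ℂ (fun w : ℂ => 1 - w / a) z := by fun_prop
  split_ifs with h
  · subst h
    have hd : HasDerivAt (fun w : ℂ => 1 - w / z) (-(1 / z)) z :=
      ((hasDerivAt_id z).div_const z).const_sub 1
    have := han.analyticOrderAt_sub_eq_one_of_deriv_ne_zero (by rw [hd.deriv]; simpa using ha)
    simpa [ha] using this
  · rw [han.analyticOrderAt_eq_zero]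
    intro h0
    apply h
    field_simp at h0
    exact (sub_eq_zero.1 (h0.trans (mul_zero a))).symm

theorem Differentiable.exists_eq_one_sub_div_mul {f : ℂ → ℂ} (hf : Differentiable ℂ f) {a : ℂ}
    (ha : a ≠ 0) (hfa : f a = 0) :
    ∃ g : ℂ → ℂ, Differentiable ℂ g ∧ ∀ z, f z = (1 - z / a) * g z := by
  refine ⟨fun z => -a * dslope f a z, ?_, fun z => ?_⟩
  · exact (differentiableOn_univ.1 ((Complex.differentiableOn_dslope Filter.univ_mem).2
      hf.differentiableOn)).const_mul _
  · have := sub_smul_dslope f a z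
    rw [hfa, sub_zero, smul_eq_mul] at this
    rw [← this]
    field_simp
    ring

/-- Orders are additive, so dividing by one linear factor lowers the order by one at that zero only.
Counting just the indices in `s` lets the hypothesis pass to the quotient with the remaining
indices. -/
theorem Differentiable.exists_eq_prod_mul {ι : Type*} {ρ : ι → ℂ} (hρ : ∀ i, ρ i ≠ 0)
    (s : Finset ι) {f : ℂ → ℂ} (hf : Differentiable ℂ f)
    (hs : ∀ z, ((s : Set ι) ∩ {i | ρ i = z}).encard ≤ analyticOrderAt f z) :
    ∃ g : ℂ → ℂ, Differentiable ℂ g ∧ ∀ z, f z = (∏ i ∈ s, (1 - z / ρ i)) * g z := by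
  classical
  induction s using Finset.induction_on generalizing f with
  | empty => exact ⟨f, hf, by simp⟩
  | insert i s hi ih =>
    have h1 : f (ρ i) = 0 := by
      apply apply_eq_zero_of_analyticOrderAt_ne_zero
      intro h0
      have := hs (ρ i)
      rw [h0, nonpos_iff_eq_zero, Set.encard_eq_zero] at this
      exact (Set.eq_empty_iff_forall_notMem.1 this i) (by simp)
    obtain ⟨h, hh, hfh⟩ := hf.exists_eq_one_sub_div_mul (hρ i) h1
    have hord : ∀ z, analyticOrderAt f z = (if z = ρ i then 1 else 0) + analyticOrderAt h z := by
      intro z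
      rw [← analyticOrderAt_one_sub_div (hρ i) z, ← analyticOrderAt_mul (by fun_prop)
        (hh.analyticAt z)]
      congr 1
      ext w
      simp [hfh w]
    obtain ⟨g, hg, hhg⟩ := ih hh (fun z => by
      have := hs z
      rw [hord] at this
      split_ifs at this with hz
      · have hins : ((insert i s : Finset ι) : Set ι) ∩ {j | ρ j = z}
            = insert i ((s : Set ι) ∩ {j | ρ j = z}) := by
          ext j
          simp only [Finset.coe_insert, Set.mem_inter_iff, Set.mem_insert_iff, Finset.mem_coe,
            Set.mem_ofPred_eq]
          constructor
          · rintro ⟨h1 | h1, h2⟩ <;> tauto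
          · rintro (h1 | h1)
            · subst h1; simp [hz]
            · tauto
        rw [hins, Set.encard_insert_of_notMem (by simp [hi]), add_comm] at this
        exact (ENat.add_le_add_iff_left (by simp)).1 this
      · rw [zero_add] at this
        refine le_trans (Set.encard_le_encard ?_) this
        gcongr
        simp)
    refine ⟨g, hg, fun z => ?_⟩
    rw [hfh, hhg, Finset.prod_insert hi, mul_assoc]

theorem Complex.norm_le_of_forall_sphere {g : ℂ → ℂ} (hg : Differentiable ℂ g) {r M : ℝ}
    (h : ∀ z, ‖z‖ = r → ‖g z‖ ≤ M) {z : ℂ} (hz : ‖z‖ ≤ r) : ‖g z‖ ≤ M := by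
  rcases eq_or_ne r 0 with hr | hr
  · exact h z (le_antisymm hz (hr ▸ norm_nonneg z))
  refine Complex.norm_le_of_forall_mem_frontier_norm_le (U := Metric.ball 0 r)
    Metric.isBounded_ball hg.diffContOnCl (fun w hw => h w ?_) ?_
  · rw [frontier_ball _ hr] at hw
    simpa using hw
  · rw [closure_ball _ hr]
    simpa using hz

/-- A crude Jensen inequality. On $|z|=4r$ each factor $1-z/\varrho$ has modulus at least $3$, so
the quotient of `f` by the product is at most $M/3^n$ there, hence also at $0$, where it equals `f
0`. -/
theorem three_pow_card_mul_norm_le {ι : Type*} {ρ : ι → ℂ} (hρ : ∀ i, ρ i ≠ 0)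
    (s : Finset ι) {f : ℂ → ℂ} (hf : Differentiable ℂ f)
    (hs : ∀ z, {i | ρ i = z}.encard ≤ analyticOrderAt f z) {r M : ℝ} (hr : 0 < r)
    (hsr : ∀ i ∈ s, ‖ρ i‖ ≤ r) (hM : ∀ z, ‖z‖ = 4 * r → ‖f z‖ ≤ M) :
    3 ^ s.card * ‖f 0‖ ≤ M := by
  obtain ⟨g, hg, hfg⟩ := hf.exists_eq_prod_mul hρ s
    (fun z => (Set.encard_le_encard Set.inter_subset_right).trans (hs z))
  have h0 : f 0 = g 0 := by simp [hfg]
  have : ‖g 0‖ ≤ M / 3 ^ s.card := by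
    refine Complex.norm_le_of_forall_sphere hg (r := 4 * r) (fun z hz => ?_) (by simp; positivity)
    rw [le_div_iff₀ (by positivity), mul_comm]
    refine le_trans ?_ (hM z hz)
    rw [hfg, norm_mul, norm_prod, ← Finset.prod_const]
    gcongr with i hi
    have hi' : 0 < ‖ρ i‖ := norm_pos_iff.2 (hρ i)
    have h1 : 4 ≤ ‖z / ρ i‖ := by
      rw [norm_div, hz, le_div_iff₀ hi']
      linarith [hsr i hi]
    have := norm_sub_norm_le (z / ρ i) 1
    rw [norm_sub_rev, norm_one] at this
    linarith
  rw [le_div_iff₀ (by positivity)] at this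
  rw [h0]; linarith

theorem finite_setOf_norm_le {ι : Type*} {ρ : ι → ℂ} (hρ : ∀ i, ρ i ≠ 0)
    {f : ℂ → ℂ} (hf : Differentiable ℂ f) (hf0 : f 0 ≠ 0)
    (hs : ∀ z, {i | ρ i = z}.encard ≤ analyticOrderAt f z) (r : ℝ) :
    {i | ‖ρ i‖ ≤ r}.Finite := by
  wlog hr : 0 < r
  · exact (this hρ hf hf0 hs 1 one_pos).subset (fun i (hi : ‖ρ i‖ ≤ r) => show ‖ρ i‖ ≤ 1 by linarith)
  obtain ⟨M, hM⟩ := (isCompact_sphere (0 : ℂ) (4 * r)).exists_bound_of_continuousOn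
    hf.continuous.continuousOn
  by_contra hinf
  obtain ⟨n, hn⟩ := pow_unbounded_of_one_lt (M / ‖f 0‖) (show (1 : ℝ) < 3 by norm_num)
  obtain ⟨t, ht, htn⟩ := Set.Infinite.exists_subset_card_eq hinf n
  have := three_pow_card_mul_norm_le hρ t hf hs hr (fun i hi => ht hi)
    (fun z hz => hM z (by simpa using hz))
  rw [div_lt_iff₀ (norm_pos_iff.2 hf0), ← htn] at hn
  linarith

/-! ### Logarithms on discs and the finite form of the Hadamard factorization. -/

theorem Complex.exists_exp_eq_of_ball {g : ℂ → ℂ} {r : ℝ} (hr : 0 < r)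
    (hg : DifferentiableOn ℂ g (Metric.ball 0 r)) (h0 : ∀ z ∈ Metric.ball (0 : ℂ) r, g z ≠ 0) :
    ∃ G : ℂ → ℂ, DifferentiableOn ℂ G (Metric.ball 0 r) ∧
      ∀ z ∈ Metric.ball (0 : ℂ) r, g z = Complex.exp (G z) := by
  have hg' : DifferentiableOn ℂ (deriv g) (Metric.ball 0 r) := hg.deriv Metric.isOpen_ball
  obtain ⟨G, hG0, hG⟩ := ((hg'.div hg h0).isExactOn_ball).with_val_at 0 (Complex.log (g 0))
  have h00 : (0 : ℂ) ∈ Metric.ball (0 : ℂ) r := by simpa using hr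
  refine ⟨G, fun z hz => (hG z hz).differentiableAt.differentiableWithinAt, fun z hz => ?_⟩
  have hconst : ∀ w ∈ Metric.ball (0 : ℂ) r,
      HasDerivAt (fun w => g w * Complex.exp (-G w)) 0 w := by
    intro w hw
    have h1 := (hg.differentiableAt (Metric.isOpen_ball.mem_nhds hw)).hasDerivAt
    convert! h1.mul ((hG w hw).neg.cexp) using 1
    have := h0 w hw
    simp only [Pi.div_apply]
    field_simp
    ring
  have := (convex_ball (0 : ℂ) r).is_const_of_fderivWithin_eq_zero (𝕜 := ℂ)
    (f := fun w => g w * Complex.exp (-G w))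
    (fun w hw => (hconst w hw).differentiableAt.differentiableWithinAt)
    (fun w hw => by
      rw [fderivWithin_of_isOpen Metric.isOpen_ball hw]
      ext; simp [(hconst w hw).deriv]) hz h00
  simp only [hG0] at this
  rw [Complex.exp_neg (Complex.log _), Complex.exp_log (h0 0 h00), mul_inv_cancel₀ (h0 0 h00),
    Complex.exp_neg, mul_inv_eq_one₀ (Complex.exp_ne_zero _)] at this
  exact this

/-- Borel–Carathéodory gives $|G|\le2M$ on $|w|\le r$. Two Cauchy estimates with radius $r/4$ bound
$G''$ by $2M/(r/4)^2$ on $|w|\le r/2$, and integrating twice gives the claim. -/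
theorem Complex.norm_sub_deriv_mul_le {G : ℂ → ℂ} {r M : ℝ} (hr : 0 < r) (hM : 0 < M)
    (hG : DifferentiableOn ℂ G (Metric.ball 0 (2 * r))) (h0 : G 0 = 0)
    (hre : ∀ z ∈ Metric.ball (0 : ℂ) (2 * r), (G z).re ≤ M) {z : ℂ} (hz : ‖z‖ ≤ r / 2) :
    ‖G z - deriv G 0 * z‖ ≤ 32 * M / r ^ 2 * ‖z‖ ^ 2 := by
  have hb : ∀ w : ℂ, ‖w‖ ≤ r → ‖G w‖ ≤ 2 * M := by
    intro w hw
    refine (Complex.borelCaratheodory_zero hM hG hre (by positivity)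
      (by simp; linarith) h0).trans ?_
    rw [div_le_iff₀ (by linarith)]
    nlinarith [norm_nonneg w]
  have hdiff : ∀ w : ℂ, ‖w‖ < 2 * r → DifferentiableAt ℂ G w := fun w hw =>
    hG.differentiableAt (Metric.isOpen_ball.mem_nhds (by simpa using hw))
  have hdiff' : ∀ w : ℂ, ‖w‖ < 2 * r → DifferentiableAt ℂ (deriv G) w := fun w hw =>
    (hG.deriv Metric.isOpen_ball).differentiableAt (Metric.isOpen_ball.mem_nhds (by simpa using hw))
  have hnorm : ∀ (w : ℂ) (y : ℂ) (t : ℝ), y ∈ Metric.closedBall w t → ‖y‖ ≤ ‖w‖ + t := by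
    intro w y t hy
    rw [mem_closedBall_iff_norm] at hy
    have := norm_le_norm_add_norm_sub' y w
    linarith
  have hb1 : ∀ w : ℂ, ‖w‖ ≤ 3 * r / 4 → ‖deriv G w‖ ≤ 2 * M / (r / 4) := by
    intro w hw
    refine Complex.norm_deriv_le_of_forall_mem_sphere_norm_le (by positivity) ?_ ?_
    · refine DifferentiableOn.diffContOnCl ?_
      intro y hy
      rw [closure_ball _ (by positivity)] at hy
      exact (hdiff y (by have := hnorm w y _ hy; linarith)).differentiableWithinAt
    · intro y hy
      exact hb y (by have := hnorm w y _ (Metric.sphere_subset_closedBall hy); linarith)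
  have hb2 : ∀ w : ℂ, ‖w‖ ≤ r / 2 → ‖deriv (deriv G) w‖ ≤ 32 * M / r ^ 2 := by
    intro w hw
    have : ‖deriv (deriv G) w‖ ≤ 2 * M / (r / 4) / (r / 4) := by
      refine Complex.norm_deriv_le_of_forall_mem_sphere_norm_le (by positivity) ?_ ?_
      · refine DifferentiableOn.diffContOnCl ?_
        intro y hy
        rw [closure_ball _ (by positivity)] at hy
        exact (hdiff' y (by have := hnorm w y _ hy; linarith)).differentiableWithinAt
      · intro y hy
        exact hb1 y (by have := hnorm w y _ (Metric.sphere_subset_closedBall hy); linarith)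
    refine this.trans (le_of_eq ?_)
    field_simp
    norm_num
  have h1 : ∀ w : ℂ, ‖w‖ ≤ ‖z‖ → ‖deriv G w - deriv G 0‖ ≤ 32 * M / r ^ 2 * ‖z‖ := by
    intro w hw
    have := (convex_closedBall (0 : ℂ) ‖z‖).norm_image_sub_le_of_norm_deriv_le (f := deriv G)
      (C := 32 * M / r ^ 2) (x := 0) (y := w)
      (fun y hy => hdiff' y (by simp at hy; linarith)) (fun y hy => hb2 y (by simp at hy; linarith))
      (by simp) (by simpa using hw)
    rw [sub_zero] at this
    refine this.trans ?_
    gcongr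
  have h2 : ∀ w : ℂ, ‖w‖ ≤ ‖z‖ →
      HasDerivAt (fun w => G w - deriv G 0 * w) (deriv G w - deriv G 0) w := by
    intro w hw
    have hw' : ‖w‖ < 2 * r := by linarith
    simpa using ((hdiff w hw').hasDerivAt).fun_sub ((hasDerivAt_id w).const_mul (deriv G 0))
  have := (convex_closedBall (0 : ℂ) ‖z‖).norm_image_sub_le_of_norm_deriv_le
      (f := fun w => G w - deriv G 0 * w)
      (C := 32 * M / r ^ 2 * ‖z‖) (x := 0) (y := z)
      (fun y hy => (h2 y (by simpa using hy)).differentiableAt)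
      (fun y hy => by rw [(h2 y (by simpa using hy)).deriv]; exact h1 y (by simpa using hy))
      (by simp) (by simp)
  simp only [h0, mul_zero, sub_zero] at this
  linarith

/-- Dividing out all zeros with $|\varrho|\le2r$ leaves a function without zeros in $|z|<2r$ and at
most $e^M$ times its value at $0$, because the divided factors have modulus at least $1$ on
$|z|=4r$. Its logarithm is linear up to `e`, with slope $f'(0)/f(0)+\sum1/\varrho$; the sum supplies
the factors $e^{z/\varrho}$. -/
theorem exists_eq_prod_mul_exp {ι : Type*} {ρ : ι → ℂ} (hρ : ∀ i, ρ i ≠ 0)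
    (s : Finset ι) {f : ℂ → ℂ} (hf : Differentiable ℂ f) (hf0 : f 0 ≠ 0)
    (hs : ∀ z, {i | ρ i = z}.encard = analyticOrderAt f z) {r M : ℝ} (hr : 0 < r) (hM0 : 0 < M)
    (hsr : ∀ i, i ∈ s ↔ ‖ρ i‖ ≤ 2 * r)
    (hM : ∀ z, ‖z‖ = 4 * r → ‖f z‖ ≤ ‖f 0‖ * Real.exp M) {z : ℂ} (hz : ‖z‖ ≤ r / 2) :
    ∃ e : ℂ, ‖e‖ ≤ 32 * M / r ^ 2 * ‖z‖ ^ 2 ∧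
      f z = f 0 * (∏ i ∈ s, (1 - z / ρ i) * Complex.exp (z / ρ i)) *
        Complex.exp (deriv f 0 / f 0 * z + e) := by
  classical
  obtain ⟨g, hg, hfg⟩ := hf.exists_eq_prod_mul hρ s
    (fun z => (Set.encard_le_encard Set.inter_subset_right).trans (hs z).le)
  have h0 : f 0 = g 0 := by simp [hfg]
  have hg0 : ∀ w ∈ Metric.ball (0 : ℂ) (2 * r), g w / g 0 ≠ 0 := by
    intro w hw
    refine div_ne_zero (fun hgw => ?_) (h0 ▸ hf0)
    obtain ⟨h, hh, hgh⟩ : ∃ h : ℂ → ℂ, Differentiable ℂ h ∧ ∀ z, g z = (1 - z / w) * h z := by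
      refine hg.exists_eq_one_sub_div_mul ?_ hgw
      rintro rfl
      exact hf0 (h0.trans hgw)
    have hw0 : w ≠ 0 := by
      rintro rfl
      exact hf0 (h0.trans hgw)
    have hfin : {i | ρ i = w}.Finite := s.finite_toSet.subset (fun i (hi : ρ i = w) => by
      rw [Finset.mem_coe, hsr, hi]
      exact le_of_lt (by simpa using hw))
    -- the order of `f` at `w` exceeds the number of indices
    have key : ∀ t : Finset ι, ∃ q : ℂ → ℂ, Differentiable ℂ q ∧
        ∀ z, (∏ i ∈ t, (1 - z / ρ i)) = (1 - z / w) ^ (t.filter (fun i => ρ i = w)).card * q z := by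
      intro t
      refine ⟨fun z => ∏ i ∈ t.filter (fun i => ¬ ρ i = w), (1 - z / ρ i), by fun_prop, fun z => ?_⟩
      rw [← Finset.prod_filter_mul_prod_filter_not t (fun i => ρ i = w)]
      congr 1
      rw [← Finset.prod_const]
      refine Finset.prod_congr rfl (fun i hi => ?_)
      rw [(Finset.mem_filter.1 hi).2]
    obtain ⟨q, hq, hsq⟩ := key s
    have horder : ((s.filter (fun i => ρ i = w)).card : ℕ∞) + 1 ≤ analyticOrderAt f w := by
      have : f = (fun z => (1 - z / w)) ^ ((s.filter (fun i => ρ i = w)).card + 1)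
          * (q * h) := by
        ext z
        simp only [Pi.mul_apply, Pi.pow_apply]
        rw [hfg, hsq, hgh]
        ring
      rw [this, analyticOrderAt_mul (by fun_prop) ((hq.mul hh).analyticAt w),
        analyticOrderAt_pow (by fun_prop), analyticOrderAt_one_sub_div hw0]
      simp
    have hcard : {i | ρ i = w}.encard = (s.filter (fun i => ρ i = w)).card := by
      rw [← Set.encard_coe_eq_coe_finsetCard]
      congr 1
      ext i
      simp only [Set.mem_ofPred_eq, Finset.coe_filter]
      refine ⟨fun hi => ⟨?_, hi⟩, fun hi => hi.2⟩
      rw [hsr, hi]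
      exact le_of_lt (by simpa using hw)
    rw [← hs w, hcard] at horder
    have : (s.filter (fun i => ρ i = w)).card + 1 ≤ (s.filter (fun i => ρ i = w)).card := by
      exact_mod_cast horder
    omega
  have hgdiff : Differentiable ℂ (fun w => g w / g 0) := hg.div_const _
  obtain ⟨G₁, hG₁, hgG₁⟩ := Complex.exists_exp_eq_of_ball (by positivity : 0 < 2 * r)
    hgdiff.differentiableOn hg0
  have h00 : (0 : ℂ) ∈ Metric.ball (0 : ℂ) (2 * r) := by simp; exact hr
  obtain ⟨G, hGdef⟩ : ∃ G : ℂ → ℂ, G = fun w => G₁ w - G₁ 0 := ⟨_, rfl⟩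
  have hG : DifferentiableOn ℂ G (Metric.ball 0 (2 * r)) := by rw [hGdef]; exact hG₁.sub_const _
  have hG0 : G 0 = 0 := by simp [hGdef]
  have hgG : ∀ w ∈ Metric.ball (0 : ℂ) (2 * r), g w / g 0 = Complex.exp (G w) := by
    intro w hw
    have := hgG₁ 0 h00
    rw [div_self (h0 ▸ hf0)] at this
    simp only [hGdef]
    rw [Complex.exp_sub, ← this, div_one, hgG₁ w hw]
  have hbound : ∀ w : ℂ, ‖w‖ ≤ 4 * r → ‖g w / g 0‖ ≤ Real.exp M := by
    intro w hw
    refine Complex.norm_le_of_forall_sphere hgdiff (r := 4 * r) (fun y hy => ?_) hw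
    rw [norm_div, div_le_iff₀ (norm_pos_iff.2 (h0 ▸ hf0)), mul_comm, ← h0]
    refine le_trans ?_ (hM y hy)
    rw [hfg y, norm_mul, norm_prod]
    refine le_mul_of_one_le_left (norm_nonneg _) ?_
    rw [← Finset.prod_const_one (s := s)]
    gcongr with i hi
    have hi' : 0 < ‖ρ i‖ := norm_pos_iff.2 (hρ i)
    have h1 : 2 ≤ ‖y / ρ i‖ := by
      rw [norm_div, hy, le_div_iff₀ hi']
      linarith [(hsr i).1 hi]
    have := norm_sub_norm_le (y / ρ i) 1
    rw [norm_sub_rev, norm_one] at this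
    linarith
  have hre : ∀ w ∈ Metric.ball (0 : ℂ) (2 * r), (G w).re ≤ M := by
    intro w hw
    have := hbound w (by simp at hw; linarith)
    rwa [hgG w hw, Complex.norm_exp, Real.exp_le_exp] at this
  have hderiv : deriv f 0 / f 0 = deriv G 0 - ∑ i ∈ s, 1 / ρ i := by
    have hGd : HasDerivAt G (deriv G 0) 0 :=
      (hG.differentiableAt (Metric.isOpen_ball.mem_nhds h00)).hasDerivAt
    have hev : f =ᶠ[nhds 0] fun w => g 0 * ((∏ i ∈ s, (1 - w / ρ i)) * Complex.exp (G w)) := by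
      filter_upwards [Metric.isOpen_ball.mem_nhds h00] with w hw
      rw [hfg, ← hgG w hw]
      field_simp [show g 0 ≠ 0 from h0 ▸ hf0]
    have hp : HasDerivAt (fun w : ℂ => ∏ i ∈ s, (1 - w / ρ i)) (∑ i ∈ s, -(1 / ρ i)) 0 := by
      have := HasDerivAt.fun_finsetProd (u := s) (x := (0 : ℂ)) (f := fun i w => 1 - w / ρ i)
        (f' := fun i => -(1 / ρ i))
        (fun i _ => ((hasDerivAt_id (0 : ℂ)).div_const (ρ i)).const_sub 1)
      simpa using this
    have := ((hp.mul hGd.cexp).const_mul (g 0)).congr_of_eventuallyEq hev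
    rw [this.deriv, h0, mul_comm, mul_div_assoc, div_self (h0 ▸ hf0)]
    simp [hG0]
    ring
  have hzb : z ∈ Metric.ball (0 : ℂ) (2 * r) := by simp; linarith
  refine ⟨G z - deriv G 0 * z, Complex.norm_sub_deriv_mul_le hr hM0 hG hG0 hre hz, ?_⟩
  rw [hfg z, show g z = f 0 * Complex.exp (G z) by rw [← hgG z hzb, h0]; field_simp [show g 0 ≠ 0 from h0 ▸ hf0],
    Finset.prod_mul_distrib, ← Complex.exp_sum, hderiv]
  have : Complex.exp (G z) = Complex.exp (∑ i ∈ s, z / ρ i) *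
      Complex.exp ((deriv G 0 - ∑ i ∈ s, 1 / ρ i) * z + (G z - deriv G 0 * z)) := by
    rw [← Complex.exp_add]
    congr 1
    have : ∑ i ∈ s, z / ρ i = (∑ i ∈ s, 1 / ρ i) * z := by
      rw [Finset.sum_mul]
      exact Finset.sum_congr rfl (fun i _ => by ring)
    rw [this]; ring
  rw [this]; ring

/-! ### Convergence of genus one products and Hadamard's theorem. -/

theorem Complex.norm_one_sub_mul_exp_sub_one_le {z : ℂ} (hz : ‖z‖ ≤ 1) :
    ‖(1 - z) * Complex.exp z - 1‖ ≤ 3 * ‖z‖ ^ 2 := by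
  have h := Complex.norm_exp_sub_one_sub_id_le hz
  have : (1 - z) * Complex.exp z - 1 = (1 - z) * (Complex.exp z - 1 - z) - z ^ 2 := by ring
  rw [this]
  have h1 : ‖1 - z‖ ≤ 2 := (norm_sub_le _ _).trans (by rw [norm_one]; linarith)
  calc _ ≤ ‖1 - z‖ * ‖Complex.exp z - 1 - z‖ + ‖z‖ ^ 2 := by
        refine (norm_sub_le _ _).trans ?_
        rw [norm_mul, norm_pow]
    _ ≤ 2 * ‖z‖ ^ 2 + ‖z‖ ^ 2 := by gcongr
    _ = _ := by ring

-- On a compact set all but finitely many factors are $1+O(|\varrho|^{-2})$; the exceptions are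
-- those with $|z/\varrho|>1$ for some $z$ in the set.
open Filter in
theorem multipliableLocallyUniformly_one_sub_mul_exp {ι : Type*} {ρ : ι → ℂ}
    (hsum : Summable fun i => (‖ρ i‖ ^ 2)⁻¹) :
    MultipliableLocallyUniformly
      (fun (i : ι) (z : ℂ) => (1 - z / ρ i) * Complex.exp (z / ρ i)) := by
  refine ⟨fun z => ∏' i, (1 + ((1 - z / ρ i) * Complex.exp (z / ρ i) - 1)), ?_⟩
  refine hasProdLocallyUniformly_of_forall_compact (fun K hK => ?_)
  obtain ⟨B, hB⟩ := hK.isBounded.exists_norm_le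
  have hev : ∀ᶠ i in cofinite, ∀ z ∈ K,
      ‖(1 - z / ρ i) * Complex.exp (z / ρ i) - 1‖ ≤ 3 * B ^ 2 * (‖ρ i‖ ^ 2)⁻¹ := by
    have h1 := (hsum.mul_left (B ^ 2)).tendsto_cofinite_zero.eventually_lt_const one_pos
    filter_upwards [h1] with i hi z hz
    have h2 : ‖z / ρ i‖ ^ 2 ≤ B ^ 2 * (‖ρ i‖ ^ 2)⁻¹ := by
      rw [norm_div, div_pow, div_eq_mul_inv]
      have := hB z hz
      gcongr
    have h3 : ‖z / ρ i‖ ≤ 1 := by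
      rw [← sq_le_one_iff₀ (norm_nonneg _)]
      linarith
    refine (Complex.norm_one_sub_mul_exp_sub_one_le h3).trans ?_
    linarith
  have := Summable.hasProdUniformlyOn_one_add hK (hsum.mul_left (3 * B ^ 2)) hev
    (fun i => by fun_prop)
  simpa using this

theorem card_le_of_growth {ι : Type*} {ρ : ι → ℂ} (hρ : ∀ i, ρ i ≠ 0)
    (s : Finset ι) {f : ℂ → ℂ} (hf : Differentiable ℂ f) (hf0 : f 0 ≠ 0)
    (hs : ∀ z, {i | ρ i = z}.encard ≤ analyticOrderAt f z) {r M : ℝ} (hr : 0 < r)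
    (hsr : ∀ i ∈ s, ‖ρ i‖ ≤ r) (hM : ∀ z, ‖z‖ = 4 * r → ‖f z‖ ≤ ‖f 0‖ * Real.exp M) :
    (s.card : ℝ) ≤ M := by
  have h := three_pow_card_mul_norm_le hρ s hf hs hr hsr hM
  rw [mul_comm, mul_le_mul_iff_right₀ (norm_pos_iff.2 hf0)] at h
  have h3 : Real.exp s.card ≤ 3 ^ s.card := by
    rw [← mul_one (s.card : ℝ), Real.exp_nat_mul]
    gcongr
    exact Real.exp_one_lt_three.le
  exact Real.exp_le_exp.1 (h3.trans h)

/-- Radii $4^k$ turn the growth exponent $3/2$ into integer powers: $O(8^k)$ against $r^2=16^k$. -/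
theorem Real.four_pow_rpow (k : ℕ) : ((4 : ℝ) ^ k) ^ (3 / 2 : ℝ) = 8 ^ k := by
  rw [← Real.rpow_natCast, ← Real.rpow_natCast, show (8 : ℝ) = 4 ^ (3 / 2 : ℝ) by
    rw [show (4 : ℝ) = 2 ^ (2 : ℝ) by norm_num, ← Real.rpow_mul (by norm_num)]; norm_num,
    ← Real.rpow_mul (by norm_num), ← Real.rpow_mul (by norm_num), mul_comm]

-- The disc $|z|\le4^k$ contains $O(8^k)$ zeros. Giving each of them weight $16^{-k}$ for every such
-- `k` costs $O(\sum2^{-k})$ in all, and this dominates $\sum|\varrho|^{-2}$.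
open Filter in
theorem summable_inv_norm_sq_of_growth {ι : Type*} {ρ : ι → ℂ} (hρ : ∀ i, ρ i ≠ 0)
    {f : ℂ → ℂ} (hf : Differentiable ℂ f) (hf0 : f 0 ≠ 0)
    (hs : ∀ z, {i | ρ i = z}.encard ≤ analyticOrderAt f z) {C : ℝ}
    (hC : ∀ z, ‖f z‖ ≤ ‖f 0‖ * Real.exp (C * (1 + ‖z‖ ^ (3 / 2 : ℝ)))) :
    Summable fun i => (‖ρ i‖ ^ 2)⁻¹ := by
  classical
  have hfin := finite_setOf_norm_le hρ hf hf0 hs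
  -- If $4^k\le|\varrho|<4^{k+1}$, the single term `F (k + 1, i)` is already at least
  -- $\frac1{16}|\varrho|^{-2}$; summing in the other order then bounds the series.
  let F : ℕ × ι → ℝ := fun p => if ‖ρ p.2‖ ≤ 4 ^ p.1 then (16 ^ p.1)⁻¹ else 0
  have hF0 : 0 ≤ F := fun p => by
    simp only [F]
    split_ifs <;> simp
  have hsupp : ∀ k i, i ∉ (hfin (4 ^ k)).toFinset → F (k, i) = 0 := by
    intro k i hi
    have : ¬ ‖ρ i‖ ≤ 4 ^ k := by simpa using hi
    simp only [F, if_neg this]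
  have hC0 : 0 ≤ C := by
    have := hC 0
    rw [le_mul_iff_one_le_right (norm_pos_iff.2 hf0), Real.one_le_exp_iff] at this
    simpa using this
  have htsum : ∀ k, ∑' i, F (k, i) ≤ 9 * C * (1 / 2 : ℝ) ^ k := by
    intro k
    rw [tsum_eq_sum (fun i hi => hsupp k i hi)]
    have hcard := card_le_of_growth hρ (hfin (4 ^ k)).toFinset hf hf0 hs (r := 4 ^ k)
      (M := C * (1 + (4 * 4 ^ k) ^ (3 / 2 : ℝ))) (by positivity) (fun i hi => by simpa using hi)
      (fun z hz => by rw [← hz]; exact hC z)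
    calc _ ≤ ∑ i ∈ (hfin (4 ^ k)).toFinset, ((16 : ℝ) ^ k)⁻¹ := by
          refine Finset.sum_le_sum (fun i _ => ?_)
          simp only [F]
          split_ifs
          · exact le_rfl
          · positivity
      _ = (hfin (4 ^ k)).toFinset.card * ((16 : ℝ) ^ k)⁻¹ := by simp
      _ ≤ (9 * C * 8 ^ k) * ((16 : ℝ) ^ k)⁻¹ := by
          gcongr
          refine hcard.trans ?_
          rw [← pow_succ', Real.four_pow_rpow, pow_succ]
          have : (1 : ℝ) ≤ 8 ^ k := one_le_pow₀ (by norm_num)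
          nlinarith
      _ = _ := by
          rw [mul_assoc, ← inv_pow, ← mul_pow]
          norm_num
  have hFsum : Summable F := by
    rw [summable_prod_of_nonneg hF0]
    refine ⟨fun k => summable_of_ne_finset_zero (s := (hfin (4 ^ k)).toFinset) (hsupp k), ?_⟩
    refine Summable.of_nonneg_of_le (fun k => tsum_nonneg (fun i => hF0 _)) htsum ?_
    exact (summable_geometric_of_lt_one (by norm_num) (by norm_num)).mul_left _
  have hsw := hFsum.prod_symm
  have hA : Summable fun i => 16 * ∑' k, F (k, i) := (hsw.prod).mul_left 16
  refine Summable.of_norm_bounded_eventually hA ?_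
  have hcof : ∀ᶠ i in cofinite, 1 < ‖ρ i‖ := by
    rw [eventually_cofinite]
    simpa using hfin 1
  filter_upwards [hcof] with i hi
  obtain ⟨k, hk, hk'⟩ := exists_nat_pow_near hi.le (show (1 : ℝ) < 4 by norm_num)
  have h1 : F (k + 1, i) ≤ ∑' k, F (k, i) :=
    (hsw.prod_factor i).le_tsum (k + 1) (fun j _ => hF0 _)
  have h2 : F (k + 1, i) = (16 ^ (k + 1))⁻¹ := if_pos hk'.le
  rw [norm_inv, norm_pow, norm_norm]
  refine le_trans ?_ (mul_le_mul_of_nonneg_left h1 (by norm_num))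
  have h3 : 16 * ((16 : ℝ) ^ (k + 1))⁻¹ = (16 ^ k)⁻¹ := by
    rw [pow_succ]
    field_simp
  rw [h2, h3]
  apply inv_anti₀ (by positivity)
  rw [show (16 : ℝ) = 4 ^ 2 by norm_num, ← pow_mul, mul_comm, pow_mul]
  gcongr

open Filter Topology in
/-- **Hadamard factorization** in genus one. -/
theorem eq_mul_exp_mul_tprod_of_growth {ι : Type*} {ρ : ι → ℂ} (hρ : ∀ i, ρ i ≠ 0)
    {f : ℂ → ℂ} (hf : Differentiable ℂ f) (hf0 : f 0 ≠ 0)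
    (hs : ∀ z, {i | ρ i = z}.encard = analyticOrderAt f z) {C : ℝ}
    (hC : ∀ z, ‖f z‖ ≤ ‖f 0‖ * Real.exp (C * (1 + ‖z‖ ^ (3 / 2 : ℝ)))) (z : ℂ) :
    f z = f 0 * Complex.exp (deriv f 0 / f 0 * z) *
      ∏' i, (1 - z / ρ i) * Complex.exp (z / ρ i) := by
  classical
  have hfin := finite_setOf_norm_le hρ hf hf0 (fun z => (hs z).le)
  wlog hC0 : 0 < C generalizing C
  · refine this (C := 1) (fun w => (hC w).trans ?_) one_pos
    gcongr
    linarith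
  have hmul := (multipliableLocallyUniformly_one_sub_mul_exp
    (summable_inv_norm_sq_of_growth hρ hf hf0 (fun z => (hs z).le) hC)).multipliable (x := z)
  let s : ℕ → Finset ι := fun k => (hfin (2 * 4 ^ k)).toFinset
  have hs_mem : ∀ k i, i ∈ s k ↔ ‖ρ i‖ ≤ 2 * 4 ^ k := fun k i => by simp [s]
  have hs_top : Tendsto s atTop atTop := by
    refine tendsto_atTop_finset_of_monotone (fun a b hab i hi => ?_) (fun i => ?_)
    · rw [hs_mem] at hi ⊢
      refine hi.trans ?_
      gcongr
      norm_num
    · obtain ⟨n, hn⟩ := pow_unbounded_of_one_lt ‖ρ i‖ (show (1 : ℝ) < 4 by norm_num)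
      refine ⟨n, ?_⟩
      rw [hs_mem]
      have : (0 : ℝ) < 4 ^ n := by positivity
      linarith
  have hprod := hmul.hasProd.comp hs_top
  -- With $r=4^k$ one has $M=C(1+8^{k+1})\le9C\,8^k$, so the error $32M|z|^2/r^2$ is at most
  -- $288\,C|z|^2\,2^{-k}$. The condition on `k` stays inside the existential so that `e` is defined
  -- for every `k`.
  have hex : ∀ k : ℕ, ∃ e : ℂ, 2 * ‖z‖ ≤ 4 ^ k →
      ‖e‖ ≤ 288 * C * ‖z‖ ^ 2 * (1 / 2) ^ k ∧
      f z = f 0 * (∏ i ∈ s k, (1 - z / ρ i) * Complex.exp (z / ρ i)) *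
        Complex.exp (deriv f 0 / f 0 * z + e) := by
    intro k
    by_cases hk : 2 * ‖z‖ ≤ 4 ^ k
    · obtain ⟨e, he, h⟩ := exists_eq_prod_mul_exp hρ (s k) hf hf0 hs (r := 4 ^ k)
        (M := C * (1 + (4 * 4 ^ k) ^ (3 / 2 : ℝ))) (by positivity) (by positivity)
        (hs_mem k) (fun w hw => by rw [← hw]; exact hC w) (z := z) (by linarith)
      refine ⟨e, fun _ => ⟨he.trans ?_, h⟩⟩
      rw [← pow_succ', Real.four_pow_rpow, pow_succ]
      have h8 : (1 : ℝ) ≤ 8 ^ k := one_le_pow₀ (by norm_num)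
      have h16 : ((4 : ℝ) ^ k) ^ 2 = 8 ^ k * 2 ^ k := by
        rw [← pow_mul, mul_comm, pow_mul, ← mul_pow]; norm_num
      rw [h16]
      calc _ ≤ 32 * (C * (9 * 8 ^ k)) / (8 ^ k * 2 ^ k) * ‖z‖ ^ 2 := by
            gcongr
            linarith
        _ = _ := by
            rw [one_div, inv_pow]
            field_simp
            ring
    · exact ⟨0, fun h => absurd h hk⟩
  choose e he using hex
  have hev : ∀ᶠ k : ℕ in atTop, 2 * ‖z‖ ≤ 4 ^ k :=
    (tendsto_pow_atTop_atTop_of_one_lt (by norm_num : (1 : ℝ) < 4)).eventually_ge_atTop _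
  have he0 : Tendsto e atTop (𝓝 0) := by
    refine squeeze_zero_norm' (hev.mono (fun k hk => (he k hk).1)) ?_
    simpa using (tendsto_pow_atTop_nhds_zero_of_lt_one (by norm_num : (0 : ℝ) ≤ 1 / 2)
      (by norm_num)).const_mul (288 * C * ‖z‖ ^ 2)
  have hlim := (hprod.const_mul (f 0)).mul
    ((Complex.continuous_exp.tendsto _).comp (he0.const_add (deriv f 0 / f 0 * z)))
  have hconst : Tendsto (fun _ : ℕ => f z) atTop (𝓝 (f z)) := tendsto_const_nhds
  have := tendsto_nhds_unique (hconst.congr' (hev.mono (fun k hk => (he k hk).2))) hlim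
  rw [this, add_zero]
  ring

/-! ### Infinitely many zeros in a half plane, by Phragmén–Lindelöf. -/

open Filter Topology Asymptotics in
/-- A bounded holomorphic function on the upper half plane which decays exponentially along the
positive real axis vanishes on the imaginary axis. -/
theorem Complex.eq_zero_of_bounded_of_exp_decay {H : ℂ → ℂ}
    (hH : DifferentiableOn ℂ H {z | -1 < z.im}) {C c : ℝ} (hc : 0 < c)
    (hb : ∀ z : ℂ, 0 ≤ z.im → ‖H z‖ ≤ C) (hdec : ∀ x : ℝ, 0 ≤ x → ‖H x‖ ≤ C * Real.exp (-c * x))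
    {y : ℝ} (hy : 0 < y) : H (y * Complex.I) = 0 := by
  have hC : 0 ≤ C := (norm_nonneg _).trans (hb 0 (by simp))
  -- Since $|e^{cz}|=1$ on the imaginary axis, $H(z)e^{cz}$ is bounded by `C` on both edges of the
  -- first quadrant; its order $1$ is below the critical $2$.
  have hquad : ∀ z : ℂ, 0 ≤ z.re → 0 ≤ z.im → ‖H z‖ ≤ C * Real.exp (-c * z.re) := by
    intro z hz hz'
    have hcl : closure (Set.Ioi (0 : ℝ) ×ℂ Set.Ioi (0 : ℝ)) ⊆ {z : ℂ | -1 < z.im} := by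
      rw [Complex.closure_reProdIm, closure_Ioi]
      intro w hw
      have : 0 ≤ w.im := hw.2
      simp only [Set.mem_ofPred_eq]
      linarith
    have hd : DiffContOnCl ℂ (fun z => H z * Complex.exp (c * z))
        (Set.Ioi (0 : ℝ) ×ℂ Set.Ioi (0 : ℝ)) := by
      refine DifferentiableOn.diffContOnCl ?_
      exact (hH.mono hcl).mul (by fun_prop)
    have hgrow : ∃ d < (2 : ℝ), ∃ B, (fun z => H z * Complex.exp (c * z)) =O[
        Bornology.cobounded ℂ ⊓ 𝓟 (Set.Ioi (0 : ℝ) ×ℂ Set.Ioi (0 : ℝ))]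
        fun z => Real.exp (B * ‖z‖ ^ d) := by
      refine ⟨1, by norm_num, c, IsBigO.of_bound C ?_⟩
      filter_upwards [mem_inf_of_right (mem_principal_self _)] with w hw
      have hw2 : 0 ≤ w.im := le_of_lt hw.2
      rw [norm_mul, Complex.norm_exp, Real.norm_eq_abs, Real.abs_exp, Real.rpow_one]
      refine mul_le_mul (hb w hw2) (Real.exp_le_exp.2 ?_) (by positivity) hC
      simp only [Complex.mul_re, Complex.ofReal_re, Complex.ofReal_im, zero_mul, sub_zero]
      gcongr
      exact Complex.re_le_norm w
    have := PhragmenLindelof.quadrant_I hd hgrow (C := C) (z := z)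
      (fun x hx => by
        rw [norm_mul, Complex.norm_exp, ← Complex.ofReal_mul, Complex.ofReal_re]
        calc _ ≤ C * Real.exp (-c * x) * Real.exp (c * x) := by gcongr; exact hdec x hx
          _ = C := by rw [mul_assoc, ← Real.exp_add]; simp)
      (fun x hx => by
        rw [norm_mul, Complex.norm_exp]
        simpa using hb (x * Complex.I) (by simpa using hx))
      hz hz'
    rw [norm_mul, Complex.norm_exp] at this
    simp only [Complex.mul_re, Complex.ofReal_re, Complex.ofReal_im, zero_mul, sub_zero] at this
    rwa [neg_mul, Real.exp_neg, ← div_eq_mul_inv, le_div_iff₀ (Real.exp_pos _)]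
  -- Multiply by $e^{\alpha z}$ with $\alpha=c/2-iq$, which has modulus $e^{qy}$ at $iy$. The angle
  -- `ε` satisfies $q\sin\varepsilon=\frac c2\cos\varepsilon$: on the ray of argument `ε` the growth
  -- of $e^{\alpha z}$ exactly matches the decay from `hquad`, and on the ray of argument
  -- $\pi-\varepsilon$ its modulus is $1$.
  have hmain : ∀ q : ℝ, 0 < q → ‖H (y * Complex.I)‖ ≤ C * Real.exp (-(q * y)) := by
    intro q hq
    obtain ⟨ε, hε⟩ : ∃ ε, ε = Real.arctan (c / (2 * q)) := ⟨_, rfl⟩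
    have hε0 : 0 < ε := by rw [hε]; exact Real.arctan_pos.2 (by positivity)
    have hε1 : ε < Real.pi / 2 := by rw [hε]; exact Real.arctan_lt_pi_div_two _
    have hcos : 0 < Real.cos ε := Real.cos_pos_of_mem_Ioo ⟨by linarith, hε1⟩
    have htan : q * Real.sin ε = c / 2 * Real.cos ε := by
      have h1 : Real.tan ε = c / (2 * q) := by rw [hε, Real.tan_arctan]
      rw [Real.tan_eq_sin_div_cos, div_eq_div_iff hcos.ne' (by positivity)] at h1
      linarith
    let α : ℂ := c / 2 - q * Complex.I
    have hre : ∀ w : ℂ, (α * Complex.exp w).re =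
        Real.exp w.re * (c / 2 * Real.cos w.im + q * Real.sin w.im) := by
      intro w
      simp only [α, Complex.mul_re, Complex.exp_re, Complex.exp_im, Complex.sub_re, Complex.sub_im,
        Complex.mul_im, Complex.ofReal_re, Complex.ofReal_im, Complex.I_re, Complex.I_im]
      simp [Complex.div_ofNat_re, Complex.div_ofNat_im]
      ring
    have hnn : ∀ w : ℂ, 0 ≤ w.im → w.im ≤ Real.pi → 0 ≤ (Complex.exp w).im := by
      intro w h1 h2
      rw [Complex.exp_im]
      exact mul_nonneg (Real.exp_pos _).le (Real.sin_nonneg_of_nonneg_of_le_pi h1 h2)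
    have hnormK : ∀ w : ℂ, ‖H (Complex.exp w) * Complex.exp (α * Complex.exp w)‖ =
        ‖H (Complex.exp w)‖ *
          Real.exp (Real.exp w.re * (c / 2 * Real.cos w.im + q * Real.sin w.im)) := by
      intro w
      rw [norm_mul, Complex.norm_exp, hre]
    have hd : DiffContOnCl ℂ (fun w => H (Complex.exp w) * Complex.exp (α * Complex.exp w))
        (Complex.im ⁻¹' Set.Ioo ε (Real.pi - ε)) := by
      refine DifferentiableOn.diffContOnCl ?_
      rw [Complex.closure_preimage_im, closure_Ioo (by linarith)]
      refine DifferentiableOn.mul (hH.comp (by fun_prop) ?_) (by fun_prop)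
      intro w hw
      have := hnn w (by linarith [hw.1]) (by linarith [hw.2])
      simp only [Set.mem_ofPred_eq]
      linarith
    -- In the variable $w=\log z$ the sector is a strip of width $\pi-2\varepsilon$; that this is
    -- less than $\pi$ is what admits growth of order $1$.
    have hgrow : ∃ d < Real.pi / (Real.pi - ε - ε), ∃ B,
        (fun w => H (Complex.exp w) * Complex.exp (α * Complex.exp w)) =O[
        comap (_root_.abs ∘ Complex.re) atTop ⊓ 𝓟 (Complex.im ⁻¹' Set.Ioo ε (Real.pi - ε))]
        fun w => Real.exp (B * Real.exp (d * |w.re|)) := by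
      refine ⟨1, by rw [lt_div_iff₀ (by linarith)]; linarith, c / 2 + q, IsBigO.of_bound C ?_⟩
      filter_upwards [mem_inf_of_right (mem_principal_self _)] with w hw
      rw [hnormK, Real.norm_eq_abs, Real.abs_exp]
      refine mul_le_mul (hb _ (hnn w (by linarith [hw.1]) (by linarith [hw.2])))
        (Real.exp_le_exp.2 ?_) (by positivity) hC
      rw [mul_comm, one_mul]
      have h1 : Real.exp w.re ≤ Real.exp |w.re| := Real.exp_le_exp.2 (le_abs_self _)
      have h2 := Real.cos_le_one w.im
      have h3 := Real.sin_le_one w.im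
      refine mul_le_mul ?_ h1 (Real.exp_pos _).le (by positivity)
      nlinarith
    have := PhragmenLindelof.horizontal_strip hd hgrow (C := C)
      (z := Real.log y + Real.pi / 2 * Complex.I) ?_ ?_ ?_ ?_
    · rw [hnormK, Complex.exp_add, Complex.exp_pi_div_two_mul_I, ← Complex.ofReal_exp,
        Real.exp_log hy] at this
      simp [Real.exp_log hy] at this
      rw [Real.exp_neg, ← div_eq_mul_inv, le_div_iff₀ (Real.exp_pos _), mul_comm q]
      exact this
    · intro w hw
      rw [hnormK, hw]
      have h1 : (Complex.exp w).re = Real.exp w.re * Real.cos ε := by rw [Complex.exp_re, hw]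
      calc _ ≤ C * Real.exp (-c * (Complex.exp w).re) *
            Real.exp (Real.exp w.re * (c / 2 * Real.cos ε + q * Real.sin ε)) := by
            gcongr
            refine hquad _ ?_ (hnn w (by linarith) (by linarith))
            rw [h1]; positivity
        _ = C := by
          rw [mul_assoc, ← Real.exp_add, h1, htan]
          ring_nf
          simp
    · intro w hw
      rw [hnormK, hw, Real.cos_pi_sub, Real.sin_pi_sub, htan]
      simpa using hb _ (hnn w (by linarith) (by linarith))
    · simp [Complex.div_ofNat_re]
      linarith
    · simp [Complex.div_ofNat_re]
      linarith
  have hlim : Tendsto (fun q : ℝ => C * Real.exp (-(q * y))) atTop (𝓝 (C * 0)) :=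
    (Real.tendsto_exp_neg_atTop_nhds_zero.comp (tendsto_id.atTop_mul_const hy)).const_mul C
  rw [mul_zero] at hlim
  have := ge_of_tendsto hlim ((eventually_gt_atTop 0).mono hmain)
  exact norm_le_zero_iff.1 this

/-- The logarithmic derivative of a zero-free function of finite order on a half plane grows at
most polynomially. -/
theorem norm_logDeriv_le_of_zero_free {f : ℂ → ℂ} (hf : Differentiable ℂ f) {C : ℝ}
    (hC : ∀ z, ‖f z‖ ≤ Real.exp (C * (1 + ‖z‖ ^ 2))) (h0 : ∀ z : ℂ, -2 < z.im → f z ≠ 0) :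
    ∃ K, ∀ z : ℂ, 0 ≤ z.im → ‖deriv f z / f z‖ ≤ K * ‖z + Complex.I‖ ^ 8 := by
  wlog hC0 : 0 < C generalizing C
  · refine this (C := 1) (fun w => (hC w).trans ?_) one_pos
    gcongr
    linarith
  -- A Cayley map from the unit disc to $\operatorname{Im}z>-2$, where a logarithm `G` of
  -- $f\circ\varphi$ exists with real part $O((1-|w|)^{-2})$.
  let φ : ℂ → ℂ := fun w => -2 * Complex.I + Complex.I * (1 + w) / (1 - w)
  have hball : ∀ w ∈ Metric.ball (0 : ℂ) 1, 0 < 1 - ‖w‖ ∧ 1 - ‖w‖ ≤ ‖1 - w‖ := by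
    intro w hw
    have h1 : ‖w‖ < 1 := by simpa using hw
    have := norm_sub_norm_le 1 w
    rw [norm_one] at this
    exact ⟨by linarith, this⟩
  have hne : ∀ w ∈ Metric.ball (0 : ℂ) 1, 1 - w ≠ 0 := by
    intro w hw
    have := hball w hw
    exact norm_pos_iff.1 (by linarith)
  have hφ : ∀ w ∈ Metric.ball (0 : ℂ) 1, HasDerivAt φ (2 * Complex.I / (1 - w) ^ 2) w := by
    intro w hw
    have h1 : HasDerivAt (fun w : ℂ => Complex.I * (1 + w)) Complex.I w := by
      simpa using ((hasDerivAt_id w).const_add 1).const_mul Complex.I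
    have h2 : HasDerivAt (fun w : ℂ => 1 - w) (-1) w := (hasDerivAt_id w).const_sub 1
    refine ((h1.fun_div h2 (hne w hw)).const_add (-2 * Complex.I)).congr_deriv ?_
    congr 1
    ring
  have him : ∀ w ∈ Metric.ball (0 : ℂ) 1, -2 < (φ w).im := by
    intro w hw
    have h1 := hne w hw
    have h2 : (Complex.I * (1 + w) / (1 - w)).im = (1 - ‖w‖ ^ 2) / Complex.normSq (1 - w) := by
      rw [Complex.div_im, ← Complex.normSq_eq_norm_sq, Complex.normSq_apply w]
      simp
      ring
    have h3 : 0 < (1 - ‖w‖ ^ 2) / Complex.normSq (1 - w) := by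
      have := hball w hw
      refine div_pos ?_ (Complex.normSq_pos.2 h1)
      nlinarith [norm_nonneg w]
    simp only [φ, Complex.add_im, h2]
    simpa using h3
  have hfφ : DifferentiableOn ℂ (fun w => f (φ w)) (Metric.ball 0 1) := fun w hw =>
    ((hf (φ w)).comp w (hφ w hw).differentiableAt).differentiableWithinAt
  obtain ⟨G, hG, hGf⟩ := Complex.exists_exp_eq_of_ball one_pos hfφ
    (fun w hw => h0 _ (him w hw))
  have hφn : ∀ w ∈ Metric.ball (0 : ℂ) 1, ‖φ w‖ ≤ 4 / (1 - ‖w‖) := by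
    intro w hw
    obtain ⟨h1, h2⟩ := hball w hw
    calc ‖φ w‖ ≤ ‖-2 * Complex.I‖ + ‖Complex.I * (1 + w) / (1 - w)‖ := norm_add_le _ _
      _ = 2 + ‖1 + w‖ / ‖1 - w‖ := by simp
      _ ≤ 2 / (1 - ‖w‖) + 2 / (1 - ‖w‖) := by
          gcongr
          · rw [le_div_iff₀ h1]
            nlinarith [norm_nonneg w]
          · refine (norm_add_le _ _).trans ?_
            rw [norm_one]; linarith
      _ = _ := by ring
  have hGre : ∀ w ∈ Metric.ball (0 : ℂ) 1, (G w).re ≤ 17 * C / (1 - ‖w‖) ^ 2 := by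
    intro w hw
    obtain ⟨h1, h2⟩ := hball w hw
    have := hC (φ w)
    rw [hGf w hw, Complex.norm_exp, Real.exp_le_exp] at this
    refine this.trans ?_
    calc C * (1 + ‖φ w‖ ^ 2) ≤ C * (1 / (1 - ‖w‖) ^ 2 + (4 / (1 - ‖w‖)) ^ 2) := by
          gcongr
          · rw [le_div_iff₀ (by positivity)]
            nlinarith [norm_nonneg w]
          · exact hφn w hw
      _ = _ := by rw [div_pow]; ring
  -- Borel–Carathéodory on the disc of radius $(1+|w|)/2$ costs one more power of $1-|w|$, and
  -- Cauchy's estimate for $G'$ another, for a total of four.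
  obtain ⟨A, hA⟩ : ∃ A, A = 272 * C + 4 * ‖G 0‖ := ⟨_, rfl⟩
  have hA0 : 0 ≤ A := by rw [hA]; positivity
  have hGn : ∀ w ∈ Metric.ball (0 : ℂ) 1, ‖G w‖ ≤ A / (1 - ‖w‖) ^ 3 := by
    intro w hw
    obtain ⟨h1, h2⟩ := hball w hw
    have hsub : Metric.ball (0 : ℂ) ((1 + ‖w‖) / 2) ⊆ Metric.ball 0 1 :=
      Metric.ball_subset_ball (by linarith)
    have := Complex.borelCaratheodory (f := G) (R := (1 + ‖w‖) / 2) (z := w)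
      (M := 68 * C / (1 - ‖w‖) ^ 2) (by positivity) (hG.mono hsub) ?_ (by positivity)
      (by simp; linarith)
    · refine this.trans ?_
      have e : (1 + ‖w‖) / 2 - ‖w‖ = (1 - ‖w‖) / 2 := by ring
      rw [e, hA, add_div (272 * C)]
      refine add_le_add ?_ ?_
      · calc _ ≤ 2 * (68 * C / (1 - ‖w‖) ^ 2) * 1 / ((1 - ‖w‖) / 2) := by
              gcongr; linarith
          _ = _ := by field_simp; norm_num
      · calc _ ≤ ‖G 0‖ * 2 / ((1 - ‖w‖) / 2) := by
              gcongr; linarith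
          _ = 4 * ‖G 0‖ / (1 - ‖w‖) := by field_simp; norm_num
          _ ≤ _ := by
              gcongr
              exact pow_le_of_le_one h1.le (by linarith [norm_nonneg w]) (by norm_num)
    · intro u hu
      have hu' : ‖u‖ < (1 + ‖w‖) / 2 := by simpa using hu
      refine (hGre u (hsub hu)).trans ?_
      calc 17 * C / (1 - ‖u‖) ^ 2 ≤ 17 * C / ((1 - ‖w‖) / 2) ^ 2 := by
            gcongr; linarith
        _ = _ := by field_simp; norm_num
  have hdG : ∀ w ∈ Metric.ball (0 : ℂ) 1, ‖deriv G w‖ ≤ 16 * A / (1 - ‖w‖) ^ 4 := by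
    intro w hw
    obtain ⟨h1, h2⟩ := hball w hw
    have hin : ∀ u ∈ Metric.closedBall w ((1 - ‖w‖) / 2), ‖u‖ ≤ (1 + ‖w‖) / 2 := by
      intro u hu
      rw [mem_closedBall_iff_norm] at hu
      have := norm_le_norm_add_norm_sub' u w
      linarith
    have : ‖deriv G w‖ ≤ A / ((1 - ‖w‖) / 2) ^ 3 / ((1 - ‖w‖) / 2) := by
      refine Complex.norm_deriv_le_of_forall_mem_sphere_norm_le (by positivity) ?_ ?_
      · refine DifferentiableOn.diffContOnCl (hG.mono ?_)
        intro u hu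
        rw [closure_ball _ (by positivity)] at hu
        have := hin u hu
        simp; linarith
      · intro u hu
        have := hin u (Metric.sphere_subset_closedBall hu)
        refine (hGn u (by simp; linarith)).trans ?_
        gcongr; linarith
    refine this.trans (le_of_eq ?_)
    field_simp
    norm_num
  -- For the preimage $w$ of $z$ one has $1-|w|\ge2/|z+3i|^2$, which turns the fourth power into
  -- exponent $8$; $|z+3i|\le3|z+i|$ gives $3^8$.
  refine ⟨32 * A * 3 ^ 8, fun z hz => ?_⟩
  have hden : z + 3 * Complex.I ≠ 0 := by
    intro h
    have := congrArg Complex.im h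
    simp at this
    linarith
  let w := (z + Complex.I) / (z + 3 * Complex.I)
  have hpos : 0 < ‖z + 3 * Complex.I‖ := norm_pos_iff.2 hden
  have hw1 : 4 / ‖z + 3 * Complex.I‖ ^ 2 ≤ 1 - ‖w‖ ^ 2 := by
    have : 1 - ‖w‖ ^ 2 = (4 * (z.im + 2)) / ‖z + 3 * Complex.I‖ ^ 2 := by
      simp only [w, norm_div, div_pow]
      rw [eq_div_iff (by positivity), sub_mul, div_mul_cancel₀ _ (by positivity),
        ← Complex.normSq_eq_norm_sq, ← Complex.normSq_eq_norm_sq, Complex.normSq_apply,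
        Complex.normSq_apply]
      simp
      ring
    rw [this]
    gcongr
    linarith
  have hwlt : ‖w‖ < 1 := by
    have : 0 < 4 / ‖z + 3 * Complex.I‖ ^ 2 := by positivity
    rw [← sq_lt_one_iff₀ (norm_nonneg _)]
    linarith
  have hw : w ∈ Metric.ball (0 : ℂ) 1 := by simpa using hwlt
  have hw2 : 2 / ‖z + 3 * Complex.I‖ ^ 2 ≤ 1 - ‖w‖ := by
    have e : 4 / ‖z + 3 * Complex.I‖ ^ 2 = 2 * (2 / ‖z + 3 * Complex.I‖ ^ 2) := by ring
    nlinarith [norm_nonneg w]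
  have hφw : φ w = z := by
    have e1 : w * (z + 3 * Complex.I) = z + Complex.I := div_mul_cancel₀ _ hden
    have e2 : Complex.I * (1 + w) / (1 - w) = z + 2 * Complex.I := by
      rw [div_eq_iff (hne w hw)]
      linear_combination e1
    simp only [φ, e2]
    ring
  have hder : deriv f z / f z = deriv G w * (1 - w) ^ 2 / (2 * Complex.I) := by
    have e1 : HasDerivAt (fun w => f (φ w)) (deriv f z * (2 * Complex.I / (1 - w) ^ 2)) w := by
      have := (hf (φ w)).hasDerivAt.comp w (hφ w hw)
      rwa [hφw] at this
    have e2 : HasDerivAt (fun w => f (φ w)) (Complex.exp (G w) * deriv G w) w := by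
      refine ((hG.differentiableAt (Metric.isOpen_ball.mem_nhds hw)).hasDerivAt.cexp
        ).congr_of_eventuallyEq ?_
      filter_upwards [Metric.isOpen_ball.mem_nhds hw] with u hu using hGf u hu
    have e3 := e1.unique e2
    rw [← hGf w hw, hφw] at e3
    have hfz : f z ≠ 0 := h0 z (by linarith)
    have := hne w hw
    rw [div_eq_div_iff hfz (by simp)]
    field_simp at e3
    linear_combination e3
  rw [hder, norm_div, norm_mul, norm_pow]
  have hle2 : ‖1 - w‖ ≤ 2 := (norm_sub_le _ _).trans (by rw [norm_one]; linarith)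
  calc _ ≤ 16 * A / (1 - ‖w‖) ^ 4 * 2 ^ 2 / 2 := by
        have : ‖2 * Complex.I‖ = 2 := by simp
        rw [this]
        gcongr
        exact hdG w hw
    _ ≤ 16 * A / (2 / ‖z + 3 * Complex.I‖ ^ 2) ^ 4 * 2 ^ 2 / 2 := by gcongr
    _ = 2 * A * ‖z + 3 * Complex.I‖ ^ 8 := by field_simp; ring
    _ ≤ 32 * A * (3 * ‖z + Complex.I‖) ^ 8 := by
        have e1 : 1 ≤ ‖z + Complex.I‖ := by
          have := Complex.abs_im_le_norm (z + Complex.I)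
          rw [Complex.add_im, Complex.I_im, abs_of_nonneg (by linarith)] at this
          linarith
        have e2 : ‖z + 3 * Complex.I‖ ≤ ‖z + Complex.I‖ + 2 := by
          have : z + 3 * Complex.I = (z + Complex.I) + 2 * Complex.I := by ring
          rw [this]
          refine (norm_add_le _ _).trans ?_
          simp
        gcongr
        · norm_num
        · linarith
    _ = _ := by ring

/-- An entire function of finite order which tends to `1` exponentially fast along horizontal
lines is constant if it has no zeros in a half plane. -/
theorem deriv_eq_zero_of_zero_free {f : ℂ → ℂ} (hf : Differentiable ℂ f) {C : ℝ}
    (hC : ∀ z, ‖f z‖ ≤ Real.exp (C * (1 + ‖z‖ ^ 2))) (h0 : ∀ z : ℂ, -2 < z.im → f z ≠ 0)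
    {c B : ℝ} (hc : 0 < c)
    (hd : ∀ z : ℂ, |z.im| ≤ 1 → 0 ≤ z.re → ‖f z - 1‖ ≤ B * Real.exp (-c * z.re)) (z : ℂ) :
    deriv f z = 0 := by
  obtain ⟨K, hK⟩ := norm_logDeriv_le_of_zero_free hf hC h0
  have hdf : Differentiable ℂ (deriv f) := hf.deriv
  have hB : 0 ≤ B := by
    have := (norm_nonneg _).trans (hd 0 (by simp) (by simp))
    simpa using this
  have hderiv : ∀ x : ℝ, 1 ≤ x → ‖deriv f x‖ ≤ B * Real.exp c * Real.exp (-c * x) := by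
    intro x hx
    have h1 : deriv f x = deriv (fun z => f z - 1) x := by rw [deriv_sub_const]
    have : ‖deriv (fun z => f z - 1) x‖ ≤ B * Real.exp (-c * (x - 1)) / 1 := by
      refine Complex.norm_deriv_le_of_forall_mem_sphere_norm_le one_pos
        (hf.sub_const 1).diffContOnCl (fun u hu => ?_)
      rw [mem_sphere_iff_norm] at hu
      have hre := Complex.abs_re_le_norm (u - x)
      have him := Complex.abs_im_le_norm (u - x)
      rw [hu, Complex.sub_re, Complex.ofReal_re, abs_le] at hre
      rw [hu, Complex.sub_im, Complex.ofReal_im, sub_zero] at him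
      refine (hd u him (by linarith)).trans ?_
      gcongr B * Real.exp ?_
      nlinarith
    rw [h1]
    refine this.trans (le_of_eq ?_)
    rw [div_one, mul_assoc, ← Real.exp_add]
    ring_nf
  -- Beyond `x₀` one has $|f|\ge\frac12$, so $f'/f$ decays like $f'$; on $[0,x_0]$ compactness
  -- suffices.
  obtain ⟨x₀, hx₀, hx₁⟩ : ∃ x₀ : ℝ, 1 ≤ x₀ ∧ ∀ x, x₀ ≤ x → B * Real.exp (-c * x) ≤ 1 / 2 := by
    refine ⟨max 1 (2 * B / c), le_max_left _ _, fun x hx => ?_⟩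
    have hx1 : 2 * B / c ≤ x := (le_max_right _ _).trans hx
    rw [div_le_iff₀ hc] at hx1
    have : 1 + c * x ≤ Real.exp (c * x) := by linarith [Real.add_one_le_exp (c * x)]
    rw [neg_mul, Real.exp_neg, ← div_eq_mul_inv, div_le_iff₀ (Real.exp_pos _)]
    linarith
  have hcont : ContinuousOn (fun x : ℝ => deriv f x / f x * Complex.exp (c * x))
      (Set.Icc 0 x₀) := by
    refine ContinuousOn.mul (ContinuousOn.div ?_ ?_ ?_) (by fun_prop)
    · exact (hdf.continuous.comp Complex.continuous_ofReal).continuousOn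
    · exact (hf.continuous.comp Complex.continuous_ofReal).continuousOn
    · intro x _
      exact h0 x (by simp)
  obtain ⟨D, hD⟩ := isCompact_Icc.exists_bound_of_continuousOn hcont
  obtain ⟨E, hE⟩ : ∃ E, E = max D (2 * (B * Real.exp c)) := ⟨_, rfl⟩
  have hdecay : ∀ x : ℝ, 0 ≤ x → ‖deriv f x / f x‖ ≤ E * Real.exp (-c * x) := by
    intro x hx
    rcases le_total x x₀ with h | h
    · have := hD x ⟨hx, h⟩
      rw [norm_mul, Complex.norm_exp, ← Complex.ofReal_mul, Complex.ofReal_re] at this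
      rw [neg_mul, Real.exp_neg, ← div_eq_mul_inv, le_div_iff₀ (Real.exp_pos _), hE]
      exact this.trans (le_max_left _ _)
    · have h1 := hderiv x (hx₀.trans h)
      have h2 : 1 / 2 ≤ ‖f x‖ := by
        have h3 := (hd x (by simp) (by simpa using hx)).trans (hx₁ x h)
        have h4 := norm_sub_norm_le 1 (1 - f x)
        rw [norm_one, sub_sub_cancel, norm_sub_rev 1] at h4
        linarith
      rw [norm_div, div_le_iff₀ (by linarith)]
      calc _ ≤ B * Real.exp c * Real.exp (-c * x) := h1
        _ = (2 * (B * Real.exp c)) * Real.exp (-c * x) * (1 / 2) := by ring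
        _ ≤ _ := by
          have : 2 * (B * Real.exp c) ≤ E := hE ▸ le_max_right _ _
          have h5 : 0 ≤ E := le_trans (by positivity) this
          gcongr
  have hden : ∀ z : ℂ, -1 < z.im → z + Complex.I ≠ 0 := by
    intro z hz h
    have := congrArg Complex.im h
    simp at this
    linarith
  have hden1 : ∀ z : ℂ, 0 ≤ z.im → 1 ≤ ‖z + Complex.I‖ := by
    intro z hz
    have := Complex.abs_im_le_norm (z + Complex.I)
    rw [Complex.add_im, Complex.I_im, abs_of_nonneg (by linarith)] at this
    linarith
  have hzero : ∀ y : ℝ, 0 < y → deriv f (y * Complex.I) = 0 := by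
    intro y hy
    -- Division by $(z+i)^8$ makes $f'/f$ bounded on the upper half plane and, since $|z+i|\ge1$
    -- there, keeps its decay.
    have := Complex.eq_zero_of_bounded_of_exp_decay
      (H := fun z => deriv f z / f z / (z + Complex.I) ^ 8) (C := max K E) (c := c) ?_ hc ?_ ?_ hy
    · rcases div_eq_zero_iff.1 this with h | h
      · rcases div_eq_zero_iff.1 h with h | h
        · exact h
        · exact absurd h (h0 _ (by simp; linarith))
      · exact absurd (pow_eq_zero_iff (by norm_num) |>.1 h) (hden _ (by simp; linarith))
    · refine DifferentiableOn.div (DifferentiableOn.div hdf.differentiableOn hf.differentiableOn ?_)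
        (by fun_prop) ?_
      · intro w hw
        exact h0 w (by have : -1 < w.im := hw; linarith)
      · intro w hw
        exact pow_ne_zero _ (hden w hw)
    · intro w hw
      have h1 := hden1 w hw
      rw [norm_div, norm_pow, div_le_iff₀ (by positivity)]
      refine (hK w hw).trans ?_
      gcongr
      exact le_max_left _ _
    · intro x hx
      have h1 := hden1 x (by simp)
      rw [norm_div, norm_pow]
      refine (div_le_self (norm_nonneg _) (one_le_pow₀ h1)).trans ((hdecay x hx).trans ?_)
      gcongr
      exact le_max_right _ _
  -- The zeros of $f'$ on the imaginary axis accumulate at $i$, so the identity theorem gives $f'=0$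
  -- everywhere.
  have hfreq : ∃ᶠ w in nhdsWithin Complex.I {Complex.I}ᶜ, deriv f w = 0 := by
    have htend : Filter.Tendsto (fun y : ℝ => (y : ℂ) * Complex.I) (nhdsWithin 1 {1}ᶜ)
        (nhdsWithin Complex.I {Complex.I}ᶜ) := by
      refine tendsto_nhdsWithin_iff.2 ⟨?_, ?_⟩
      · have : Continuous (fun y : ℝ => (y : ℂ) * Complex.I) := by fun_prop
        exact (this.tendsto' 1 Complex.I (by simp)).mono_left nhdsWithin_le_nhds
      · filter_upwards [self_mem_nhdsWithin] with y hy h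
        apply hy
        have : (y : ℂ) * Complex.I = 1 * Complex.I := by simpa using h
        exact_mod_cast mul_right_cancel₀ Complex.I_ne_zero this
    refine htend.frequently (Filter.Eventually.frequently ?_)
    filter_upwards [mem_nhdsWithin_of_mem_nhds (lt_mem_nhds (zero_lt_one (α := ℝ)))] with y hy
      using hzero y hy
  have := (hdf.differentiableOn.analyticOnNhd isOpen_univ).eqOn_zero_of_preconnected_of_frequently_eq_zero
    isPreconnected_univ (Set.mem_univ _) hfreq
  exact this (Set.mem_univ z)

/-- Finitely many zeros would lie below some height, and a vertical translation would then clear the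
half plane required by `deriv_eq_zero_of_zero_free`. Decay is assumed in every strip so that it
survives the translation. -/
theorem infinite_zeros_upper_half_plane {f : ℂ → ℂ} (hf : Differentiable ℂ f) {C : ℝ}
    (hC : ∀ z, ‖f z‖ ≤ Real.exp (C * (1 + ‖z‖ ^ 2)))
    (hd : ∀ T : ℝ, ∃ c B : ℝ, 0 < c ∧ ∀ z : ℂ, |z.im| ≤ T → 0 ≤ z.re →
      ‖f z - 1‖ ≤ B * Real.exp (-c * z.re))
    (hnc : ∃ z, deriv f z ≠ 0) : {z : ℂ | f z = 0 ∧ 0 < z.im}.Infinite := by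
  intro hfin
  obtain ⟨T, hT⟩ := (hfin.image Complex.im).bddAbove
  obtain ⟨z₀, hz₀⟩ := hnc
  obtain ⟨S, hS⟩ : ∃ S, S = |T| + 2 := ⟨_, rfl⟩
  have hS2 : 2 ≤ S := by rw [hS]; linarith [abs_nonneg T]
  obtain ⟨c, B, hc, hcB⟩ := hd (S + 1)
  -- For $C<0$ the bound would give $|f|\le e^C<1$ on the real axis, against $f\to1$.
  have hC0 : 0 ≤ C := by
    obtain ⟨c, B, hc, hcB⟩ := hd 0
    by_contra hneg
    have hlim : Filter.Tendsto (fun x : ℝ => f x) Filter.atTop (nhds 1) := by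
      rw [tendsto_iff_norm_sub_tendsto_zero]
      refine squeeze_zero' (Filter.Eventually.of_forall fun _ => norm_nonneg _)
        ((Filter.eventually_ge_atTop 0).mono fun x hx => hcB x (by simp) (by simpa using hx)) ?_
      have : Filter.Tendsto (fun x : ℝ => B * Real.exp (-(c * x))) Filter.atTop (nhds (B * 0)) :=
        (Real.tendsto_exp_neg_atTop_nhds_zero.comp
          (Filter.tendsto_id.const_mul_atTop hc)).const_mul B
      simpa using this
    have h1 : ∀ x : ℝ, ‖f x‖ ≤ Real.exp C := fun x => (hC x).trans (by
      rw [Real.exp_le_exp]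
      nlinarith [sq_nonneg ‖(x : ℂ)‖])
    have h2 := le_of_tendsto hlim.norm (Filter.Eventually.of_forall h1)
    rw [norm_one, Real.one_le_exp_iff] at h2
    exact hneg h2
  have hder : ∀ z, deriv (fun z => f (z + S * Complex.I)) z = deriv f (z + S * Complex.I) :=
    fun z => deriv_comp_add_const f (S * Complex.I) z
  refine hz₀ ?_
  -- The constant comes from $1+(|z|+S)^2\le2(1+S^2)(1+|z|^2)$.
  have := deriv_eq_zero_of_zero_free (f := fun z => f (z + S * Complex.I))
    (hf.comp (differentiable_id.add_const _)) (C := 2 * C * (1 + S ^ 2)) (fun z => ?_)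
    (fun z hz h => ?_) hc (B := B) (fun z hz hz' => ?_) (z₀ - S * Complex.I)
  · rwa [hder, sub_add_cancel] at this
  · refine (hC _).trans ?_
    rw [Real.exp_le_exp]
    have h1 : ‖z + S * Complex.I‖ ≤ ‖z‖ + S := by
      refine (norm_add_le _ _).trans ?_
      simp [abs_of_nonneg (by linarith : 0 ≤ S)]
    have h2 : ‖z + S * Complex.I‖ ^ 2 ≤ (‖z‖ + S) ^ 2 := by gcongr
    rw [mul_comm 2 C, mul_assoc, mul_assoc]
    gcongr
    nlinarith [sq_nonneg (‖z‖ - S), mul_nonneg (sq_nonneg ‖z‖) (sq_nonneg S)]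
  · have h1 : (z + S * Complex.I).im = z.im + S := by simp
    have h2 := hT ⟨z + S * Complex.I, ⟨h, by rw [h1]; linarith⟩, rfl⟩
    rw [h1] at h2
    linarith [le_abs_self T]
  · have h1 : (z + S * Complex.I).im = z.im + S := by simp
    have h2 : (z + S * Complex.I).re = z.re := by simp
    have := hcB (z + S * Complex.I) (by
      rw [h1]; rw [abs_le] at hz ⊢; constructor <;> linarith [hz.1, hz.2]) (by rwa [h2])
    rwa [h2] at this

/-! ### Gaussian moments and the integral behind the simplicity of the trivial zeros. -/

/-- The weight `e^{-π y² - a y}` with `a = π / √2`. -/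
noncomputable def gaussWeight (y : ℝ) : ℝ :=
  Real.exp (-Real.pi * y ^ 2 - Real.pi / √2 * y)

noncomputable def gaussMoment (m : ℕ) : ℝ := ∫ y in Set.Ioi (0 : ℝ), y ^ m * gaussWeight y

theorem continuous_gaussWeight : Continuous gaussWeight := by
  unfold gaussWeight
  fun_prop

theorem gaussWeight_pos (y : ℝ) : 0 < gaussWeight y := Real.exp_pos _

theorem pi_div_sqrt_two_sq : (Real.pi / √2) ^ 2 = Real.pi ^ 2 / 2 := by
  rw [div_pow, Real.sq_sqrt (by norm_num)]

theorem pi_div_sqrt_two_gt : 2.221 < Real.pi / √2 := by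
  have h := pi_div_sqrt_two_sq
  have h1 := Real.pi_gt_d4
  have h2 : 0 < Real.pi / √2 := by positivity
  nlinarith

theorem pi_div_sqrt_two_lt : Real.pi / √2 < 2.2216 := by
  have h := pi_div_sqrt_two_sq
  have h1 := Real.pi_lt_d4
  have h0 := Real.pi_pos
  have h2 : 0 < Real.pi / √2 := by positivity
  nlinarith

theorem integrableOn_pow_mul_gaussWeight (m : ℕ) :
    MeasureTheory.IntegrableOn (fun y => y ^ m * gaussWeight y) (Set.Ioi 0) := by
  have h := integrableOn_rpow_mul_exp_neg_mul_sq Real.pi_pos (s := m)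
    (by have : (0 : ℝ) ≤ m := Nat.cast_nonneg m; linarith)
  refine MeasureTheory.Integrable.mono' h
    (((continuous_id.pow m).mul continuous_gaussWeight).aestronglyMeasurable) ?_
  filter_upwards [MeasureTheory.ae_restrict_mem measurableSet_Ioi] with y hy
  have hy0 : (0 : ℝ) < y := hy
  rw [Real.norm_of_nonneg (mul_nonneg (by positivity) (gaussWeight_pos y).le),
    Real.rpow_natCast, gaussWeight]
  gcongr
  have : 0 < Real.pi / √2 * y := by positivity
  linarith

theorem gaussMoment_pos (m : ℕ) : 0 < gaussMoment m := by
  refine (MeasureTheory.setIntegral_pos_iff_support_of_nonneg_ae ?_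
    (integrableOn_pow_mul_gaussWeight m)).2 ?_
  · filter_upwards [MeasureTheory.ae_restrict_mem measurableSet_Ioi] with y hy
    have hy0 : (0 : ℝ) < y := hy
    exact mul_nonneg (by positivity) (gaussWeight_pos y).le
  · have : Set.Ioi (0 : ℝ) ⊆ (Function.support fun y => y ^ m * gaussWeight y) ∩ Set.Ioi 0 := by
      intro y hy
      have hy0 : (0 : ℝ) < y := hy
      exact ⟨(mul_pos (by positivity) (gaussWeight_pos y)).ne', hy⟩
    exact lt_of_lt_of_le (by simp) (MeasureTheory.measure_mono this)

-- Integration by parts: the derivative of $y^{m+1}e^{-\pi y^2-ay}$ has integral $0$ over $y>0$.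
open Filter Topology in
theorem gaussMoment_recurrence (m : ℕ) :
    (m + 1) * gaussMoment m
      = 2 * Real.pi * gaussMoment (m + 2) + Real.pi / √2 * gaussMoment (m + 1) := by
  have hi := fun m => integrableOn_pow_mul_gaussWeight m
  have hd : ∀ y : ℝ, HasDerivAt (fun y => y ^ (m + 1) * gaussWeight y)
      ((m + 1) * (y ^ m * gaussWeight y) - (2 * Real.pi * (y ^ (m + 2) * gaussWeight y) +
        Real.pi / √2 * (y ^ (m + 1) * gaussWeight y))) y := by
    intro y
    have h1 : HasDerivAt (fun y : ℝ => -Real.pi * y ^ 2 - Real.pi / √2 * y)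
        (-Real.pi * (2 * y) - Real.pi / √2) y := by
      simpa using! ((hasDerivAt_pow 2 y).const_mul (-Real.pi)).fun_sub
        ((hasDerivAt_id y).const_mul (Real.pi / √2))
    refine ((hasDerivAt_pow (m + 1) y).fun_mul h1.exp).congr_deriv ?_
    simp only [gaussWeight, Nat.add_sub_cancel]
    push_cast
    ring
  have htend : Tendsto (fun y => y ^ (m + 1) * gaussWeight y) atTop (𝓝 0) := by
    refine squeeze_zero' ?_ ?_ (Real.tendsto_pow_mul_exp_neg_atTop_nhds_zero (m + 1))
    · filter_upwards [eventually_ge_atTop 0] with y hy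
      exact mul_nonneg (by positivity) (gaussWeight_pos y).le
    · filter_upwards [eventually_ge_atTop 0] with y hy
      unfold gaussWeight
      gcongr
      have := pi_div_sqrt_two_gt
      nlinarith [mul_nonneg Real.pi_pos.le (sq_nonneg y)]
  have := MeasureTheory.integral_Ioi_of_hasDerivAt_of_tendsto
    (hd 0).continuousAt.continuousWithinAt (fun y _ => hd y)
    (((hi m).const_mul _).sub (((hi (m + 2)).const_mul _).add ((hi (m + 1)).const_mul _))) htend
  rw [MeasureTheory.integral_sub ((hi m).const_mul _)
    (MeasureTheory.Integrable.fun_add ((hi (m + 2)).const_mul _) ((hi (m + 1)).const_mul _)),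
    MeasureTheory.integral_add ((hi (m + 2)).const_mul _) ((hi (m + 1)).const_mul _),
    MeasureTheory.integral_const_mul, MeasureTheory.integral_const_mul,
    MeasureTheory.integral_const_mul] at this
  simp only [ne_eq, Nat.add_eq_zero_iff, one_ne_zero, and_false, not_false_eq_true, zero_pow,
    zero_mul, sub_zero] at this
  simp only [gaussMoment]
  linarith

theorem integral_pow_mul_sub_sq (m : ℕ) (t : ℝ) :
    ∫ y in Set.Ioi (0 : ℝ), y ^ m * gaussWeight y * (y - t) ^ 2 =
      gaussMoment (m + 2) - 2 * t * gaussMoment (m + 1) + t ^ 2 * gaussMoment m := by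
  have hi := fun m => integrableOn_pow_mul_gaussWeight m
  have : ∀ y : ℝ, y ^ m * gaussWeight y * (y - t) ^ 2 = y ^ (m + 2) * gaussWeight y
      - 2 * t * (y ^ (m + 1) * gaussWeight y) + t ^ 2 * (y ^ m * gaussWeight y) := by
    intro y; ring
  simp_rw [this]
  have h1 : MeasureTheory.IntegrableOn (fun y => y ^ (m + 2) * gaussWeight y
      - 2 * t * (y ^ (m + 1) * gaussWeight y)) (Set.Ioi 0) := (hi _).sub ((hi _).const_mul _)
  rw [MeasureTheory.integral_add h1
    ((hi m).const_mul _), MeasureTheory.integral_sub (hi (m + 2)) ((hi (m + 1)).const_mul _),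
    MeasureTheory.integral_const_mul, MeasureTheory.integral_const_mul]
  rfl

/-- Log-convexity of moments, from the nonnegative integral of $(y-t)^2$ at the minimising $t$. -/
theorem gaussMoment_sq_le (m : ℕ) :
    gaussMoment (m + 1) ^ 2 ≤ gaussMoment m * gaussMoment (m + 2) := by
  have h0 := gaussMoment_pos m
  have h : 0 ≤ ∫ y in Set.Ioi (0 : ℝ), y ^ m * gaussWeight y *
      (y - gaussMoment (m + 1) / gaussMoment m) ^ 2 := by
    refine MeasureTheory.setIntegral_nonneg measurableSet_Ioi (fun y hy => ?_)
    have hy0 : (0 : ℝ) < y := hy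
    exact mul_nonneg (mul_nonneg (by positivity) (gaussWeight_pos y).le) (sq_nonneg _)
  rw [integral_pow_mul_sub_sq] at h
  have e : gaussMoment (m + 2) - 2 * (gaussMoment (m + 1) / gaussMoment m) * gaussMoment (m + 1) +
      (gaussMoment (m + 1) / gaussMoment m) ^ 2 * gaussMoment m =
      (gaussMoment m * gaussMoment (m + 2) - gaussMoment (m + 1) ^ 2) / gaussMoment m := by
    field_simp
    ring
  rw [e, le_div_iff₀ h0] at h
  linarith

/-- The density $y^{m+1}e^{-\pi y^2-ay}$, once normalised, has variance at most $1/(2\pi)$. After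
rotating the phase by $e^{-ia\mu}$, with `μ` its mean, $\cos t\ge1-t^2/2$ shows that the oscillation
loses at most the proportion $\frac{a^2}2\cdot\frac1{2\pi}=\frac\pi8$. -/
theorem norm_integral_gaussWeight_mul_exp_ge (m : ℕ) :
    (1 - Real.pi / 8) * gaussMoment (m + 1) ≤
      ‖∫ y in Set.Ioi (0 : ℝ), ((y ^ (m + 1) * gaussWeight y : ℝ) : ℂ) *
        Complex.exp ((Real.pi / √2 * y : ℝ) * Complex.I)‖ := by
  obtain ⟨a, ha⟩ : ∃ a, a = Real.pi / √2 := ⟨_, rfl⟩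
  have ha2 : a ^ 2 = Real.pi ^ 2 / 2 := ha ▸ pi_div_sqrt_two_sq
  obtain ⟨A0, hA0⟩ : ∃ x, x = gaussMoment m := ⟨_, rfl⟩
  obtain ⟨A1, hA1⟩ : ∃ x, x = gaussMoment (m + 1) := ⟨_, rfl⟩
  obtain ⟨A2, hA2⟩ : ∃ x, x = gaussMoment (m + 2) := ⟨_, rfl⟩
  obtain ⟨A3, hA3⟩ : ∃ x, x = gaussMoment (m + 3) := ⟨_, rfl⟩
  have p0 : 0 < A0 := hA0 ▸ gaussMoment_pos m
  have p1 : 0 < A1 := hA1 ▸ gaussMoment_pos _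
  have p2 : 0 < A2 := hA2 ▸ gaussMoment_pos _
  have r0 := gaussMoment_recurrence m
  have r1 := gaussMoment_recurrence (m + 1)
  have cs := gaussMoment_sq_le m
  rw [← ha, ← hA0, ← hA1, ← hA2] at r0
  rw [← ha, ← hA1, show m + 1 + 2 = m + 3 by ring, show m + 1 + 1 = m + 2 by ring,
    ← hA2, ← hA3] at r1
  push_cast at r1
  rw [← hA0, ← hA1, ← hA2] at cs
  obtain ⟨μ, hμ⟩ : ∃ μ, μ = A2 / A1 := ⟨_, rfl⟩
  have hμA : μ * A1 = A2 := by rw [hμ]; field_simp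
  -- The variance bound combines the recurrence at `m` and `m + 1` with log-convexity in the form
  -- $A_1\le\mu A_0$.
  have hvar : 2 * Real.pi * (A3 - 2 * μ * A2 + μ ^ 2 * A1) ≤ A1 := by
    have e1 : A3 - 2 * μ * A2 + μ ^ 2 * A1 = A3 - μ * A2 := by
      rw [pow_two, mul_assoc μ μ, hμA]; ring
    rw [e1]
    have e2 : (m + 1) * A1 ≤ (2 * Real.pi * A2 + a * A1) * μ := by
      rw [← r0, hμ]
      rw [mul_div_assoc', le_div_iff₀ p1]
      have : (0 : ℝ) ≤ m + 1 := by positivity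
      nlinarith
    linear_combination e2 - r1 + a * hμA
  have hint : MeasureTheory.IntegrableOn (fun y : ℝ => ((y ^ (m + 1) * gaussWeight y : ℝ) : ℂ) *
        Complex.exp ((a * y : ℝ) * Complex.I)) (Set.Ioi 0) := by
    refine MeasureTheory.Integrable.mono' (integrableOn_pow_mul_gaussWeight (m + 1)) ?_ ?_
    · have := continuous_gaussWeight
      exact Continuous.aestronglyMeasurable (by fun_prop)
    · filter_upwards [MeasureTheory.ae_restrict_mem measurableSet_Ioi] with y hy
      have hy0 : (0 : ℝ) < y := hy
      rw [norm_mul, Complex.norm_exp_ofReal_mul_I, mul_one, Complex.norm_real,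
        Real.norm_of_nonneg (mul_nonneg (by positivity) (gaussWeight_pos y).le)]
  obtain ⟨Q, hQ⟩ : ∃ Q, Q = ∫ y in Set.Ioi (0 : ℝ), ((y ^ (m + 1) * gaussWeight y : ℝ) : ℂ) *
        Complex.exp ((a * y : ℝ) * Complex.I) := ⟨_, rfl⟩
  rw [← ha, ← hA1, ← hQ]
  have hre : (Q * Complex.exp ((-(a * μ) : ℝ) * Complex.I)).re =
      ∫ y in Set.Ioi (0 : ℝ), y ^ (m + 1) * gaussWeight y * Real.cos (a * (y - μ)) := by
    rw [hQ, ← MeasureTheory.integral_mul_const, ← RCLike.re_eq_complex_re,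
      ← integral_re (hint.mul_const _)]
    refine MeasureTheory.setIntegral_congr_fun measurableSet_Ioi (fun y _ => ?_)
    simp only [RCLike.re_eq_complex_re]
    rw [mul_assoc, ← Complex.exp_add, ← add_mul, ← Complex.ofReal_add, Complex.re_ofReal_mul,
      Complex.exp_ofReal_mul_I_re]
    congr 2
    ring
  have hge : A1 - a ^ 2 / 2 * (A3 - 2 * μ * A2 + μ ^ 2 * A1) ≤
      ∫ y in Set.Ioi (0 : ℝ), y ^ (m + 1) * gaussWeight y * Real.cos (a * (y - μ)) := by
    have hi := fun m => integrableOn_pow_mul_gaussWeight m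
    have hi2 : MeasureTheory.IntegrableOn
        (fun y => y ^ (m + 1) * gaussWeight y * (y - μ) ^ 2) (Set.Ioi 0) := by
      have : ∀ y : ℝ, y ^ (m + 1) * gaussWeight y * (y - μ) ^ 2 = y ^ (m + 3) * gaussWeight y
          - 2 * μ * (y ^ (m + 2) * gaussWeight y) + μ ^ 2 * (y ^ (m + 1) * gaussWeight y) := by
        intro y; ring
      simp_rw [this]
      exact ((hi _).sub ((hi _).const_mul _)).add ((hi _).const_mul _)
    have e := integral_pow_mul_sub_sq (m + 1) μ
    rw [show m + 1 + 2 = m + 3 by ring, show m + 1 + 1 = m + 2 by ring, ← hA1, ← hA2, ← hA3] at e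
    rw [← e, hA1, gaussMoment, ← MeasureTheory.integral_const_mul,
      ← MeasureTheory.integral_sub (hi _) (hi2.const_mul _)]
    refine MeasureTheory.setIntegral_mono_on ((hi _).sub (hi2.const_mul _)) ?_ measurableSet_Ioi
      (fun y hy => ?_)
    · refine MeasureTheory.Integrable.mono' (hi (m + 1)) ?_ ?_
      · have := continuous_gaussWeight
        exact Continuous.aestronglyMeasurable (by fun_prop)
      · filter_upwards [MeasureTheory.ae_restrict_mem measurableSet_Ioi] with y hy
        have hy0 : (0 : ℝ) < y := hy
        have hp : 0 ≤ y ^ (m + 1) * gaussWeight y :=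
          mul_nonneg (by positivity) (gaussWeight_pos y).le
        rw [norm_mul, Real.norm_of_nonneg hp]
        exact mul_le_of_le_one_right hp (Real.abs_cos_le_one _)
    · have hy0 : (0 : ℝ) < y := hy
      have hp : 0 ≤ y ^ (m + 1) * gaussWeight y :=
        mul_nonneg (by positivity) (gaussWeight_pos y).le
      have hc := Real.one_sub_sq_div_two_le_cos (x := a * (y - μ))
      have := mul_le_mul_of_nonneg_left hc hp
      refine le_trans (le_of_eq ?_) this
      ring
  have hnorm : (Q * Complex.exp ((-(a * μ) : ℝ) * Complex.I)).re ≤ ‖Q‖ := by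
    refine (Complex.re_le_norm _).trans ?_
    rw [norm_mul, Complex.norm_exp_ofReal_mul_I, mul_one]
  rw [hre] at hnorm
  refine le_trans ?_ (hge.trans hnorm)
  rw [ha2]
  have hpi := Real.pi_pos
  nlinarith

theorem exp_pi_mul_I_div_four :
    Complex.exp (Real.pi * Complex.I / 4) = (√2 / 2 : ℝ) + (√2 / 2 : ℝ) * Complex.I := by
  rw [show (Real.pi * Complex.I / 4 : ℂ) = ((Real.pi / 4 : ℝ) : ℂ) * Complex.I by push_cast; ring,
    Complex.exp_mul_I, ← Complex.ofReal_cos, ← Complex.ofReal_sin, Real.cos_pi_div_four,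
    Real.sin_pi_div_four]

theorem pi_mul_I_mul_exp_pi_mul_I_div_four (y : ℝ) :
    Real.pi * Complex.I * (Complex.exp (Real.pi * Complex.I / 4) * y) =
      ((-(Real.pi / √2 * y) : ℝ) : ℂ) + ((Real.pi / √2 * y : ℝ) : ℂ) * Complex.I := by
  have h : Real.pi / √2 = Real.pi * (√2 / 2) := by
    rw [div_eq_iff (by positivity), mul_assoc, div_mul_eq_mul_div, Real.mul_self_sqrt (by norm_num)]
    ring
  rw [exp_pi_mul_I_div_four, h]
  push_cast
  linear_combination (Real.pi * (√2 / 2) * y : ℂ) * Complex.I_sq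

/-- For $|E|<1$ one has $1/(E-E^{-1})=-E-E^3-\cdots$; this estimates everything after the first
term. -/
theorem norm_add_div_sub_inv_le {E g : ℂ} {b : ℝ} (hb : 0 < b) (hE : ‖E‖ = Real.exp (-b)) :
    ‖g / (E - E⁻¹) + g * E‖ ≤ ‖g * E‖ / (Real.exp (2 * b) - 1) := by
  have hE0 : E ≠ 0 := norm_pos_iff.1 (hE ▸ Real.exp_pos _)
  have hlt : ‖E ^ 2‖ < 1 := by
    rw [norm_pow, hE, ← Real.exp_nat_mul, Real.exp_lt_one_iff]
    push_cast; linarith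
  have h1 : E ^ 2 - 1 ≠ 0 := by
    intro h
    rw [sub_eq_zero.1 h] at hlt
    simp at hlt
  have h2 : g / (E - E⁻¹) + g * E = g * E * (E ^ 2 / (E ^ 2 - 1)) := by
    have : E - E⁻¹ = (E ^ 2 - 1) / E := by field_simp
    rw [this]
    field_simp
    ring
  have h3 : ‖E ^ 2‖ = (Real.exp (2 * b))⁻¹ := by
    rw [norm_pow, hE, ← Real.exp_neg, ← Real.exp_nat_mul]
    congr 1
    push_cast; ring
  have h4 : 1 < Real.exp (2 * b) := by rw [Real.one_lt_exp_iff]; linarith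
  have h5 : 1 - ‖E ^ 2‖ ≤ ‖E ^ 2 - 1‖ := by
    have := norm_sub_norm_le 1 (E ^ 2)
    rwa [norm_one, norm_sub_rev] at this
  rw [h2, norm_mul, div_eq_mul_inv ‖g * E‖]
  gcongr
  rw [norm_div]
  calc _ ≤ ‖E ^ 2‖ / (1 - ‖E ^ 2‖) := by
        gcongr
    _ = _ := by
        rw [h3]
        have : Real.exp (2 * b) - 1 ≠ 0 := by linarith
        field_simp

theorem inv_exp_sub_one_le {b : ℝ} (hb : 0 < b) : (Real.exp b - 1)⁻¹ ≤ b⁻¹ := by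
  have := Real.add_one_le_exp b
  gcongr
  linarith

/-- Here $1/(b+b^2/2)=1/b-1/(b+2)$, and $-\frac38+\frac b{16}$ is the tangent at $b=2$ to the
convave function $-1/(b+2)$. -/
theorem inv_exp_sub_one_le' {b : ℝ} (hb : 0 < b) :
    (Real.exp b - 1)⁻¹ ≤ b⁻¹ - 3 / 8 + b / 16 := by
  have := Real.quadratic_le_exp_of_nonneg hb.le
  calc _ ≤ (b + b ^ 2 / 2)⁻¹ := by
        gcongr
        linarith
    _ ≤ _ := by
        have : b⁻¹ - 3 / 8 + b / 16 - (b + b ^ 2 / 2)⁻¹ = (b - 2) ^ 2 / (16 * (b + 2)) := by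
          field_simp
          ring
        have h : 0 ≤ (b - 2) ^ 2 / (16 * (b + 2)) := by positivity
        linarith

/-- Bounds the ratio of consecutive moments: log-convexity in the recurrence, with its positive
linear term discarded. -/
theorem two_pi_mul_gaussMoment_sq_le (m : ℕ) :
    2 * Real.pi * gaussMoment (m + 1) ^ 2 ≤ (m + 1) * gaussMoment m ^ 2 := by
  have r := gaussMoment_recurrence m
  have cs := gaussMoment_sq_le m
  have p0 := gaussMoment_pos m
  have p1 := gaussMoment_pos (m + 1)
  have ha : 0 < Real.pi / √2 := by positivity
  have hpi := Real.pi_pos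
  have e : (m + 1) * gaussMoment m ^ 2 = 2 * Real.pi * (gaussMoment m * gaussMoment (m + 2)) +
      Real.pi / √2 * gaussMoment (m + 1) * gaussMoment m := by
    linear_combination gaussMoment m * r
  rw [e]
  have : 0 < Real.pi / √2 * gaussMoment (m + 1) * gaussMoment m := by positivity
  nlinarith

/-- The numerical comparison behind the nonvanishing of `integral_gauss_div_sin_ne_zero`. -/
theorem gaussMoment_tail_lt {m : ℕ} (hm : 2 ≤ m) :
    gaussMoment m / (2 * (Real.pi / √2)) < (1 - Real.pi / 8) * gaussMoment (m + 1) := by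
  obtain ⟨a, ha⟩ : ∃ a, a = Real.pi / √2 := ⟨_, rfl⟩
  have ha1 : 2.221 < a := ha ▸ pi_div_sqrt_two_gt
  have ha2 : a < 2.2216 := ha ▸ pi_div_sqrt_two_lt
  have hpi := Real.pi_lt_d4
  have hpi0 := Real.pi_pos
  have r := gaussMoment_recurrence m
  have b := two_pi_mul_gaussMoment_sq_le (m + 1)
  have p0 := gaussMoment_pos m
  have p1 := gaussMoment_pos (m + 1)
  have p2 := gaussMoment_pos (m + 2)
  rw [← ha] at r ⊢
  push_cast at b
  rw [show m + 1 + 1 = m + 2 by ring] at b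
  generalize gaussMoment m = A0 at *
  generalize gaussMoment (m + 1) = A1 at *
  generalize gaussMoment (m + 2) = A2 at *
  have hm' : (2 : ℝ) ≤ m := by exact_mod_cast hm
  generalize (m : ℝ) = t at *
  rw [div_lt_iff₀ (by linarith)]
  have hX : (2 * Real.pi * A2) ^ 2 ≤ 6.2832 * (t + 2) * A1 ^ 2 := by
    have : (2 * Real.pi * A2) ^ 2 = 2 * Real.pi * (2 * Real.pi * A2 ^ 2) := by ring
    rw [this]
    calc _ ≤ 2 * Real.pi * ((t + 1 + 1) * A1 ^ 2) := by gcongr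
      _ ≤ 6.2832 * ((t + 1 + 1) * A1 ^ 2) := by gcongr; linarith
      _ = _ := by ring
  -- This is where $m\ge2$ is needed; the inequality of squares fails at $t=1$.
  have hX2 : 2 * Real.pi * A2 < (2.69 * (t + 1) - 2.2216) * A1 := by
    refine lt_of_pow_lt_pow_left₀ 2 (by nlinarith) (hX.trans_lt ?_)
    rw [mul_pow]
    gcongr
    nlinarith
  have h1 : (t + 1) * A0 < 2.69 * (t + 1) * A1 := by
    rw [r]
    nlinarith
  have h2 : A0 < 2.69 * A1 := by nlinarith
  -- The constant $2.69$ is a lower approximation to $(1-\pi/8)\cdot2a\approx2.697$.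
  have h3 : 2.69 ≤ (1 - Real.pi / 8) * (2 * a) := by nlinarith
  nlinarith

/-- The comparison for $m=1$, where the tail is estimated by `inv_exp_sub_one_le'` in place of
`inv_exp_sub_one_le`. -/
theorem gaussMoment_tail_lt' :
    gaussMoment 1 / (2 * (Real.pi / √2)) - 3 / 8 * gaussMoment 2
      + (2 * (Real.pi / √2)) / 16 * gaussMoment 3 < (1 - Real.pi / 8) * gaussMoment 2 := by
  obtain ⟨a, ha⟩ : ∃ a, a = Real.pi / √2 := ⟨_, rfl⟩
  have ha1 : 2.221 < a := ha ▸ pi_div_sqrt_two_gt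
  have ha2 : a < 2.2216 := ha ▸ pi_div_sqrt_two_lt
  have hpi := Real.pi_lt_d4
  have hpi1 := Real.pi_gt_d4
  have r := gaussMoment_recurrence 1
  have b := two_pi_mul_gaussMoment_sq_le 2
  have p0 := gaussMoment_pos 1
  have p1 := gaussMoment_pos 2
  have p2 := gaussMoment_pos 3
  rw [← ha] at r ⊢
  norm_num at r b
  generalize gaussMoment 1 = A0 at *
  generalize gaussMoment 2 = A1 at *
  generalize gaussMoment 3 = A2 at *
  have h3 : A2 < 0.6911 * A1 := by
    refine lt_of_pow_lt_pow_left₀ 2 (by positivity) ?_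
    rw [mul_pow]
    nlinarith
  have h0 : A0 / (2 * a) < 0.739 * A1 := by
    rw [div_lt_iff₀ (by linarith)]
    nlinarith
  nlinarith

/-- The integral whose nonvanishing says that the trivial zeros of `riemannAux` are simple. -/
theorem integral_gauss_div_sin_ne_zero {m : ℕ} (hm : 1 ≤ m) :
    ∫ y in Set.Ioi (0 : ℝ), ((y ^ (m + 1) * Real.exp (-Real.pi * y ^ 2) : ℝ) : ℂ) /
      (Complex.exp (Real.pi * Complex.I * (Complex.exp (Real.pi * Complex.I / 4) * y)) -
       Complex.exp (-(Real.pi * Complex.I * (Complex.exp (Real.pi * Complex.I / 4) * y)))) ≠ 0 := by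
  obtain ⟨a, ha⟩ : ∃ a, a = Real.pi / √2 := ⟨_, rfl⟩
  have ha0 : 0 < a := by rw [ha]; positivity
  obtain ⟨J, hJ⟩ : ∃ J : ℝ → ℂ, J = fun y => ((y ^ (m + 1) * Real.exp (-Real.pi * y ^ 2) : ℝ) : ℂ) /
      (Complex.exp (Real.pi * Complex.I * (Complex.exp (Real.pi * Complex.I / 4) * y)) -
       Complex.exp (-(Real.pi * Complex.I * (Complex.exp (Real.pi * Complex.I / 4) * y)))) :=
    ⟨_, rfl⟩
  obtain ⟨M, hM⟩ : ∃ M : ℝ → ℂ, M = fun y => ((y ^ (m + 1) * gaussWeight y : ℝ) : ℂ) *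
        Complex.exp ((Real.pi / √2 * y : ℝ) * Complex.I) := ⟨_, rfl⟩
  have hnormM : ∀ y, 0 < y → ‖M y‖ = y ^ (m + 1) * gaussWeight y := by
    intro y hy
    rw [hM]
    simp only
    rw [norm_mul, Complex.norm_exp_ofReal_mul_I, mul_one, Complex.norm_real,
        Real.norm_of_nonneg (mul_nonneg (by positivity) (gaussWeight_pos y).le)]
  -- The leading term of `J` is `-M`, so `J + M` is the tail. If `J` had integral zero, the integral
  -- of the tail would equal that of `M`, which is too large.
  have htail : ∀ y, 0 < y →
      ‖J y + M y‖ ≤ y ^ (m + 1) * gaussWeight y * (Real.exp (2 * a * y) - 1)⁻¹ := by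
    intro y hy
    have h1 := pi_mul_I_mul_exp_pi_mul_I_div_four y
    rw [← ha] at h1
    have h2 : M y = ((y ^ (m + 1) * Real.exp (-Real.pi * y ^ 2) : ℝ) : ℂ) *
        Complex.exp (Real.pi * Complex.I * (Complex.exp (Real.pi * Complex.I / 4) * y)) := by
      rw [h1, Complex.exp_add, hM]
      simp only [gaussWeight, ← ha]
      rw [sub_eq_add_neg, Real.exp_add]
      push_cast
      ring
    have := norm_add_div_sub_inv_le (b := a * y)
      (g := ((y ^ (m + 1) * Real.exp (-Real.pi * y ^ 2) : ℝ) : ℂ))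
      (E := Complex.exp (Real.pi * Complex.I * (Complex.exp (Real.pi * Complex.I / 4) * y)))
      (by positivity) (by rw [h1, Complex.norm_exp]; simp)
    rw [← h2, hnormM y hy, ← Complex.exp_neg] at this
    rw [mul_assoc 2 a y, ← div_eq_mul_inv, hJ]
    exact this
  have hi := fun m => integrableOn_pow_mul_gaussWeight m
  have hMint : MeasureTheory.IntegrableOn M (Set.Ioi 0) := by
    refine MeasureTheory.Integrable.mono' (hi (m + 1)) ?_ ?_
    · rw [hM]
      have := continuous_gaussWeight
      exact Continuous.aestronglyMeasurable (by fun_prop)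
    · filter_upwards [MeasureTheory.ae_restrict_mem measurableSet_Ioi] with y hy
      exact (hnormM y hy).le
  have hdec1 : ∀ y, 0 < y → ‖J y + M y‖ ≤ (2 * a)⁻¹ * (y ^ m * gaussWeight y) := by
    intro y hy
    refine (htail y hy).trans ?_
    calc _ ≤ y ^ (m + 1) * gaussWeight y * (2 * a * y)⁻¹ := by
          have := gaussWeight_pos y
          exact mul_le_mul_of_nonneg_left (inv_exp_sub_one_le (by positivity)) (by positivity)
      _ = _ := by rw [pow_succ]; field_simp
  have hJmeas : Measurable J := by
    rw [hJ]
    fun_prop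
  have hTint : MeasureTheory.IntegrableOn (fun y => J y + M y) (Set.Ioi 0) := by
    refine MeasureTheory.Integrable.mono' ((hi m).const_mul (2 * a)⁻¹) ?_ ?_
    · exact hJmeas.aestronglyMeasurable.add hMint.aestronglyMeasurable
    · filter_upwards [MeasureTheory.ae_restrict_mem measurableSet_Ioi] with y hy
      exact hdec1 y hy
  have hT : ‖∫ y in Set.Ioi (0 : ℝ), (J y + M y)‖ < (1 - Real.pi / 8) * gaussMoment (m + 1) := by
    rcases hm.eq_or_lt with h1 | h1
    · subst h1
      refine lt_of_le_of_lt ?_ gaussMoment_tail_lt'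
      have e : gaussMoment 1 / (2 * (Real.pi / √2)) - 3 / 8 * gaussMoment 2
          + (2 * (Real.pi / √2)) / 16 * gaussMoment 3 = ∫ y in Set.Ioi (0 : ℝ),
            ((2 * a)⁻¹ * (y ^ 1 * gaussWeight y) - 3 / 8 * (y ^ 2 * gaussWeight y) +
              (2 * a) / 16 * (y ^ 3 * gaussWeight y)) := by
        have hh : MeasureTheory.IntegrableOn (fun y : ℝ => (2 * a)⁻¹ * (y ^ 1 * gaussWeight y) -
            3 / 8 * (y ^ 2 * gaussWeight y)) (Set.Ioi 0) :=
          ((hi _).const_mul _).sub ((hi _).const_mul _)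
        rw [MeasureTheory.integral_add hh ((hi _).const_mul _),
          MeasureTheory.integral_sub ((hi _).const_mul _) ((hi _).const_mul _),
          MeasureTheory.integral_const_mul, MeasureTheory.integral_const_mul,
          MeasureTheory.integral_const_mul, ← ha, div_eq_inv_mul]
        rfl
      rw [e]
      refine MeasureTheory.norm_integral_le_of_norm_le
        ((((hi _).const_mul _).sub ((hi _).const_mul _)).add ((hi _).const_mul _)) ?_
      filter_upwards [MeasureTheory.ae_restrict_mem measurableSet_Ioi] with y hy
      have hy0 : 0 < y := hy
      refine (htail y hy).trans ?_
      calc _ ≤ y ^ (1 + 1) * gaussWeight y * ((2 * a * y)⁻¹ - 3 / 8 + 2 * a * y / 16) := by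
            have := gaussWeight_pos y
            gcongr
            exact inv_exp_sub_one_le' (by positivity)
        _ = _ := by
          field_simp
          ring
    · refine lt_of_le_of_lt ?_ (gaussMoment_tail_lt h1)
      have e : gaussMoment m / (2 * (Real.pi / √2)) =
          ∫ y in Set.Ioi (0 : ℝ), (2 * a)⁻¹ * (y ^ m * gaussWeight y) := by
        rw [MeasureTheory.integral_const_mul, ← ha, div_eq_inv_mul]
        rfl
      rw [e]
      refine MeasureTheory.norm_integral_le_of_norm_le ((hi _).const_mul _) ?_
      filter_upwards [MeasureTheory.ae_restrict_mem measurableSet_Ioi] with y hy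
      exact hdec1 y hy
  intro h0
  rw [← hJ] at h0
  have hsum : ∫ y in Set.Ioi (0 : ℝ), (J y + M y) = ∫ y in Set.Ioi (0 : ℝ), M y := by
    have hJint : MeasureTheory.IntegrableOn J (Set.Ioi 0) := by
      have := hTint.sub hMint
      refine this.congr (Filter.Eventually.of_forall fun y => ?_)
      simp
    rw [MeasureTheory.integral_add hJint hMint, h0, zero_add]
  have := norm_integral_gaussWeight_mul_exp_ge m
  rw [hsum, hM] at hT
  linarith

/-! ### Shifting lines of integration under Gaussian decay. -/

theorem integrable_of_continuous_of_gaussian_bound {g : ℝ → ℂ} (hg : Continuous g) {K M : ℝ}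
    (hb : ∀ u, M ≤ |u| → ‖g u‖ ≤ K * Real.exp (-u ^ 2)) : MeasureTheory.Integrable g := by
  have hgauss : MeasureTheory.Integrable fun u : ℝ => Real.exp (-u ^ 2) := by
    simpa using integrable_exp_neg_mul_sq (one_pos)
  refine hg.locallyIntegrable.integrable_of_isBigO_cocompact (g := fun u => Real.exp (-u ^ 2)) ?_
    (hgauss.integrableAtFilter _)
  refine Asymptotics.IsBigO.of_bound K ?_
  have := (isCompact_closedBall (0 : ℝ) M).compl_mem_cocompact
  filter_upwards [this] with u hu
  rw [Real.norm_of_nonneg (Real.exp_pos _).le]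
  refine hb u ?_
  have : ¬ |u| ≤ M := by simpa [Real.norm_eq_abs] using hu
  linarith

open Filter Topology in
/-- Two horizontal line integrals of a function holomorphic with Gaussian decay in the strip between
them agree. -/
theorem integral_horizontal_eq {G : ℂ → ℂ} {a b K M : ℝ} (hab : a ≤ b)
    (hc : ContinuousOn G {z | a ≤ z.im ∧ z.im ≤ b})
    (hd : ∀ z : ℂ, a < z.im → z.im < b → DifferentiableAt ℂ G z)
    (hb : ∀ z : ℂ, a ≤ z.im → z.im ≤ b → M ≤ |z.re| → ‖G z‖ ≤ K * Real.exp (-z.re ^ 2)) :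
    MeasureTheory.Integrable (fun u : ℝ => G (u + a * Complex.I)) ∧
    MeasureTheory.Integrable (fun u : ℝ => G (u + b * Complex.I)) ∧
    ∫ u : ℝ, G (u + a * Complex.I) = ∫ u : ℝ, G (u + b * Complex.I) := by
  have hint : ∀ c, a ≤ c → c ≤ b → MeasureTheory.Integrable (fun u : ℝ => G (u + c * Complex.I)) := by
    intro c h1 h2
    refine integrable_of_continuous_of_gaussian_bound (K := K) (M := M) ?_ (fun u hu => ?_)
    · exact hc.comp_continuous (by fun_prop) (fun u => by simpa using ⟨h1, h2⟩)
    · simpa using hb (u + c * Complex.I) (by simpa using h1) (by simpa using h2) (by simpa using hu)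
  have ha' := hint a le_rfl hab
  have hb' := hint b hab le_rfl
  refine ⟨ha', hb', ?_⟩
  have hrect : ∀ T : ℝ, ((∫ x : ℝ in (-T)..T, G (x + a * Complex.I)) -
      ∫ x : ℝ in (-T)..T, G (x + b * Complex.I)) =
      Complex.I • (∫ y : ℝ in a..b, G ((-T : ℝ) + y * Complex.I)) -
      Complex.I • ∫ y : ℝ in a..b, G (T + y * Complex.I) := by
    intro T
    have := Complex.integral_boundary_rect_eq_zero_of_differentiable_on_off_countable G
      ⟨-T, a⟩ ⟨T, b⟩ ∅ Set.countable_empty (hc.mono ?_) ?_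
    · simp only at this
      linear_combination this
    · intro z hz
      have := hz.2
      simpa [Set.uIcc_of_le hab] using this
    · rintro z ⟨hz, -⟩
      have := hz.2
      simp only [min_eq_left hab, max_eq_right hab] at this
      exact hd z this.1 this.2
  have hvert : ∀ σ : ℝ, |σ| = 1 →
      Tendsto (fun T : ℝ => ∫ y : ℝ in a..b, G ((σ * T : ℝ) + y * Complex.I)) atTop (𝓝 0) := by
    intro σ hσ
    have hlim : Tendsto (fun T : ℝ => |K| * Real.exp (-T ^ 2) * |b - a|) atTop (𝓝 0) := by
      have h1 : Tendsto (fun T : ℝ => Real.exp (-T ^ 2)) atTop (𝓝 0) :=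
        Real.tendsto_exp_neg_atTop_nhds_zero.comp (tendsto_pow_atTop (by norm_num))
      simpa using (h1.const_mul |K|).mul_const |b - a|
    refine squeeze_zero_norm' ?_ hlim
    filter_upwards [eventually_ge_atTop (max M 0)] with T hT
    have hT0 : 0 ≤ T := (le_max_right _ _).trans hT
    have habs : |σ * T| = T := by rw [abs_mul, hσ, one_mul, abs_of_nonneg hT0]
    refine intervalIntegral.norm_integral_le_of_norm_le_const (fun y hy => ?_)
    rw [Set.uIoc_of_le hab] at hy
    have := hb ((σ * T : ℝ) + y * Complex.I) (by simpa using hy.1.le) (by simpa using hy.2)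
      (by simpa [habs] using (le_max_left _ _).trans hT)
    refine this.trans ?_
    have h2 : (((σ * T : ℝ) : ℂ) + y * Complex.I).re = σ * T := by simp
    rw [h2, ← sq_abs, habs]
    gcongr
    exact le_abs_self K
  have hlim1 := (MeasureTheory.intervalIntegral_tendsto_integral ha' tendsto_neg_atTop_atBot
    tendsto_id).sub (MeasureTheory.intervalIntegral_tendsto_integral hb' tendsto_neg_atTop_atBot
    tendsto_id)
  have hlim2 : Tendsto (fun T : ℝ => Complex.I • (∫ y : ℝ in a..b, G ((-T : ℝ) + y * Complex.I)) -
      Complex.I • ∫ y : ℝ in a..b, G (T + y * Complex.I)) atTop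
      (𝓝 (Complex.I • (0 : ℂ) - Complex.I • (0 : ℂ))) := by
    have h1 := hvert (-1) (by simp)
    have h2 := hvert 1 (by simp)
    simp only [neg_mul, one_mul] at h1 h2
    exact (h1.const_smul _).sub (h2.const_smul _)
  have := tendsto_nhds_unique (hlim1.congr (fun T => hrect T)) hlim2
  simp only [smul_zero, sub_zero] at this
  exact sub_eq_zero.1 this

/-- The closed strip between the lines of slope `1` through `p` and `q`. -/
def diagStrip (p q : ℝ) : Set ℂ := {x | p ≤ x.re - x.im ∧ x.re - x.im ≤ q}

theorem norm_exp_pi_mul_I_div_four : ‖Complex.exp (Real.pi * Complex.I / 4)‖ = 1 := by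
  rw [show (Real.pi * Complex.I / 4 : ℂ) = ((Real.pi / 4 : ℝ) : ℂ) * Complex.I by push_cast; ring]
  exact Complex.norm_exp_ofReal_mul_I _

theorem re_sub_im_exp_mul (z : ℂ) :
    (Complex.exp (Real.pi * Complex.I / 4) * z).re - (Complex.exp (Real.pi * Complex.I / 4) * z).im
      = -(√2 * z.im) := by
  rw [exp_pi_mul_I_div_four]
  simp
  ring

/-- Rotation by $e^{-i\pi/4}$ takes the line of slope $1$ through `p` to the horizontal line at
height $-p/\sqrt2$; the real shift of the parameter does not affect integrals. -/
theorem diagLine_eq (p u : ℝ) :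
    (p + u * Complex.exp (Real.pi * Complex.I / 4) : ℂ) = Complex.exp (Real.pi * Complex.I / 4) *
      (((u + p * (√2 / 2) : ℝ) : ℂ) + ((-(p * (√2 / 2)) : ℝ) : ℂ) * Complex.I) := by
  rw [exp_pi_mul_I_div_four]
  have h2 : (√2 : ℂ) * √2 = 2 := by
    rw [← Complex.ofReal_mul, Real.mul_self_sqrt (by norm_num)]; norm_num
  push_cast
  linear_combination (-p / 2 + (p / 4) * (1 + Complex.I ^ 2) : ℂ) * h2 + p / 2 * Complex.I_sq

/-- Two integrals along lines of slope `1` of a function holomorphic with Gaussian decay in the strip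
between them agree. -/
theorem integral_diagLine_eq {G : ℂ → ℂ} {p q K M : ℝ} (hpq : p ≤ q)
    (hc : ContinuousOn G (diagStrip p q))
    (hd : ∀ x : ℂ, p < x.re - x.im → x.re - x.im < q → DifferentiableAt ℂ G x)
    (hb : ∀ x ∈ diagStrip p q, M ≤ ‖x‖ → ‖G x‖ ≤ K * Real.exp (-‖x‖ ^ 2)) :
    MeasureTheory.Integrable
      (fun u : ℝ => G (p + u * Complex.exp (Real.pi * Complex.I / 4))) ∧
    MeasureTheory.Integrable
      (fun u : ℝ => G (q + u * Complex.exp (Real.pi * Complex.I / 4))) ∧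
    ∫ u : ℝ, G (p + u * Complex.exp (Real.pi * Complex.I / 4)) =
      ∫ u : ℝ, G (q + u * Complex.exp (Real.pi * Complex.I / 4)) := by
  obtain ⟨ω, hω⟩ : ∃ ω, ω = Complex.exp (Real.pi * Complex.I / 4) := ⟨_, rfl⟩
  have hωn : ‖ω‖ = 1 := hω ▸ norm_exp_pi_mul_I_div_four
  have hωim : ∀ z : ℂ, (ω * z).re - (ω * z).im = -(√2 * z.im) := hω ▸ re_sub_im_exp_mul
  have hs : √2 * (√2 / 2) = 1 := by
    rw [← mul_div_assoc, Real.mul_self_sqrt (by norm_num)]; norm_num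
  have hs0 : 0 < √2 := by positivity
  have hsc : ∀ r : ℝ, √2 * -(r * (√2 / 2)) = -r := fun r => by linear_combination -r * hs
  have hline : ∀ p u : ℝ, (p + u * ω : ℂ) =
      ω * (((u + p * (√2 / 2) : ℝ) : ℂ) + ((-(p * (√2 / 2)) : ℝ) : ℂ) * Complex.I) :=
    hω ▸ diagLine_eq
  have hmem : ∀ z : ℂ, -(q * (√2 / 2)) ≤ z.im → z.im ≤ -(p * (√2 / 2)) →
      ω * z ∈ diagStrip p q := by
    intro z h1 h2
    simp only [diagStrip, Set.mem_ofPred_eq, hωim]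
    have e1 := mul_le_mul_of_nonneg_left h1 hs0.le
    have e2 := mul_le_mul_of_nonneg_left h2 hs0.le
    rw [hsc] at e1 e2
    constructor <;> linarith
  have key := integral_horizontal_eq (G := fun z => G (ω * z)) (a := -(q * (√2 / 2)))
    (b := -(p * (√2 / 2))) (K := |K|) (M := M) (by gcongr) ?_ ?_ ?_
  · obtain ⟨h1, h2, h3⟩ := key
    simp only [← hω, hline]
    refine ⟨h2.comp_add_right (p * (√2 / 2)), h1.comp_add_right (q * (√2 / 2)), ?_⟩
    rw [MeasureTheory.integral_add_right_eq_self
      (fun u : ℝ => G (ω * ((u : ℂ) + ((-(p * (√2 / 2)) : ℝ) : ℂ) * Complex.I))),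
      MeasureTheory.integral_add_right_eq_self
      (fun u : ℝ => G (ω * ((u : ℂ) + ((-(q * (√2 / 2)) : ℝ) : ℂ) * Complex.I)))]
    exact h3.symm
  · exact hc.comp (by fun_prop) (fun z hz => hmem z hz.1 hz.2)
  · intro z h1 h2
    have : DifferentiableAt ℂ G (ω * z) := by
      have e1 := mul_lt_mul_of_pos_left h1 hs0
      have e2 := mul_lt_mul_of_pos_left h2 hs0
      rw [hsc] at e1 e2
      refine hd _ ?_ ?_
      · rw [hωim]; linarith
      · rw [hωim]; linarith
    exact this.comp z (by fun_prop)
  · intro z h1 h2 h3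
    have hn : ‖ω * z‖ = ‖z‖ := by rw [norm_mul, hωn, one_mul]
    have h4 := Complex.abs_re_le_norm z
    have := hb _ (hmem z h1 h2) (by rw [hn]; linarith)
    rw [hn] at this
    refine this.trans ?_
    have h5 : z.re ^ 2 ≤ ‖z‖ ^ 2 := by rw [← sq_abs]; gcongr
    gcongr
    exact le_abs_self K

/-! ### The kernel and its size on lines of slope $1$. -/

/-- The denominator `e^{πix} - e^{-πix}`. -/
noncomputable def auxDen (x : ℂ) : ℂ :=
  Complex.exp (Real.pi * Complex.I * x) - Complex.exp (-(Real.pi * Complex.I * x))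

/-- The factor of `auxIntegrand` that does not depend on `s`. -/
noncomputable def auxKernel (x : ℂ) : ℂ :=
  Complex.exp (Real.pi * Complex.I * x ^ 2) / auxDen x

theorem auxIntegrand_eq (s x : ℂ) : auxIntegrand s x = x ^ (-s) * auxKernel x := by
  rw [auxIntegrand, auxKernel, auxDen, mul_div_assoc]

theorem auxDen_eq_sin (x : ℂ) : auxDen x = 2 * Complex.I * Complex.sin (Real.pi * x) := by
  rw [auxDen, Complex.sin, show -(Real.pi * x) * Complex.I = -(Real.pi * Complex.I * x) by ring,
    show Real.pi * x * Complex.I = Real.pi * Complex.I * x by ring]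
  linear_combination (-Complex.exp (-(Real.pi * Complex.I * x)) +
    Complex.exp (Real.pi * Complex.I * x)) * Complex.I_sq

theorem auxDen_add_one (x : ℂ) : auxDen (x + 1) = -auxDen x := by
  rw [auxDen_eq_sin, auxDen_eq_sin, mul_add, mul_one, Complex.sin_add_pi]
  ring

theorem auxDen_neg (x : ℂ) : auxDen (-x) = -auxDen x := by
  rw [auxDen_eq_sin, auxDen_eq_sin, mul_neg, Complex.sin_neg]
  ring

theorem auxKernel_neg (x : ℂ) : auxKernel (-x) = -auxKernel x := by
  rw [auxKernel, auxKernel, auxDen_neg, neg_sq, div_neg]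

theorem differentiable_auxDen : Differentiable ℂ auxDen := by
  unfold auxDen
  fun_prop

theorem auxDen_eq_zero_iff {x : ℂ} : auxDen x = 0 ↔ ∃ k : ℤ, x = k := by
  have hpi : (Real.pi : ℂ) ≠ 0 := by exact_mod_cast Real.pi_ne_zero
  rw [auxDen_eq_sin]
  simp only [mul_eq_zero, OfNat.ofNat_ne_zero, Complex.I_ne_zero, or_self, false_or,
    Complex.sin_eq_zero_iff]
  refine exists_congr (fun k => ?_)
  rw [mul_comm]
  exact mul_left_inj' hpi

theorem hasDerivAt_auxDen (x : ℂ) :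
    HasDerivAt auxDen (2 * Complex.I * (Complex.cos (Real.pi * x) * Real.pi)) x := by
  have : auxDen = fun x => 2 * Complex.I * Complex.sin (Real.pi * x) := funext auxDen_eq_sin
  rw [this]
  have h1 : HasDerivAt (fun x : ℂ => (Real.pi : ℂ) * x) Real.pi x := by
    simpa using! (hasDerivAt_id x).const_mul (Real.pi : ℂ)
  exact (h1.csin).const_mul _

theorem normSq_sin (z : ℂ) :
    Complex.normSq (Complex.sin z) = Real.sin z.re ^ 2 + Real.sinh z.im ^ 2 := by
  have h := Complex.sin_eq z
  rw [← Complex.ofReal_sin, ← Complex.ofReal_cos, ← Complex.ofReal_sinh, ← Complex.ofReal_cosh,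
    ← Complex.ofReal_mul, ← Complex.ofReal_mul] at h
  rw [h, Complex.normSq_add_mul_I]
  have h1 := Real.cosh_sq z.im
  have h2 := Real.sin_sq_add_cos_sq z.re
  rw [mul_pow, mul_pow, h1]
  linear_combination Real.sinh z.im ^ 2 * h2

theorem norm_auxDen_sq (x : ℂ) :
    ‖auxDen x‖ ^ 2 = 4 * (Real.sin (Real.pi * x.re) ^ 2 + Real.sinh (Real.pi * x.im) ^ 2) := by
  rw [auxDen_eq_sin, norm_mul, mul_pow, ← Complex.normSq_eq_norm_sq (Complex.sin _), normSq_sin]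
  simp
  norm_num

theorem sq_le_sinh_sq (t : ℝ) : t ^ 2 ≤ Real.sinh t ^ 2 := by
  rw [← sq_abs (Real.sinh t), Real.abs_sinh, ← sq_abs t]
  gcongr
  exact Real.self_le_sinh_iff.2 (abs_nonneg t)

theorem one_le_norm_auxDen_of_im {x : ℂ} (hx : 1 ≤ |x.im|) : 1 ≤ ‖auxDen x‖ := by
  rw [← one_le_sq_iff₀ (norm_nonneg _), norm_auxDen_sq]
  have h1 := sq_le_sinh_sq (Real.pi * x.im)
  have h2 : 1 ≤ x.im ^ 2 := by rw [← sq_abs]; nlinarith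
  have h3 := Real.pi_gt_three
  have h4 := sq_nonneg (Real.sin (Real.pi * x.re))
  rw [mul_pow] at h1
  nlinarith

/-- On this line $\sin(\pi\operatorname{Re}x)=\cos(\pi\operatorname{Im}x)$, so $|\sin\pi
x|^2=1-\sin^2t+\sinh^2t\ge1$ with $t=\pi\operatorname{Im}x$. -/
theorem one_le_norm_auxDen_of_half {x : ℂ} (hx : x.re - x.im = 1 / 2) : 1 ≤ ‖auxDen x‖ := by
  rw [← one_le_sq_iff₀ (norm_nonneg _), norm_auxDen_sq]
  have h1 := sq_le_sinh_sq (Real.pi * x.im)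
  have h2 : Real.sin (Real.pi * x.re) = Real.cos (Real.pi * x.im) := by
    rw [show x.re = 1 / 2 + x.im by linarith, ← Real.sin_pi_div_two_sub, ← Real.sin_pi_sub]
    congr 1; ring
  have h3 := Real.cos_sq' (Real.pi * x.im)
  have h4 : Real.sin (Real.pi * x.im) ^ 2 ≤ (Real.pi * x.im) ^ 2 := by
    rw [← sq_abs (Real.sin _), ← sq_abs (Real.pi * x.im)]
    exact pow_le_pow_left₀ (abs_nonneg _) Real.abs_sin_le_abs 2
  rw [h2, h3]
  linarith

/-- The source of all Gaussian decay:
$\operatorname{Re}(ix^2)=-2\operatorname{Re}x\operatorname{Im}x$, and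
$\operatorname{Re}x-\operatorname{Im}x$ is constant on a line of slope $1$. -/
theorem norm_exp_pi_mul_I_mul_sq (x : ℂ) : ‖Complex.exp (Real.pi * Complex.I * x ^ 2)‖ =
    Real.exp (-Real.pi * ‖x‖ ^ 2 + Real.pi * (x.re - x.im) ^ 2) := by
  rw [Complex.norm_exp, ← Complex.normSq_eq_norm_sq, Complex.normSq_apply]
  congr 1
  simp [pow_two]
  ring

theorem one_le_norm_auxDen {x : ℂ} (hd : 0 ≤ x.re - x.im) (hd' : x.re - x.im ≤ 3 / 2)
    (h : 5 ≤ ‖x‖ ∨ x.re - x.im = 1 / 2 ∨ x.re - x.im = 3 / 2) : 1 ≤ ‖auxDen x‖ := by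
  rcases h with h | h | h
  · apply one_le_norm_auxDen_of_im
    have h1 := Complex.norm_le_abs_re_add_abs_im x
    have h2 : |x.re| ≤ |x.im| + 3 / 2 := by
      rw [abs_le]
      constructor <;> linarith [neg_abs_le x.im, le_abs_self x.im]
    linarith
  · exact one_le_norm_auxDen_of_half h
  · have : auxDen x = -auxDen (x - 1) := by rw [← auxDen_add_one]; ring_nf
    rw [this, norm_neg]
    apply one_le_norm_auxDen_of_half
    simp only [Complex.sub_re, Complex.sub_im, Complex.one_re, Complex.one_im]
    linarith

theorem norm_auxKernel_le {x : ℂ} (hd : 0 ≤ x.re - x.im) (hd' : x.re - x.im ≤ 3 / 2)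
    (h : 5 ≤ ‖x‖ ∨ x.re - x.im = 1 / 2 ∨ x.re - x.im = 3 / 2) :
    ‖auxKernel x‖ ≤ Real.exp (9 * Real.pi / 4) * Real.exp (-Real.pi * ‖x‖ ^ 2) := by
  have hden := one_le_norm_auxDen hd hd' h
  rw [auxKernel, norm_div, norm_exp_pi_mul_I_mul_sq]
  refine (div_le_self (Real.exp_pos _).le hden).trans ?_
  rw [← Real.exp_add, Real.exp_le_exp]
  have h2 : (x.re - x.im) ^ 2 ≤ (3 / 2) ^ 2 := by gcongr
  have := mul_le_mul_of_nonneg_left h2 Real.pi_pos.le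
  linarith

/-! ### Growth in `s`, and differentiation under the integral sign. -/

/-- A bound for the growth in `s` of `riemannAux`. -/
noncomputable def auxGrowth (A : ℝ) : ℝ := (4 * (1 + A)) ^ A * Real.exp (Real.pi * A)

theorem auxGrowth_pos {A : ℝ} (hA : 0 ≤ A) : 0 < auxGrowth A := by
  unfold auxGrowth
  positivity

theorem auxGrowth_mono {A B : ℝ} (hA : 0 ≤ A) (hAB : A ≤ B) : auxGrowth A ≤ auxGrowth B := by
  unfold auxGrowth
  have : 0 ≤ B := hA.trans hAB
  gcongr
  calc (4 * (1 + A)) ^ A ≤ (4 * (1 + B)) ^ A := by gcongr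
    _ ≤ _ := Real.rpow_le_rpow_of_exponent_le (by linarith) hAB

/-- For $r\ge A$ use $(1+r)^A\le e^{Ar}\le e^{r^2}$. The Gaussian factor is later absorbed by the
kernel. -/
theorem one_add_rpow_le {A r : ℝ} (hA : 0 ≤ A) (hr : 0 ≤ r) :
    (1 + r) ^ A ≤ (1 + A) ^ A * Real.exp (r ^ 2) := by
  rcases le_total r A with h | h
  · calc (1 + r) ^ A ≤ (1 + A) ^ A := by gcongr
      _ ≤ _ := le_mul_of_one_le_right (by positivity) (Real.one_le_exp (sq_nonneg r))
  · have h1 : (1 : ℝ) ≤ (1 + A) ^ A := Real.one_le_rpow (by linarith) hA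
    refine le_trans ?_ (le_mul_of_one_le_left (Real.exp_pos _).le h1)
    rw [Real.rpow_def_of_pos (by linarith), Real.exp_le_exp]
    have h2 : Real.log (1 + r) ≤ r := by
      have := Real.log_le_sub_one_of_pos (show 0 < 1 + r by linarith)
      linarith
    have h3 : 0 ≤ Real.log (1 + r) := Real.log_nonneg (by linarith)
    nlinarith

theorem norm_cpow_neg_le (s : ℂ) {x : ℂ} (hx : 1 / 4 ≤ ‖x‖) :
    ‖x ^ (-s)‖ ≤ auxGrowth ‖s‖ * Real.exp (‖x‖ ^ 2) := by
  have hx0 : 0 < ‖x‖ := by linarith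
  rw [Complex.norm_cpow_of_ne_zero (norm_pos_iff.1 hx0), div_eq_mul_inv, ← Real.exp_neg]
  have h1 : Real.exp (-(x.arg * (-s).im)) ≤ Real.exp (Real.pi * ‖s‖) := by
    rw [Real.exp_le_exp]
    refine (le_abs_self _).trans ?_
    rw [abs_neg, abs_mul]
    gcongr
    · exact Complex.abs_arg_le_pi x
    · rw [← norm_neg]; exact Complex.abs_im_le_norm (-s)
  -- As $|x|\ge\frac14$, the number $4(1+|x|)$ dominates both $|x|$ and $|x|^{-1}$, which covers
  -- either sign of $\operatorname{Re}s$.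
  have hbase : 1 ≤ 4 * (1 + ‖x‖) := by linarith
  have h2 : ‖x‖ ^ (-s).re ≤ (4 * (1 + ‖x‖)) ^ ‖s‖ := by
    have hre := Complex.abs_re_le_norm s
    rw [abs_le] at hre
    rcases le_total 0 (-s).re with h | h
    · calc ‖x‖ ^ (-s).re ≤ (4 * (1 + ‖x‖)) ^ (-s).re := by
            gcongr
            linarith
        _ ≤ _ := Real.rpow_le_rpow_of_exponent_le hbase (by simp; linarith)
    · calc ‖x‖ ^ (-s).re = (‖x‖⁻¹) ^ s.re := by
            rw [Complex.neg_re, Real.rpow_neg hx0.le, Real.inv_rpow hx0.le]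
        _ ≤ (4 * (1 + ‖x‖)) ^ s.re := by
            have : 0 ≤ s.re := by simpa using h
            gcongr
            rw [inv_le_iff_one_le_mul₀ hx0]
            nlinarith
        _ ≤ _ := Real.rpow_le_rpow_of_exponent_le hbase (by linarith)
  calc _ ≤ (4 * (1 + ‖x‖)) ^ ‖s‖ * Real.exp (Real.pi * ‖s‖) := by gcongr
    _ ≤ 4 ^ ‖s‖ * ((1 + ‖s‖) ^ ‖s‖ * Real.exp (‖x‖ ^ 2)) * Real.exp (Real.pi * ‖s‖) := by
        rw [Real.mul_rpow (by norm_num) (by linarith)]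
        gcongr
        exact one_add_rpow_le (norm_nonneg s) hx0.le
    _ = _ := by
        rw [auxGrowth, Real.mul_rpow (by norm_num) (by positivity)]
        ring

theorem norm_log_le {x : ℂ} (hx : 1 / 4 ≤ ‖x‖) : ‖Complex.log x‖ ≤ 8 * Real.exp (‖x‖ ^ 2) := by
  have hx0 : 0 < ‖x‖ := by linarith
  have h1 : ‖Complex.log x‖ ≤ |Real.log ‖x‖| + Real.pi := by
    refine (Complex.norm_le_abs_re_add_abs_im _).trans ?_
    rw [Complex.log_re, Complex.log_im]
    gcongr
    exact Complex.abs_arg_le_pi x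
  have h2 : |Real.log ‖x‖| ≤ 3 + ‖x‖ := by
    rw [abs_le]
    constructor
    · have := Real.log_le_sub_one_of_pos (inv_pos.2 hx0)
      rw [Real.log_inv] at this
      have h3 : ‖x‖⁻¹ ≤ 4 := by
        rw [inv_le_comm₀ hx0 (by norm_num)]
        linarith
      linarith
    · have := Real.log_le_sub_one_of_pos hx0
      linarith
  have h3 := Real.pi_lt_d2
  have h4 := Real.add_one_le_exp (‖x‖ ^ 2)
  nlinarith [sq_nonneg (‖x‖ - 1)]

theorem quarter_le_norm {x : ℂ} (hx : 1 / 2 ≤ x.re - x.im) : 1 / 4 ≤ ‖x‖ := by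
  have h1 := Complex.abs_re_le_norm x
  have h2 := Complex.abs_im_le_norm x
  rw [abs_le] at h1 h2
  linarith [h1.2, h2.1]

theorem mem_slitPlane_of_re_sub_im_pos {x : ℂ} (hx : 0 < x.re - x.im) : x ∈ Complex.slitPlane := by
  rw [Complex.mem_slitPlane_iff]
  by_contra! h
  rw [h.2] at hx
  linarith

/-- The point with parameter `u` on the line of slope `1` through `p`. -/
noncomputable def diagLine (p u : ℝ) : ℂ := p + u * Complex.exp (Real.pi * Complex.I / 4)

theorem diagLine_re_sub_im (p u : ℝ) : (diagLine p u).re - (diagLine p u).im = p := by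
  rw [diagLine, exp_pi_mul_I_div_four]
  simp

theorem continuous_diagLine (p : ℝ) : Continuous (diagLine p) := by
  unfold diagLine
  fun_prop

theorem sq_le_norm_diagLine (p u : ℝ) : u ^ 2 / 2 - p ^ 2 ≤ ‖diagLine p u‖ ^ 2 := by
  have h : |u| ≤ ‖diagLine p u‖ + |p| := by
    have h1 : ‖(u : ℂ) * Complex.exp (Real.pi * Complex.I / 4)‖ = |u| := by
      rw [norm_mul, norm_exp_pi_mul_I_div_four, mul_one, Complex.norm_real, Real.norm_eq_abs]
    have h2 : (u : ℂ) * Complex.exp (Real.pi * Complex.I / 4) = diagLine p u - p := by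
      rw [diagLine]; ring
    rw [← h1, h2]
    refine (norm_sub_le _ _).trans ?_
    rw [Complex.norm_real, Real.norm_eq_abs]
  have h3 : u ^ 2 ≤ (‖diagLine p u‖ + |p|) ^ 2 := by
    rw [← sq_abs u]
    gcongr
  rw [← sq_abs p]
  nlinarith [sq_nonneg (‖diagLine p u‖ - |p|)]

theorem exp_neg_norm_sq_diagLine_le (p u : ℝ) :
    Real.exp (-‖diagLine p u‖ ^ 2) ≤ Real.exp (p ^ 2) * Real.exp (-(1 / 2) * u ^ 2) := by
  rw [← Real.exp_add, Real.exp_le_exp]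
  linarith [sq_le_norm_diagLine p u]

theorem norm_cpow_mul_auxKernel_le (s : ℂ) {x : ℂ} (hd : 1 / 2 ≤ x.re - x.im)
    (hd' : x.re - x.im ≤ 3 / 2) (h : 5 ≤ ‖x‖ ∨ x.re - x.im = 1 / 2 ∨ x.re - x.im = 3 / 2) :
    ‖x ^ (-s) * auxKernel x‖ ≤
      auxGrowth ‖s‖ * Real.exp (9 * Real.pi / 4) * Real.exp (-2 * ‖x‖ ^ 2) := by
  have h1 := norm_cpow_neg_le s (quarter_le_norm hd)
  have h2 := norm_auxKernel_le (by linarith) hd' h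
  have h3 := auxGrowth_pos (norm_nonneg s)
  rw [norm_mul]
  calc _ ≤ auxGrowth ‖s‖ * Real.exp (‖x‖ ^ 2) *
        (Real.exp (9 * Real.pi / 4) * Real.exp (-Real.pi * ‖x‖ ^ 2)) := by gcongr
    _ = auxGrowth ‖s‖ * Real.exp (9 * Real.pi / 4) *
        (Real.exp (‖x‖ ^ 2) * Real.exp (-Real.pi * ‖x‖ ^ 2)) := by ring
    _ ≤ _ := by
        rw [← Real.exp_add]
        gcongr
        -- The exponent is $1-\pi<-2$; part of this margin later absorbs the logarithm in the
        -- derivative.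
        nlinarith [Real.pi_gt_three, sq_nonneg ‖x‖]

theorem norm_auxIntegrand_diagLine_le {p : ℝ} (hp : p = 1 / 2 ∨ p = 3 / 2) (s : ℂ) (u : ℝ) :
    ‖auxIntegrand s (diagLine p u)‖ ≤
      auxGrowth ‖s‖ * Real.exp (9 * Real.pi / 4 + 9 / 4) * Real.exp (-(1 / 2) * u ^ 2) := by
  have hd := diagLine_re_sub_im p u
  rw [auxIntegrand_eq]
  have hle : 1 / 2 ≤ p ∧ p ≤ 3 / 2 := by rcases hp with h | h <;> rw [h] <;> norm_num
  refine (norm_cpow_mul_auxKernel_le s (by rw [hd]; exact hle.1) (by rw [hd]; exact hle.2)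
    (by rw [hd]; exact Or.inr hp)).trans ?_
  have h1 := exp_neg_norm_sq_diagLine_le p u
  have h3 := auxGrowth_pos (norm_nonneg s)
  calc _ ≤ auxGrowth ‖s‖ * Real.exp (9 * Real.pi / 4) * Real.exp (-‖diagLine p u‖ ^ 2) := by
        gcongr
        nlinarith [sq_nonneg ‖diagLine p u‖]
    _ ≤ auxGrowth ‖s‖ * Real.exp (9 * Real.pi / 4) *
        (Real.exp (p ^ 2) * Real.exp (-(1 / 2) * u ^ 2)) := by gcongr
    _ ≤ auxGrowth ‖s‖ * Real.exp (9 * Real.pi / 4) *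
        (Real.exp (9 / 4) * Real.exp (-(1 / 2) * u ^ 2)) := by
        gcongr
        nlinarith
    _ = _ := by rw [Real.exp_add]; ring

theorem integrable_exp_neg_half_sq :
    MeasureTheory.Integrable fun u : ℝ => Real.exp (-(1 / 2) * u ^ 2) :=
  integrable_exp_neg_mul_sq (by norm_num)

theorem continuous_cpow_diagLine {p : ℝ} (hp : 0 < p) (s : ℂ) :
    Continuous fun u => diagLine p u ^ s := by
  refine continuous_iff_continuousAt.2 (fun u => ?_)
  exact (continuous_diagLine p).continuousAt.cpow continuousAt_const
    (mem_slitPlane_of_re_sub_im_pos (by rw [diagLine_re_sub_im]; exact hp))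

theorem continuous_log_diagLine {p : ℝ} (hp : 0 < p) :
    Continuous fun u => Complex.log (diagLine p u) := by
  refine continuous_iff_continuousAt.2 (fun u => ?_)
  exact (continuous_diagLine p).continuousAt.clog
    (mem_slitPlane_of_re_sub_im_pos (by rw [diagLine_re_sub_im]; exact hp))

theorem continuous_auxKernel_diagLine {p : ℝ} (hp : p = 1 / 2 ∨ p = 3 / 2) :
    Continuous fun u => auxKernel (diagLine p u) := by
  have hle : 1 / 2 ≤ p ∧ p ≤ 3 / 2 := by rcases hp with h | h <;> rw [h] <;> norm_num
  have h0 : ∀ u, auxDen (diagLine p u) ≠ 0 := by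
    intro u
    have hd := diagLine_re_sub_im p u
    have := one_le_norm_auxDen (x := diagLine p u) (by linarith) (by linarith)
      (by rw [hd]; exact Or.inr hp)
    exact norm_pos_iff.1 (by linarith)
  have := continuous_diagLine p
  exact Continuous.div (by fun_prop) (differentiable_auxDen.continuous.comp this) h0

theorem continuous_auxIntegrand_diagLine {p : ℝ} (hp : p = 1 / 2 ∨ p = 3 / 2) (s : ℂ) :
    Continuous fun u => auxIntegrand s (diagLine p u) := by
  simp only [auxIntegrand_eq]
  have h0 : 0 < p := by rcases hp with h | h <;> rw [h] <;> norm_num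
  exact (continuous_cpow_diagLine h0 (-s)).mul (continuous_auxKernel_diagLine hp)

theorem integrable_auxIntegrand_diagLine {p : ℝ} (hp : p = 1 / 2 ∨ p = 3 / 2) (s : ℂ) :
    MeasureTheory.Integrable fun u => auxIntegrand s (diagLine p u) :=
  MeasureTheory.Integrable.mono' (integrable_exp_neg_half_sq.const_mul _)
    (continuous_auxIntegrand_diagLine hp s).aestronglyMeasurable
    (Filter.Eventually.of_forall (norm_auxIntegrand_diagLine_le hp s))

theorem riemannAux_eq (s : ℂ) : riemannAux s =
    -((∫ u : ℝ, auxIntegrand s (diagLine (1 / 2) u)) * Complex.exp (Real.pi * Complex.I / 4)) := by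
  rw [riemannAux, MeasureTheory.integral_mul_const]
  congr 2
  refine MeasureTheory.integral_congr_ae (Filter.Eventually.of_forall fun u => ?_)
  simp [diagLine]

theorem hasDerivAt_riemannAux (s : ℂ) : HasDerivAt riemannAux
    ((∫ u : ℝ, Complex.log (diagLine (1 / 2) u) * auxIntegrand s (diagLine (1 / 2) u)) *
      Complex.exp (Real.pi * Complex.I / 4)) s := by
  have hp : (1 / 2 : ℝ) = 1 / 2 ∨ (1 / 2 : ℝ) = 3 / 2 := Or.inl rfl
  have hne : ∀ u, diagLine (1 / 2) u ≠ 0 := fun u => Complex.slitPlane_ne_zero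
    (mem_slitPlane_of_re_sub_im_pos (by rw [diagLine_re_sub_im]; norm_num))
  have key := hasDerivAt_integral_of_dominated_loc_of_deriv_le (𝕜 := ℂ) (μ := MeasureTheory.volume)
    (F := fun s u => auxIntegrand s (diagLine (1 / 2) u))
    (F' := fun s u => -(Complex.log (diagLine (1 / 2) u) * auxIntegrand s (diagLine (1 / 2) u)))
    (x₀ := s) (s := Metric.ball s 1)
    (bound := fun u => 8 * (auxGrowth (‖s‖ + 1) * Real.exp (9 * Real.pi / 4) *
      (Real.exp ((1 / 2) ^ 2) * Real.exp (-(1 / 2) * u ^ 2))))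
    (Metric.ball_mem_nhds s one_pos)
    (Filter.Eventually.of_forall fun s =>
      (continuous_auxIntegrand_diagLine hp s).aestronglyMeasurable)
    (integrable_auxIntegrand_diagLine hp s)
    (((continuous_log_diagLine (by norm_num)).mul
      (continuous_auxIntegrand_diagLine hp s)).neg.aestronglyMeasurable)
    (Filter.Eventually.of_forall fun u w hw => ?_)
    (((integrable_exp_neg_half_sq.const_mul _).const_mul _).const_mul _)
    (Filter.Eventually.of_forall fun u w hw => ?_)
  · have h2 := (key.2.mul_const (Complex.exp (Real.pi * Complex.I / 4))).neg
    have h3 : riemannAux = -fun s => (∫ u : ℝ, auxIntegrand s (diagLine (1 / 2) u)) *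
        Complex.exp (Real.pi * Complex.I / 4) := funext riemannAux_eq
    rw [h3]
    refine h2.congr_deriv ?_
    rw [MeasureTheory.integral_neg]
    ring
  · have hd := diagLine_re_sub_im (1 / 2) u
    have h1 := norm_cpow_mul_auxKernel_le w (x := diagLine (1 / 2) u) hd.ge (by linarith)
      (Or.inr (Or.inl hd))
    have h2 := norm_log_le (quarter_le_norm hd.ge)
    have h3 : auxGrowth ‖w‖ ≤ auxGrowth (‖s‖ + 1) := by
      apply auxGrowth_mono (norm_nonneg _)
      rw [mem_ball_iff_norm] at hw
      have := norm_le_norm_add_norm_sub' w s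
      linarith
    have h4 := auxGrowth_pos (norm_nonneg w)
    rw [norm_neg, norm_mul, auxIntegrand_eq]
    calc _ ≤ 8 * Real.exp (‖diagLine (1 / 2) u‖ ^ 2) * (auxGrowth ‖w‖ *
          Real.exp (9 * Real.pi / 4) * Real.exp (-2 * ‖diagLine (1 / 2) u‖ ^ 2)) := by gcongr
      _ = 8 * (auxGrowth ‖w‖ * Real.exp (9 * Real.pi / 4) *
          (Real.exp (‖diagLine (1 / 2) u‖ ^ 2) * Real.exp (-2 * ‖diagLine (1 / 2) u‖ ^ 2))) := by
          ring
      _ = 8 * (auxGrowth ‖w‖ * Real.exp (9 * Real.pi / 4) *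
          Real.exp (-‖diagLine (1 / 2) u‖ ^ 2)) := by
          rw [← Real.exp_add]; ring_nf
      _ ≤ _ := by
          have := exp_neg_norm_sq_diagLine_le (1 / 2) u
          have h5 : 0 ≤ auxGrowth (‖s‖ + 1) := h4.le.trans h3
          gcongr
  · simp only [auxIntegrand_eq]
    have h1 : HasDerivAt (fun w : ℂ => diagLine (1 / 2) u ^ (-w))
        (diagLine (1 / 2) u ^ (-w) * Complex.log (diagLine (1 / 2) u) * (-1)) w :=
      (hasDerivAt_neg w).const_cpow (Or.inl (hne u))
    refine (h1.mul_const (auxKernel (diagLine (1 / 2) u))).congr_deriv ?_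
    ring

theorem differentiable_riemannAux : Differentiable ℂ riemannAux := fun s =>
  (hasDerivAt_riemannAux s).differentiableAt

theorem exists_norm_riemannAux_le : ∃ K, 0 < K ∧ ∀ s, ‖riemannAux s‖ ≤ K * auxGrowth ‖s‖ := by
  obtain ⟨B, hB⟩ : ∃ B, B = ∫ u : ℝ, Real.exp (-(1 / 2) * u ^ 2) := ⟨_, rfl⟩
  have hB0 : 0 ≤ B := hB ▸ MeasureTheory.integral_nonneg fun u => (Real.exp_pos _).le
  refine ⟨Real.exp (9 * Real.pi / 4 + 9 / 4) * B + 1, by positivity, fun s => ?_⟩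
  have h3 := auxGrowth_pos (norm_nonneg s)
  rw [riemannAux_eq, norm_neg, norm_mul, norm_exp_pi_mul_I_div_four, mul_one]
  have := MeasureTheory.norm_integral_le_of_norm_le
    (integrable_exp_neg_half_sq.const_mul (auxGrowth ‖s‖ * Real.exp (9 * Real.pi / 4 + 9 / 4)))
    (Filter.Eventually.of_forall (norm_auxIntegrand_diagLine_le (p := 1 / 2) (Or.inl rfl) s))
  rw [MeasureTheory.integral_const_mul, ← hB] at this
  refine this.trans ?_
  nlinarith

/-! ### Crossing an integer, the value at $0$, and the limit $1$ to the right. -/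

/-- The zeros of the denominator are simple, so $e^{\pi ix^2}$ divided by this slope extends
$(x-k)\cdot$`auxKernel x` holomorphically across `k`. Residues thus become removable singularities.
-/
theorem dslope_auxDen_ne_zero {k : ℤ} {x : ℂ} (h : ∀ j : ℤ, x = j → j = k) :
    dslope auxDen k x ≠ 0 := by
  by_cases hx : x = k
  · rw [hx, dslope_same, (hasDerivAt_auxDen _).deriv]
    have h1 : Complex.sin (Real.pi * (k : ℂ)) = 0 := by
      rw [mul_comm]; exact Complex.sin_int_mul_pi k
    have h2 := Complex.sin_sq_add_cos_sq (Real.pi * (k : ℂ))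
    have h3 : Complex.cos (Real.pi * (k : ℂ)) ≠ 0 := by
      intro h3
      rw [h1, h3] at h2
      norm_num at h2
    have hpi : (Real.pi : ℂ) ≠ 0 := by exact_mod_cast Real.pi_ne_zero
    simp [h3, hpi]
  · have h0 : auxDen k = 0 := auxDen_eq_zero_iff.2 ⟨k, rfl⟩
    rw [dslope_of_ne _ hx, slope_def_field, h0, sub_zero]
    refine div_ne_zero (fun h1 => ?_) (sub_ne_zero.2 hx)
    obtain ⟨j, hj⟩ := auxDen_eq_zero_iff.1 h1
    exact hx (by rw [hj, h j hj])

theorem differentiable_dslope_auxDen (c : ℂ) : Differentiable ℂ (dslope auxDen c) := by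
  rw [← differentiableOn_univ, Complex.differentiableOn_dslope Filter.univ_mem]
  exact differentiable_auxDen.differentiableOn

theorem mul_sub_mul_auxKernel {k : ℤ} {x : ℂ} (hx : x ≠ k) (y : ℂ) :
    y * (x - k) * auxKernel x =
      y * (Complex.exp (Real.pi * Complex.I * x ^ 2) / dslope auxDen k x) := by
  have h0 : auxDen k = 0 := auxDen_eq_zero_iff.2 ⟨k, rfl⟩
  rw [dslope_of_ne _ hx, slope_def_field, h0, sub_zero, auxKernel, div_div_eq_mul_div]
  ring

/-- At the integer `k` itself `auxKernel` has the default value $0$ of a division by zero; a line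
meets that point for at most one parameter. -/
theorem ae_diagLine_ne (p : ℝ) (c : ℂ) : ∀ᵐ u : ℝ, diagLine p u ≠ c := by
  have hs : {u : ℝ | diagLine p u = c}.Subsingleton := by
    intro u hu v hv
    have h : diagLine p u = diagLine p v := hu.trans hv.symm
    simp only [diagLine, add_right_inj] at h
    exact_mod_cast mul_right_cancel₀ (Complex.exp_ne_zero _) h
  rw [MeasureTheory.ae_iff]
  simpa using hs.measure_zero MeasureTheory.volume

/-- Moving the line of integration across or onto a removable singularity at the integer `k`. -/
theorem integral_mul_auxKernel_diagLine_eq {k : ℤ} {p q K M : ℝ} {ψ : ℂ → ℂ} (hp : 0 ≤ p)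
    (hpq : p ≤ q) (hq : q ≤ 3 / 2) (hk : ∀ j : ℤ, p ≤ j → (j : ℝ) ≤ q → j = k)
    (hc : ContinuousOn ψ (diagStrip p q))
    (hd : ∀ x : ℂ, p < x.re - x.im → x.re - x.im < q → DifferentiableAt ℂ ψ x)
    (hb : ∀ x ∈ diagStrip p q, M ≤ ‖x‖ → ‖ψ x * (x - k)‖ ≤ K * Real.exp (‖x‖ ^ 2)) :
    MeasureTheory.Integrable
      (fun u : ℝ => ψ (diagLine p u) * (diagLine p u - k) * auxKernel (diagLine p u)) ∧
    ∫ u : ℝ, ψ (diagLine p u) * (diagLine p u - k) * auxKernel (diagLine p u) =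
      ∫ u : ℝ, ψ (diagLine q u) * (diagLine q u - k) * auxKernel (diagLine q u) := by
  have hne : ∀ x ∈ diagStrip p q, dslope auxDen k x ≠ 0 := by
    intro x hx
    refine dslope_auxDen_ne_zero (fun j hj => hk j ?_ ?_)
    · simpa [hj] using hx.1
    · simpa [hj] using hx.2
  have hds := differentiable_dslope_auxDen k
  have key := integral_diagLine_eq
    (G := fun x => ψ x * (Complex.exp (Real.pi * Complex.I * x ^ 2) / dslope auxDen k x))
    (p := p) (q := q) (K := |K| * Real.exp (9 * Real.pi / 4)) (M := max M (max 5 (‖(k : ℂ)‖ + 1)))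
    hpq ?_ ?_ ?_
  · obtain ⟨h1, h2, h3⟩ := key
    have hcongr : ∀ r, (fun u : ℝ => ψ (diagLine r u) * (diagLine r u - k) *
        auxKernel (diagLine r u)) =ᵐ[MeasureTheory.volume]
        fun u => ψ (diagLine r u) * (Complex.exp (Real.pi * Complex.I * diagLine r u ^ 2) /
          dslope auxDen k (diagLine r u)) := by
      intro r
      filter_upwards [ae_diagLine_ne r k] with u hu
      exact mul_sub_mul_auxKernel hu _
    refine ⟨h1.congr (hcongr p).symm, ?_⟩
    rw [MeasureTheory.integral_congr_ae (hcongr p), MeasureTheory.integral_congr_ae (hcongr q)]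
    exact h3
  · exact hc.mul (ContinuousOn.div (by fun_prop) hds.continuous.continuousOn hne)
  · intro x h1 h2
    refine (hd x h1 h2).mul (DifferentiableAt.div (by fun_prop) (hds x) (hne x ⟨h1.le, h2.le⟩))
  · intro x hx hM
    have hx1 : M ≤ ‖x‖ := (le_max_left _ _).trans hM
    have hx2 : 5 ≤ ‖x‖ := (le_max_left _ _).trans ((le_max_right _ _).trans hM)
    have hx3 : ‖(k : ℂ)‖ + 1 ≤ ‖x‖ := (le_max_right _ _).trans ((le_max_right _ _).trans hM)
    have hxk : x ≠ k := by
      rintro rfl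
      linarith
    have h1 := norm_auxKernel_le (hp.trans hx.1) (hx.2.trans hq) (Or.inl hx2)
    rw [← mul_sub_mul_auxKernel hxk, norm_mul]
    calc _ ≤ |K| * Real.exp (‖x‖ ^ 2) * (Real.exp (9 * Real.pi / 4) *
          Real.exp (-Real.pi * ‖x‖ ^ 2)) := by
          gcongr
          refine (hb x hx hx1).trans ?_
          gcongr
          exact le_abs_self K
      _ = |K| * Real.exp (9 * Real.pi / 4) * (Real.exp (‖x‖ ^ 2) *
          Real.exp (-Real.pi * ‖x‖ ^ 2)) := by ring
      _ ≤ _ := by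
          rw [← Real.exp_add]
          gcongr
          nlinarith [Real.pi_gt_three, sq_nonneg ‖x‖]

theorem exp_pi_mul_I_div_four_sq : Complex.exp (Real.pi * Complex.I / 4) ^ 2 = Complex.I := by
  rw [← Complex.exp_nat_mul, show ((2 : ℕ) : ℂ) * (Real.pi * Complex.I / 4) =
    Real.pi / 2 * Complex.I by push_cast; ring, Complex.exp_pi_div_two_mul_I]

/-- The denominator changes sign under $x\mapsto x+1$, and the two numerators then add up to a
multiple of it, leaving a pure Gaussian. This functional equation replaces the residue at an
integer. -/
theorem auxKernel_sub_auxKernel_add_one {x : ℂ} (hx : auxDen x ≠ 0) :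
    auxKernel x - auxKernel (x + 1) =
      -Complex.exp (Real.pi * Complex.I * (x ^ 2 + x)) := by
  have h1 : auxKernel (x + 1) = -(Complex.exp (Real.pi * Complex.I * (x + 1) ^ 2) / auxDen x) := by
    rw [auxKernel, auxDen_add_one, div_neg]
  have h2 : Complex.exp (Real.pi * Complex.I * (x + 1) ^ 2) =
      -(Complex.exp (Real.pi * Complex.I * (x ^ 2 + x)) *
        Complex.exp (Real.pi * Complex.I * x)) := by
    rw [← Complex.exp_add, ← neg_one_mul, ← Complex.exp_pi_mul_I, ← Complex.exp_add]
    congr 1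
    ring
  have h3 : Complex.exp (Real.pi * Complex.I * x ^ 2) =
      Complex.exp (Real.pi * Complex.I * (x ^ 2 + x)) *
        Complex.exp (-(Real.pi * Complex.I * x)) := by
    rw [← Complex.exp_add]
    congr 1
    ring
  rw [h1, h2, auxKernel, h3, sub_neg_eq_add, ← add_div, div_eq_iff hx, auxDen]
  ring

theorem diagLine_add_one (p u : ℝ) : diagLine (p + 1) u = diagLine p u + 1 := by
  simp only [diagLine]
  push_cast
  ring

theorem diagLine_neg (p u : ℝ) : diagLine (-p) (-u) = -diagLine p u := by
  simp only [diagLine]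
  push_cast
  ring

theorem pi_mul_I_mul_diagLine_sq_add (p u : ℝ) :
    Real.pi * Complex.I * (diagLine p u ^ 2 + diagLine p u) = -Real.pi * (u : ℂ) ^ 2 +
      Real.pi * Complex.I * (2 * p + 1) * Complex.exp (Real.pi * Complex.I / 4) * u +
      Real.pi * Complex.I * (p ^ 2 + p) := by
  simp only [diagLine]
  linear_combination Real.pi * Complex.I * u ^ 2 * exp_pi_mul_I_div_four_sq +
    Real.pi * u ^ 2 * Complex.I_sq

theorem re_neg_pi_neg : (-(Real.pi : ℂ)).re < 0 := by
  simpa using Real.pi_pos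

theorem integrable_exp_diagLine_sq_add (p : ℝ) : MeasureTheory.Integrable fun u : ℝ =>
    Complex.exp (Real.pi * Complex.I * (diagLine p u ^ 2 + diagLine p u)) := by
  simp only [pi_mul_I_mul_diagLine_sq_add]
  exact integrable_cexp_quadratic' re_neg_pi_neg _ _

/-- Completing the square yields $e^{-i\pi/4}$, whatever `p` is. -/
theorem integral_exp_diagLine_sq_add (p : ℝ) :
    (∫ u : ℝ, Complex.exp (Real.pi * Complex.I * (diagLine p u ^ 2 + diagLine p u))) *
      Complex.exp (Real.pi * Complex.I / 4) = 1 := by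
  have hpi : (Real.pi : ℂ) ≠ 0 := by exact_mod_cast Real.pi_ne_zero
  simp only [pi_mul_I_mul_diagLine_sq_add]
  rw [integral_cexp_quadratic re_neg_pi_neg, neg_neg, div_self hpi, Complex.one_cpow, one_mul,
    ← Complex.exp_add, Complex.exp_eq_one_iff]
  refine ⟨0, ?_⟩
  have h : (Real.pi * Complex.I * (2 * p + 1) * Complex.exp (Real.pi * Complex.I / 4)) ^ 2 /
      (4 * -(Real.pi : ℂ)) = Real.pi * Complex.I * (2 * p + 1) ^ 2 / 4 := by
    rw [mul_pow, exp_pi_mul_I_div_four_sq, div_eq_iff (by simp)]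
    linear_combination (Real.pi * (2 * p + 1)) ^ 2 * Complex.I * Complex.I_sq
  rw [h]
  push_cast
  ring

theorem integral_auxKernel_diagLine_add_one {p : ℝ}
    (hp : MeasureTheory.Integrable fun u => auxKernel (diagLine p u))
    (h0 : ∀ u, auxDen (diagLine p u) ≠ 0) :
    (∫ u : ℝ, auxKernel (diagLine (p + 1) u)) * Complex.exp (Real.pi * Complex.I / 4) =
      (∫ u : ℝ, auxKernel (diagLine p u)) * Complex.exp (Real.pi * Complex.I / 4) + 1 := by
  have h : ∀ u, auxKernel (diagLine (p + 1) u) = auxKernel (diagLine p u) +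
      Complex.exp (Real.pi * Complex.I * (diagLine p u ^ 2 + diagLine p u)) := by
    intro u
    rw [diagLine_add_one]
    linear_combination -auxKernel_sub_auxKernel_add_one (h0 u)
  simp only [h]
  rw [MeasureTheory.integral_add hp (integrable_exp_diagLine_sq_add p), add_mul,
    integral_exp_diagLine_sq_add]

theorem integrable_auxKernel_diagLine {p : ℝ} (hp : p = 1 / 2 ∨ p = 3 / 2) :
    MeasureTheory.Integrable fun u => auxKernel (diagLine p u) := by
  simpa [auxIntegrand_eq] using integrable_auxIntegrand_diagLine hp 0

theorem auxDen_diagLine_half_ne_zero (u : ℝ) : auxDen (diagLine (1 / 2) u) ≠ 0 := by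
  have := one_le_norm_auxDen_of_half (diagLine_re_sub_im (1 / 2) u)
  exact norm_pos_iff.1 (by linarith)

/-- Oddness of the kernel makes the integrals over the lines through $\pm\frac12$ opposite, while
with the direction factor they differ by $1$; hence $\frac12$ before the orientation sign. -/
theorem riemannAux_zero : riemannAux 0 = -1 / 2 := by
  have hI := integrable_auxKernel_diagLine (p := 1 / 2) (Or.inl rfl)
  have hneg : ∀ u, auxKernel (diagLine (-(1 / 2)) u) = -auxKernel (diagLine (1 / 2) (-u)) := by
    intro u
    rw [← auxKernel_neg, ← diagLine_neg, neg_neg]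
  have h1 : MeasureTheory.Integrable fun u => auxKernel (diagLine (-(1 / 2)) u) := by
    simp only [hneg]
    exact hI.comp_neg.neg
  have h2 : ∀ u, auxDen (diagLine (-(1 / 2)) u) ≠ 0 := by
    intro u
    rw [← neg_neg u, diagLine_neg, auxDen_neg, neg_ne_zero]
    exact auxDen_diagLine_half_ne_zero _
  have h3 := integral_auxKernel_diagLine_add_one h1 h2
  simp only [hneg] at h3
  rw [MeasureTheory.integral_neg,
    MeasureTheory.integral_neg_eq_self (fun u => auxKernel (diagLine (1 / 2) u)),
    show (-(1 / 2) + 1 : ℝ) = 1 / 2 by norm_num] at h3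
  rw [riemannAux_eq]
  simp only [auxIntegrand_eq, neg_zero, Complex.cpow_zero, one_mul]
  linear_combination -h3 / 2

/-- The $1$ is the residue $1^{-s}$ at $x=1$. Write $x^{-s}=(x^{-s}-1)+1$: the first part vanishes
at $1$ and moves across freely, the second obeys the functional equation of the kernel. -/
theorem riemannAux_sub_one (s : ℂ) : riemannAux s - 1 =
    -((∫ u : ℝ, auxIntegrand s (diagLine (3 / 2) u)) * Complex.exp (Real.pi * Complex.I / 4)) := by
  have hslit : ∀ x ∈ {x : ℂ | 0 < x.re - x.im}, DifferentiableAt ℂ (fun x : ℂ => x ^ (-s)) x :=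
    fun x hx => DifferentiableAt.cpow_const differentiableAt_id (mem_slitPlane_of_re_sub_im_pos hx)
  have hopen : IsOpen {x : ℂ | 0 < x.re - x.im} :=
    isOpen_lt continuous_const (Complex.continuous_re.sub Complex.continuous_im)
  have h1mem : {x : ℂ | 0 < x.re - x.im} ∈ nhds (1 : ℂ) := hopen.mem_nhds (by simp)
  have hds : DifferentiableOn ℂ (dslope (fun x : ℂ => x ^ (-s)) 1) {x : ℂ | 0 < x.re - x.im} :=
    (Complex.differentiableOn_dslope h1mem).2 (fun x hx => (hslit x hx).differentiableWithinAt)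
  have hmul : ∀ x : ℂ, dslope (fun x : ℂ => x ^ (-s)) 1 x * (x - (1 : ℤ)) = x ^ (-s) - 1 := by
    intro x
    have := sub_smul_dslope (fun x : ℂ => x ^ (-s)) 1 x
    simp only [smul_eq_mul, Complex.one_cpow] at this
    rw [← this]
    push_cast
    ring
  have key := integral_mul_auxKernel_diagLine_eq (k := 1) (p := 1 / 2) (q := 3 / 2)
    (K := auxGrowth ‖s‖ + 1) (M := 0) (ψ := dslope (fun x : ℂ => x ^ (-s)) 1) (by norm_num)
    (by norm_num) (by norm_num) ?_ (hds.continuousOn.mono ?_) ?_ ?_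
  · have h3 := integral_auxKernel_diagLine_add_one (integrable_auxKernel_diagLine (Or.inl rfl))
      auxDen_diagLine_half_ne_zero
    rw [show (1 / 2 + 1 : ℝ) = 3 / 2 by norm_num] at h3
    have hI : ∀ p : ℝ, p = 1 / 2 ∨ p = 3 / 2 → ∫ u : ℝ, (diagLine p u ^ (-s) - 1) *
        auxKernel (diagLine p u) = (∫ u : ℝ, auxIntegrand s (diagLine p u)) -
          ∫ u : ℝ, auxKernel (diagLine p u) := by
      intro p hp
      rw [← MeasureTheory.integral_sub (integrable_auxIntegrand_diagLine hp s)
        (integrable_auxKernel_diagLine hp)]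
      simp only [auxIntegrand_eq, sub_mul, one_mul]
    have h4 := key.2
    simp only [hmul] at h4
    rw [hI _ (Or.inl rfl), hI _ (Or.inr rfl)] at h4
    rw [riemannAux_eq]
    linear_combination -Complex.exp (Real.pi * Complex.I / 4) * h4 + h3
  · intro j h1 h2
    have h3 : (0 : ℝ) < j := by linarith
    have h4 : (j : ℝ) < 2 := by linarith
    norm_cast at h3 h4
    omega
  · intro x hx
    have := hx.1
    simp only [Set.mem_ofPred_eq]
    linarith
  · intro x h1 h2
    exact hds.differentiableAt (hopen.mem_nhds (by simp only [Set.mem_ofPred_eq]; linarith))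
  · intro x hx _
    rw [hmul]
    have h1 := norm_cpow_neg_le s (quarter_le_norm hx.1)
    have h2 := norm_sub_le (x ^ (-s)) 1
    have h3 := Real.one_le_exp (sq_nonneg ‖x‖)
    rw [norm_one] at h2
    linarith

theorem exists_norm_riemannAux_sub_one_le (T : ℝ) : ∃ c B : ℝ, 0 < c ∧ ∀ s : ℂ, |s.im| ≤ T →
    0 ≤ s.re → ‖riemannAux s - 1‖ ≤ B * Real.exp (-c * s.re) := by
  refine ⟨Real.log (53 / 50), (∫ u : ℝ, ‖auxKernel (diagLine (3 / 2) u)‖) * Real.exp (Real.pi * T),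
    Real.log_pos (by norm_num), fun s hs hs0 => ?_⟩
  have hI := integrable_auxKernel_diagLine (p := 3 / 2) (Or.inr rfl)
  rw [riemannAux_sub_one, norm_neg, norm_mul, norm_exp_pi_mul_I_div_four, mul_one, mul_assoc,
    ← MeasureTheory.integral_mul_const]
  refine MeasureTheory.norm_integral_le_of_norm_le (hI.norm.mul_const _)
    (Filter.Eventually.of_forall fun u => ?_)
  have hd := diagLine_re_sub_im (3 / 2) u
  obtain ⟨x, hx⟩ : ∃ x, x = diagLine (3 / 2) u := ⟨_, rfl⟩
  simp only [← hx] at hd ⊢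
  -- The distance of the line from the origin is $3/(2\sqrt2)>1.06$; being above $1$ it makes
  -- $|x|^{-\operatorname{Re}s}$ decay.
  have hn : 53 / 50 ≤ ‖x‖ := by
    refine le_of_sq_le_sq ?_ (norm_nonneg x)
    rw [← Complex.normSq_eq_norm_sq, Complex.normSq_apply]
    nlinarith [sq_nonneg (x.re + x.im)]
  have hx0 : 0 < ‖x‖ := by linarith
  rw [auxIntegrand_eq, norm_mul, mul_comm]
  gcongr
  rw [Complex.norm_cpow_of_ne_zero (norm_pos_iff.1 hx0), div_eq_mul_inv, ← Real.exp_neg,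
    Real.rpow_def_of_pos hx0, mul_comm]
  refine mul_le_mul (Real.exp_le_exp.2 ?_) ?_ (Real.exp_pos _).le (Real.exp_pos _).le
  · refine (le_abs_self _).trans ?_
    rw [abs_neg, abs_mul, Complex.neg_im, abs_neg]
    gcongr
    exact Complex.abs_arg_le_pi x
  · rw [Complex.neg_re]
    have := Real.log_le_log (by norm_num) hn
    rw [Real.exp_le_exp]
    nlinarith

/-! ### The trivial zeros and their simplicity. -/

theorem mem_slitPlane_of_re_sub_im_nonneg {x : ℂ} (hx : 0 ≤ x.re - x.im) (h0 : x ≠ 0) :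
    x ∈ Complex.slitPlane := by
  rw [Complex.mem_slitPlane_iff]
  by_contra! h
  rw [h.2, sub_zero] at hx
  exact h0 (Complex.ext (le_antisymm h.1 hx) h.2)

theorem tendsto_mul_log_nhds_zero :
    Filter.Tendsto (fun x : ℂ => x * Complex.log x) (nhds 0) (nhds 0) := by
  have h1 : Filter.Tendsto (fun x : ℂ => |‖x‖ * Real.log ‖x‖| + ‖x‖ * Real.pi) (nhds 0) (nhds 0) := by
    have : Continuous fun x : ℂ => |‖x‖ * Real.log ‖x‖| + ‖x‖ * Real.pi :=
      (Real.continuous_mul_log.comp continuous_norm).abs.add (continuous_norm.mul_const _)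
    simpa using this.tendsto 0
  refine squeeze_zero_norm (fun x => ?_) h1
  rw [norm_mul, abs_mul, abs_norm, ← mul_add]
  gcongr
  refine (Complex.norm_le_abs_re_add_abs_im _).trans ?_
  rw [Complex.log_re, Complex.log_im]
  gcongr
  exact Complex.abs_arg_le_pi x

/-- The line through $0$ passes through the branch point, where the power of $x$ tames the
logarithm. -/
theorem continuousOn_pow_mul_log {m : ℕ} (hm : 1 ≤ m) {q : ℝ} :
    ContinuousOn (fun x : ℂ => x ^ m * Complex.log x) (diagStrip 0 q) := by
  intro x hx
  refine ContinuousAt.continuousWithinAt ?_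
  by_cases h0 : x = 0
  · obtain ⟨j, rfl⟩ := Nat.exists_eq_add_of_le' hm
    have h : (fun x : ℂ => x ^ (j + 1) * Complex.log x) =
        fun x => x ^ j * (x * Complex.log x) := by
      funext x; ring
    rw [h]
    refine ContinuousAt.mul (by fun_prop) ?_
    rw [ContinuousAt, h0, Complex.log_zero, mul_zero]
    exact tendsto_mul_log_nhds_zero
  · exact ContinuousAt.mul (by fun_prop)
      (continuousAt_clog (mem_slitPlane_of_re_sub_im_nonneg hx.1 h0))

theorem exists_pow_mul_le_exp_sq (m : ℕ) : ∃ K : ℝ, 0 ≤ K ∧ ∀ r : ℝ, 0 ≤ r →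
    r ^ m ≤ K * Real.exp (r ^ 2 / 2) := by
  refine ⟨m.factorial * Real.exp (1 / 2), by positivity, fun r hr => ?_⟩
  have h1 := Real.pow_div_factorial_le_exp r hr m
  rw [div_le_iff₀ (by positivity)] at h1
  refine h1.trans ?_
  rw [mul_assoc, ← Real.exp_add, mul_comm]
  gcongr
  nlinarith [sq_nonneg (r - 1)]

theorem exists_norm_pow_mul_log_le (m : ℕ) : ∃ K : ℝ, ∀ x : ℂ, 1 ≤ ‖x‖ →
    ‖x ^ m * Complex.log x‖ ≤ K * Real.exp (‖x‖ ^ 2) := by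
  obtain ⟨K, hK0, hK⟩ := exists_pow_mul_le_exp_sq m
  obtain ⟨L, hL0, hL⟩ := exists_pow_mul_le_exp_sq 1
  refine ⟨K * (5 * L), fun x hx => ?_⟩
  have h1 : ‖Complex.log x‖ ≤ 5 * ‖x‖ := by
    refine (Complex.norm_le_abs_re_add_abs_im _).trans ?_
    rw [Complex.log_re, Complex.log_im, abs_of_nonneg (Real.log_nonneg hx)]
    have h2 := Real.log_le_sub_one_of_pos (show 0 < ‖x‖ by linarith)
    have h3 := Complex.abs_arg_le_pi x
    have h4 := Real.pi_lt_d2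
    linarith
  have h5 := hL ‖x‖ (norm_nonneg x)
  have h6 := hK ‖x‖ (norm_nonneg x)
  rw [pow_one] at h5
  rw [norm_mul, norm_pow]
  calc _ ≤ K * Real.exp (‖x‖ ^ 2 / 2) * (5 * (L * Real.exp (‖x‖ ^ 2 / 2))) := by gcongr; linarith
    _ = K * (5 * L) * (Real.exp (‖x‖ ^ 2 / 2) * Real.exp (‖x‖ ^ 2 / 2)) := by ring
    _ = _ := by rw [← Real.exp_add, add_halves]

theorem diagLine_zero (u : ℝ) : diagLine 0 u = Complex.exp (Real.pi * Complex.I / 4) * u := by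
  simp [diagLine, mul_comm]

theorem eq_zero_of_mem_zero_half (j : ℤ) (h1 : (0 : ℝ) ≤ j) (h2 : (j : ℝ) ≤ 1 / 2) : j = 0 := by
  have h4 : (j : ℝ) < 1 := by linarith
  norm_cast at h1 h4
  omega

/-- The power cancels the pole at $0$, so the line may be moved to the origin; there $u\mapsto-u$
makes the integrand odd. -/
theorem integral_pow_mul_auxKernel_half (k : ℕ) :
    ∫ u : ℝ, diagLine (1 / 2) u ^ (2 * k + 2) * auxKernel (diagLine (1 / 2) u) = 0 := by
  obtain ⟨K, hK0, hK⟩ := exists_pow_mul_le_exp_sq (2 * k + 2)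
  have key := integral_mul_auxKernel_diagLine_eq (k := 0) (p := 0) (q := 1 / 2)
    (K := K) (M := 0) (ψ := fun x => x ^ (2 * k + 1)) le_rfl
    (by norm_num) (by norm_num) eq_zero_of_mem_zero_half (by fun_prop)
    (fun x _ _ => by fun_prop) ?_
  · have h := key.2
    simp only [Int.cast_zero, sub_zero, ← pow_succ] at h
    rw [← h]
    obtain ⟨J, hJ⟩ : ∃ J, J = ∫ u : ℝ, diagLine 0 u ^ (2 * k + 2) * auxKernel (diagLine 0 u) :=
      ⟨_, rfl⟩
    have h2 : J = -J := by
      conv_lhs => rw [hJ, ← MeasureTheory.integral_neg_eq_self]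
      rw [hJ, ← MeasureTheory.integral_neg]
      congr 1
      funext u
      rw [diagLine_zero, diagLine_zero, Complex.ofReal_neg, mul_neg, auxKernel_neg,
        Even.neg_pow ⟨k + 1, by ring⟩]
      ring
    rw [← hJ]
    linear_combination h2 / 2
  · intro x _ _
    simp only [Int.cast_zero, sub_zero, ← pow_succ, norm_pow]
    refine (hK _ (norm_nonneg x)).trans ?_
    gcongr
    linarith [sq_nonneg ‖x‖]

/-- The two points have principal arguments $\pi/4$ and $-3\pi/4$. -/
theorem log_exp_mul_neg_sub {u : ℝ} (hu : 0 < u) :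
    Complex.log (diagLine 0 u) - Complex.log (-diagLine 0 u) = Real.pi * Complex.I := by
  have hpi := Real.pi_pos
  have h1 : Complex.log (diagLine 0 u) = Real.log u + Real.pi * Complex.I / 4 := by
    have : diagLine 0 u = Complex.exp (Real.log u + Real.pi * Complex.I / 4) := by
      rw [Complex.exp_add, ← Complex.ofReal_exp, Real.exp_log hu, diagLine_zero, mul_comm]
    rw [this, Complex.log_exp] <;> simp <;> linarith
  have h2 : Complex.log (-diagLine 0 u) =
      Real.log u + Real.pi * Complex.I / 4 - Real.pi * Complex.I := by
    have : -diagLine 0 u =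
        Complex.exp (Real.log u + Real.pi * Complex.I / 4 - Real.pi * Complex.I) := by
      rw [Complex.exp_sub, Complex.exp_pi_mul_I, Complex.exp_add, ← Complex.ofReal_exp,
        Real.exp_log hu, diagLine_zero]
      ring
    rw [this, Complex.log_exp] <;> simp <;> linarith
  rw [h1, h2]
  ring

/-- On the line through $0$, folding $u$ with $-u$ replaces the logarithm by its jump $\pi i$. With
$x^2=iu^2$ there remains a nonzero multiple of the integral in `integral_gauss_div_sin_ne_zero` for
$m=2k+1$. -/
theorem integral_log_mul_pow_mul_auxKernel_half (k : ℕ) :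
    ∫ u : ℝ, Complex.log (diagLine (1 / 2) u) *
      (diagLine (1 / 2) u ^ (2 * k + 2) * auxKernel (diagLine (1 / 2) u)) ≠ 0 := by
  obtain ⟨K, hK⟩ := exists_norm_pow_mul_log_le (2 * k + 2)
  have key := integral_mul_auxKernel_diagLine_eq (k := 0) (p := 0) (q := 1 / 2)
    (K := K) (M := 1) (ψ := fun x => x ^ (2 * k + 1) * Complex.log x) le_rfl
    (by norm_num) (by norm_num) eq_zero_of_mem_zero_half (continuousOn_pow_mul_log (by omega))
    (fun x h _ => DifferentiableAt.mul (by fun_prop)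
      (differentiableAt_id.clog (mem_slitPlane_of_re_sub_im_pos h))) ?_
  · obtain ⟨hI, h⟩ := key
    have e : ∀ x : ℂ, x ^ (2 * k + 1) * Complex.log x * (x - (0 : ℤ)) * auxKernel x =
        Complex.log x * (x ^ (2 * k + 2) * auxKernel x) := by
      intro x
      push_cast
      ring
    simp only [e] at h hI
    rw [← h, ← intervalIntegral.integral_Iic_add_Ioi hI.integrableOn hI.integrableOn (b := 0)]
    have h1 := integral_comp_neg_Ioi (0 : ℝ) (fun u : ℝ => Complex.log (diagLine 0 u) *
        (diagLine 0 u ^ (2 * k + 2) * auxKernel (diagLine 0 u)))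
    rw [neg_zero] at h1
    rw [← h1, ← MeasureTheory.integral_add hI.comp_neg.integrableOn hI.integrableOn]
    have h2 : ∫ u in Set.Ioi (0 : ℝ), (Complex.log (diagLine 0 (-u)) *
        (diagLine 0 (-u) ^ (2 * k + 2) * auxKernel (diagLine 0 (-u))) +
        Complex.log (diagLine 0 u) * (diagLine 0 u ^ (2 * k + 2) * auxKernel (diagLine 0 u))) =
        ∫ u in Set.Ioi (0 : ℝ), Real.pi * Complex.I *
          Complex.exp (Real.pi * Complex.I / 4) ^ (2 * k + 2) *
          (((u ^ (2 * k + 1 + 1) * Real.exp (-Real.pi * u ^ 2) : ℝ) : ℂ) /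
          (Complex.exp (Real.pi * Complex.I * (Complex.exp (Real.pi * Complex.I / 4) * u)) -
          Complex.exp (-(Real.pi * Complex.I * (Complex.exp (Real.pi * Complex.I / 4) * u))))) := by
      refine MeasureTheory.setIntegral_congr_fun measurableSet_Ioi (fun u hu => ?_)
      have h3 : diagLine 0 (-u) = -diagLine 0 u := by
        rw [← diagLine_neg, neg_zero]
      have h4 := log_exp_mul_neg_sub hu
      have h5 : diagLine 0 u ^ (2 * k + 2) * auxKernel (diagLine 0 u) =
          Complex.exp (Real.pi * Complex.I / 4) ^ (2 * k + 2) *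
          (((u ^ (2 * k + 1 + 1) * Real.exp (-Real.pi * u ^ 2) : ℝ) : ℂ) /
          (Complex.exp (Real.pi * Complex.I * (Complex.exp (Real.pi * Complex.I / 4) * u)) -
          Complex.exp (-(Real.pi * Complex.I *
            (Complex.exp (Real.pi * Complex.I / 4) * u))))) := by
        rw [auxKernel, auxDen, diagLine_zero]
        have : Real.pi * Complex.I * (Complex.exp (Real.pi * Complex.I / 4) * u) ^ 2 =
            ((-Real.pi * u ^ 2 : ℝ) : ℂ) := by
          rw [mul_pow, exp_pi_mul_I_div_four_sq]
          push_cast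
          linear_combination Real.pi * u ^ 2 * Complex.I_sq
        rw [this]
        push_cast
        ring
      rw [h3, auxKernel_neg, Even.neg_pow ⟨k + 1, by ring⟩]
      linear_combination (diagLine 0 u ^ (2 * k + 2) * auxKernel (diagLine 0 u)) * h4 +
        Real.pi * Complex.I * h5
    rw [h2, MeasureTheory.integral_const_mul]
    have hpi : (Real.pi : ℂ) ≠ 0 := by exact_mod_cast Real.pi_ne_zero
    exact mul_ne_zero (mul_ne_zero (mul_ne_zero hpi Complex.I_ne_zero)
      (pow_ne_zero _ (Complex.exp_ne_zero _))) (integral_gauss_div_sin_ne_zero (by omega))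
  · intro x _ hx
    refine le_trans (le_of_eq ?_) (hK x hx)
    congr 1
    push_cast
    ring

theorem auxIntegrand_neg_even (k : ℕ) (x : ℂ) :
    auxIntegrand (-2 * ((k : ℂ) + 1)) x = x ^ (2 * k + 2) * auxKernel x := by
  rw [auxIntegrand_eq, ← Complex.cpow_natCast]
  congr 2
  push_cast
  ring

theorem riemannAux_neg_even (k : ℕ) : riemannAux (-2 * ((k : ℂ) + 1)) = 0 := by
  rw [riemannAux_eq]
  simp only [auxIntegrand_neg_even]
  rw [integral_pow_mul_auxKernel_half, zero_mul, neg_zero]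

theorem deriv_riemannAux_neg_even (k : ℕ) : deriv riemannAux (-2 * ((k : ℂ) + 1)) ≠ 0 := by
  rw [(hasDerivAt_riemannAux _).deriv]
  simp only [auxIntegrand_neg_even]
  exact mul_ne_zero (integral_log_mul_pow_mul_auxKernel_half k) (Complex.exp_ne_zero _)

theorem analyticOrderAt_riemannAux_neg_even (k : ℕ) :
    analyticOrderAt riemannAux (-2 * ((k : ℂ) + 1)) = 1 := by
  have ha := differentiable_riemannAux.analyticAt (-2 * ((k : ℂ) + 1))
  have h := ha.analyticOrderAt_sub_eq_one_of_deriv_ne_zero (deriv_riemannAux_neg_even k)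
  simp only [riemannAux_neg_even, sub_zero] at h
  exact h

/-! ### The order of growth. -/

theorem auxGrowth_le_exp {μ : ℝ} (hμ : 1 < μ) : ∃ C, 0 ≤ C ∧ ∀ A, 0 ≤ A →
    auxGrowth A ≤ Real.exp (C * (1 + A ^ μ)) := by
  have hε : 0 < μ - 1 := by linarith
  have h2 : (0 : ℝ) ≤ 2 ^ μ := by positivity
  refine ⟨(4 ^ (μ - 1) / (μ - 1) + Real.pi) * 2 ^ μ, by positivity, fun A hA => ?_⟩
  have h1 := Real.log_le_rpow_div (show 0 ≤ 4 * (1 + A) by positivity) hε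
  have hA1 : 1 ≤ 1 + A := by linarith
  have h3 : 1 ≤ (1 + A) ^ (μ - 1) := Real.one_le_rpow hA1 hε.le
  have h4 : (1 + A) ^ (μ - 1) * A ≤ 2 ^ μ * (1 + A ^ μ) := by
    calc (1 + A) ^ (μ - 1) * A ≤ (1 + A) ^ (μ - 1) * (1 + A) := by gcongr; linarith
      _ = (1 + A) ^ μ := by
          rw [← Real.rpow_add_one (by linarith), sub_add_cancel]
      _ ≤ _ := by
          have h5 : 0 ≤ A ^ μ := by positivity
          rcases le_total A 1 with h | h
          · calc (1 + A) ^ μ ≤ 2 ^ μ := by gcongr; linarith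
              _ ≤ _ := le_mul_of_one_le_right h2 (by linarith)
          · calc (1 + A) ^ μ ≤ (2 * A) ^ μ := by gcongr; linarith
              _ = 2 ^ μ * A ^ μ := Real.mul_rpow (by norm_num) hA
              _ ≤ _ := by gcongr; linarith
  rw [auxGrowth, Real.rpow_def_of_pos (by positivity), ← Real.exp_add, Real.exp_le_exp, mul_assoc]
  have h6 : (4 : ℝ) ^ (μ - 1) / (μ - 1) + Real.pi ≥ 0 := by positivity
  calc _ ≤ (4 ^ (μ - 1) / (μ - 1) + Real.pi) * ((1 + A) ^ (μ - 1) * A) := by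
        rw [Real.mul_rpow (by norm_num) (by positivity)] at h1
        have e1 := mul_le_mul_of_nonneg_right h1 hA
        have e2 : Real.pi * A ≤ Real.pi * ((1 + A) ^ (μ - 1) * A) := by
          gcongr
          exact le_mul_of_one_le_left hA h3
        refine (add_le_add e1 e2).trans (le_of_eq ?_)
        ring
    _ ≤ _ := by gcongr

theorem exists_norm_riemannAux_le_exp {μ : ℝ} (hμ : 1 < μ) : ∃ C, 0 ≤ C ∧ ∀ s,
    ‖riemannAux s‖ ≤ ‖riemannAux 0‖ * Real.exp (C * (1 + ‖s‖ ^ μ)) := by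
  obtain ⟨K, hK0, hK⟩ := exists_norm_riemannAux_le
  obtain ⟨C, hC0, hC⟩ := auxGrowth_le_exp hμ
  refine ⟨2 * K + C, by positivity, fun s => ?_⟩
  have h0 : ‖riemannAux 0‖ = 1 / 2 := by rw [riemannAux_zero]; norm_num
  have h1 : 0 ≤ ‖s‖ ^ μ := by positivity
  rw [h0]
  calc _ ≤ K * auxGrowth ‖s‖ := hK s
    _ = 1 / 2 * (2 * K * auxGrowth ‖s‖) := by ring
    _ ≤ 1 / 2 * (Real.exp (2 * K * (1 + ‖s‖ ^ μ)) * Real.exp (C * (1 + ‖s‖ ^ μ))) := by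
        have := hC ‖s‖ (norm_nonneg s)
        have h3 := auxGrowth_pos (norm_nonneg s)
        gcongr
        have := Real.add_one_le_exp (2 * K * (1 + ‖s‖ ^ μ))
        nlinarith
    _ = _ := by rw [← Real.exp_add]; ring_nf

theorem riemannAux_zero_ne_zero : riemannAux 0 ≠ 0 := by
  rw [riemannAux_zero]
  norm_num

theorem injective_neg_even : Function.Injective fun k : ℕ => -2 * ((k : ℂ) + 1) := by
  intro i j hij
  have h1 : (-2 : ℂ) * ((i : ℂ) + 1) = -2 * ((j : ℂ) + 1) := hij
  have : (i : ℂ) = j := by linear_combination (-1 / 2 : ℂ) * h1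
  exact_mod_cast this

theorem neg_even_ne_zero (k : ℕ) : -2 * ((k : ℂ) + 1) ≠ 0 :=
  mul_ne_zero (by norm_num) (by exact_mod_cast k.succ_ne_zero)

theorem encard_neg_even_le (z : ℂ) :
    {k : ℕ | -2 * ((k : ℂ) + 1) = z}.encard ≤ analyticOrderAt riemannAux z := by
  by_cases h : ∃ k : ℕ, -2 * ((k : ℂ) + 1) = z
  · obtain ⟨k, rfl⟩ := h
    rw [analyticOrderAt_riemannAux_neg_even, Set.encard_le_one_iff]
    intro i j hi hj
    exact injective_neg_even (hi.trans hj.symm)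
  · have : {k : ℕ | -2 * ((k : ℂ) + 1) = z} = ∅ := by
      ext k
      simpa using fun hk => h ⟨k, hk⟩
    rw [this, Set.encard_empty]
    exact zero_le

open Filter Topology in
theorem isBigO_riemannAux {μ : ℝ} (hμ : 1 < μ) :
    riemannAux =O[cocompact ℂ] fun z => Real.exp (‖z‖ ^ μ) := by
  -- The exponent `ν` strictly below `μ` absorbs the constant `C`.
  obtain ⟨ν, hν, hνμ⟩ := exists_between hμ
  obtain ⟨C, hC0, hC⟩ := exists_norm_riemannAux_le_exp hν
  have hlim : Tendsto (fun z : ℂ => ‖z‖) (cocompact ℂ) atTop := tendsto_norm_cocompact_atTop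
  have h1 := ((tendsto_rpow_atTop (sub_pos.2 hνμ)).comp hlim).eventually_ge_atTop C
  refine Asymptotics.IsBigO.of_bound (‖riemannAux 0‖ * Real.exp C) ?_
  filter_upwards [h1, hlim.eventually_gt_atTop 0] with z hz hz0
  simp only [Function.comp_apply] at hz
  refine (hC z).trans ?_
  rw [Real.norm_of_nonneg (Real.exp_pos _).le, mul_assoc, ← Real.exp_add]
  gcongr
  have : C * ‖z‖ ^ ν ≤ ‖z‖ ^ μ := by
    calc C * ‖z‖ ^ ν ≤ ‖z‖ ^ (μ - ν) * ‖z‖ ^ ν := by gcongr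
      _ = _ := by rw [← Real.rpow_add hz0, sub_add_cancel]
  linarith

-- The disc $|z|\le2n$ contains `n` trivial zeros, so zero counting forces $n\le(8n)^\mu+O(1)$,
-- which fails for large `n` if $\mu<1$.
open Filter Topology in
theorem one_le_of_isBigO_riemannAux {μ : ℝ}
    (h : riemannAux =O[cocompact ℂ] fun z => Real.exp (‖z‖ ^ μ)) : 1 ≤ μ := by
  by_contra! hμ
  obtain ⟨K, hK⟩ := h.bound
  rw [Filter.Eventually, Metric.cobounded_eq_cocompact.symm,
    ← Filter.Eventually] at hK
  have h0 : ‖riemannAux 0‖ = 1 / 2 := by rw [riemannAux_zero]; norm_num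
  obtain ⟨M, -, hM⟩ := (Filter.hasBasis_cobounded_norm (E := ℂ)).eventually_iff.1 hK
  have key : ∀ n : ℕ, 1 ≤ n → M ≤ 8 * n → (n : ℝ) ≤ (8 * n : ℝ) ^ μ + 2 * |K| := by
    intro n hn hMn
    have hn' : (1 : ℝ) ≤ n := by exact_mod_cast hn
    have := card_le_of_growth (ρ := fun k : ℕ => -2 * ((k : ℂ) + 1)) neg_even_ne_zero
      (Finset.range n) differentiable_riemannAux riemannAux_zero_ne_zero encard_neg_even_le
      (r := 2 * n) (M := (8 * n : ℝ) ^ μ + 2 * |K|) (by positivity) ?_ ?_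
    · simpa using this
    · intro k hk
      rw [Finset.mem_range] at hk
      have h1 : ((k : ℂ) + 1) = ((k + 1 : ℕ) : ℂ) := by push_cast; ring
      rw [h1, norm_mul, Complex.norm_natCast, norm_neg, Complex.norm_ofNat]
      have : ((k + 1 : ℕ) : ℝ) ≤ n := by exact_mod_cast hk
      linarith
    · intro z hz
      have hz' : ‖z‖ = 8 * n := by rw [hz]; ring
      have h1 := hM (show z ∈ {x | M ≤ ‖x‖} by simpa [hz'] using hMn)
      rw [Real.norm_of_nonneg (Real.exp_pos _).le, hz'] at h1
      refine h1.trans ?_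
      rw [h0, Real.exp_add]
      have h2 := Real.add_one_le_exp (2 * |K|)
      have h3 := le_abs_self K
      have h4 := Real.exp_pos ((8 * n : ℝ) ^ μ)
      nlinarith
  have h1 : Tendsto (fun n : ℕ => (8 * n : ℝ)) atTop atTop :=
    tendsto_natCast_atTop_atTop.const_mul_atTop (by norm_num)
  -- With $(8n)^{\mu-1}<\frac1{16}$ and $8n>32|K|$, each of $(8n)^\mu$ and $2|K|$ is less than
  -- $n/2$.
  have h2 := ((tendsto_rpow_neg_atTop (sub_pos.2 hμ)).comp h1).eventually
    (gt_mem_nhds (show (0 : ℝ) < 1 / 16 by norm_num))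
  obtain ⟨n, hn2, hn3, hn4, hn5⟩ := (h2.and ((h1.eventually_ge_atTop M).and
    ((eventually_ge_atTop 1).and (h1.eventually_gt_atTop (32 * |K|))))).exists
  have h3 := key n hn4 hn3
  simp only [Function.comp_apply, neg_sub] at hn2
  have hn' : (1 : ℝ) ≤ n := by exact_mod_cast hn4
  have h4 : (8 * n : ℝ) ^ μ = (8 * n : ℝ) ^ (μ - 1) * (8 * n) := by
    rw [← Real.rpow_add_one (by positivity), sub_add_cancel]
  nlinarith

theorem entireOrder_riemannAux : entireOrder riemannAux = 1 := by
  refine le_antisymm ?_ (le_iInf₂ fun μ h => ?_)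
  · refine ENNReal.le_of_forall_pos_le_add (fun ε hε _ => ?_)
    have : (1 : ℝ≥0∞) + ε = ((1 + ε : ℝ≥0) : ℝ≥0∞) := by push_cast; rfl
    rw [this]
    refine iInf₂_le (1 + ε) (isBigO_riemannAux ?_)
    push_cast
    have : (0 : ℝ) < ε := hε
    linarith
  · exact_mod_cast one_le_of_isBigO_riemannAux h

/-! ### Zeros of `riemannAux` in the two half planes. -/

theorem infinite_zeros_riemannAux_upper : {z : ℂ | riemannAux z = 0 ∧ 0 < z.im}.Infinite := by
  obtain ⟨C, hC0, hC⟩ := exists_norm_riemannAux_le_exp (show (1 : ℝ) < 2 by norm_num)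
  have h0 : ‖riemannAux 0‖ = 1 / 2 := by rw [riemannAux_zero]; norm_num
  refine infinite_zeros_upper_half_plane differentiable_riemannAux (C := C) (fun z => ?_)
    exists_norm_riemannAux_sub_one_le ⟨_, deriv_riemannAux_neg_even 0⟩
  have := hC z
  rw [h0, Real.rpow_two] at this
  linarith [Real.exp_pos (C * (1 + ‖z‖ ^ 2))]

/-- The hypotheses of `infinite_zeros_upper_half_plane` are symmetric under
$f(z)\mapsto\overline{f(\bar z)}$, which exchanges the half planes. Non-constancy again comes from
the simple zero at $-2$. -/
theorem infinite_zeros_riemannAux_lower : {z : ℂ | riemannAux z = 0 ∧ z.im < 0}.Infinite := by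
  obtain ⟨C, hC0, hC⟩ := exists_norm_riemannAux_le_exp (show (1 : ℝ) < 2 by norm_num)
  have h0 : ‖riemannAux 0‖ = 1 / 2 := by rw [riemannAux_zero]; norm_num
  have key := infinite_zeros_upper_half_plane
    (f := fun z => starRingEnd ℂ (riemannAux (starRingEnd ℂ z))) (C := C)
    (fun z => ?_) (fun z => ?_) (fun T => ?_) ?_
  · refine Set.Infinite.of_image (starRingEnd ℂ) (key.mono ?_)
    intro z hz
    refine ⟨starRingEnd ℂ z, ?_, by simp⟩
    simpa using hz
  · simpa [Function.comp_def] using! (differentiable_riemannAux (starRingEnd ℂ z)).conj_conj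
  · have := hC (starRingEnd ℂ z)
    rw [h0, Real.rpow_two, Complex.norm_conj] at this
    rw [Complex.norm_conj]
    linarith [Real.exp_pos (C * (1 + ‖z‖ ^ 2))]
  · obtain ⟨c, B, hc, hB⟩ := exists_norm_riemannAux_sub_one_le T
    refine ⟨c, B, hc, fun z h1 h2 => ?_⟩
    have h3 := hB (starRingEnd ℂ z) (by simpa using h1) (by simpa using h2)
    rw [Complex.conj_re] at h3
    rw [← Complex.norm_conj]
    simpa using h3
  · refine ⟨-2 * (((0 : ℕ) : ℂ) + 1), ?_⟩
    have h : (fun z => starRingEnd ℂ (riemannAux (starRingEnd ℂ z))) =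
      starRingEnd ℂ ∘ riemannAux ∘ starRingEnd ℂ := rfl
    have h3 := deriv_riemannAux_neg_even 0
    rw [h, deriv_conj_conj]
    have h2 : (starRingEnd ℂ) (-2 * (((0 : ℕ) : ℂ) + 1)) = -2 * (((0 : ℕ) : ℂ) + 1) :=
      Complex.conj_eq_iff_im.2 (by simp)
    rw [Function.comp_apply, Function.comp_apply, h2]
    exact (map_ne_zero _).2 h3

/-! ### The product over the trivial zeros. -/

theorem summable_inv_norm_sq_neg_even :
    Summable fun k : ℕ => (‖-2 * ((k : ℂ) + 1)‖ ^ 2)⁻¹ := by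
  obtain ⟨C, hC0, hC⟩ := exists_norm_riemannAux_le_exp (show (1 : ℝ) < 3 / 2 by norm_num)
  exact summable_inv_norm_sq_of_growth neg_even_ne_zero differentiable_riemannAux
    riemannAux_zero_ne_zero encard_neg_even_le hC

theorem prod_one_add_div_mul_exp (z : ℂ) (n : ℕ) :
    ∏ k ∈ Finset.range n, (1 + z / (k + 1)) * Complex.exp (-(z / (k + 1))) =
      (∏ k ∈ Finset.range n, (1 + z + k)) / n.factorial *
        Complex.exp (-(z * (harmonic n : ℝ))) := by
  induction n with
  | zero => simp
  | succ n ih =>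
    have hn : (n : ℂ) + 1 ≠ 0 := by exact_mod_cast n.succ_ne_zero
    have hf : (n.factorial : ℂ) ≠ 0 := by exact_mod_cast n.factorial_ne_zero
    have h : Complex.exp (-(z * ((harmonic (n + 1) : ℝ) : ℂ))) =
        Complex.exp (-(z * ((harmonic n : ℝ) : ℂ))) * Complex.exp (-(z / (n + 1))) := by
      rw [← Complex.exp_add, harmonic_succ]
      congr 1
      push_cast
      ring
    rw [Finset.prod_range_succ, ih, Finset.prod_range_succ, h, Nat.factorial_succ]
    push_cast
    field_simp
    ring

/-- Euler's approximation to $\Gamma$ is an exact partial Weierstrass product. The sequence ends at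
`n` but has $n+1$ factors, whence the corrections $(n+1)/n$ and $z/(n+1)$. -/
theorem inv_GammaSeq_one_add (z : ℂ) {n : ℕ} (hn : 1 ≤ n) :
    (Complex.GammaSeq (1 + z) n)⁻¹ = ((n : ℂ) + 1) / n *
      Complex.exp (z * ((harmonic n - Real.log n : ℝ) : ℂ) + z / (n + 1)) *
      ∏ k ∈ Finset.range (n + 1), (1 + z / (k + 1)) * Complex.exp (-(z / (k + 1))) := by
  have hn0 : (n : ℂ) ≠ 0 := by exact_mod_cast (show n ≠ 0 by omega)
  have hf : (n.factorial : ℂ) ≠ 0 := by exact_mod_cast n.factorial_ne_zero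
  have hn1 : (n : ℂ) + 1 ≠ 0 := by exact_mod_cast n.succ_ne_zero
  have h : Complex.exp (z * ((harmonic n - Real.log n : ℝ) : ℂ) + z / (n + 1)) *
      Complex.exp (-(z * ((harmonic (n + 1) : ℝ) : ℂ))) = Complex.exp (-(z * Real.log n)) := by
    rw [← Complex.exp_add, harmonic_succ]
    congr 1
    push_cast
    ring
  have h2 : (n : ℂ) ^ (1 + z) = n * Complex.exp (z * Real.log n) := by
    rw [Complex.cpow_add _ _ hn0, Complex.cpow_one, Complex.cpow_def_of_ne_zero hn0,
      Complex.natCast_log, mul_comm z]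
  rw [prod_one_add_div_mul_exp, Complex.GammaSeq, h2]
  calc _ = (∏ j ∈ Finset.range (n + 1), (1 + z + j)) / (n * n.factorial) *
        (Complex.exp (z * Real.log n))⁻¹ := by
        rw [inv_div]
        field_simp
    _ = (∏ j ∈ Finset.range (n + 1), (1 + z + j)) / (n * n.factorial) *
        (Complex.exp (z * ((harmonic n - Real.log n : ℝ) : ℂ) + z / (n + 1)) *
      Complex.exp (-(z * ((harmonic (n + 1) : ℝ) : ℂ)))) := by rw [h, Complex.exp_neg]
    _ = _ := by
        rw [Nat.factorial_succ]
        push_cast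
        field_simp

open Filter Topology in
/-- The Weierstrass product of the reciprocal of the Gamma function. -/
theorem inv_Gamma_one_add_eq (z : ℂ)
    (h : Multipliable fun k : ℕ => (1 + z / (k + 1)) * Complex.exp (-(z / (k + 1)))) :
    (Complex.Gamma (1 + z))⁻¹ = Complex.exp (Real.eulerMascheroniConstant * z) *
      ∏' k : ℕ, (1 + z / (k + 1)) * Complex.exp (-(z / (k + 1))) := by
  -- At a pole both sides are $0$: the product has a zero factor, and `Complex.Gamma` takes the
  -- value $0$ there, so its inverse agrees with the entire reciprocal.
  by_cases hz : ∃ m : ℕ, 1 + z = -m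
  · obtain ⟨m, hm⟩ := hz
    have hm1 : (m : ℂ) + 1 ≠ 0 := by exact_mod_cast m.succ_ne_zero
    have h0 : (1 + z / (m + 1)) * Complex.exp (-(z / (m + 1))) = 0 := by
      rw [show z = -(m + 1) by linear_combination hm, neg_div, div_self hm1]
      simp
    have h1 : ∏' k : ℕ, (1 + z / (k + 1)) * Complex.exp (-(z / (k + 1))) = 0 :=
      tprod_of_exists_eq_zero ⟨m, h0⟩
    rw [h1, hm, Complex.Gamma_neg_nat_eq_zero, inv_zero, mul_zero]
  · have hG : Complex.Gamma (1 + z) ≠ 0 := Complex.Gamma_ne_zero (fun m hm => hz ⟨m, hm⟩)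
    have h1 := (Complex.GammaSeq_tendsto_Gamma (1 + z)).inv₀ hG
    have h2 : Tendsto (fun n : ℕ => ((n : ℂ) + 1) / n *
      Complex.exp (z * ((harmonic n - Real.log n : ℝ) : ℂ) + z / (n + 1)) *
      ∏ k ∈ Finset.range (n + 1), (1 + z / (k + 1)) * Complex.exp (-(z / (k + 1)))) atTop
      (𝓝 (1 * Complex.exp (z * (Real.eulerMascheroniConstant : ℂ) + 0) *
        ∏' k : ℕ, (1 + z / (k + 1)) * Complex.exp (-(z / (k + 1))))) := by
      refine (Tendsto.mul ?_ ?_).mul (h.hasProd.tendsto_prod_nat.comp (tendsto_add_atTop_nat 1))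
      · have h3 : Tendsto (fun n : ℕ => 1 + 1 / (n : ℂ)) atTop (𝓝 (1 + 0)) :=
          tendsto_const_nhds.add (tendsto_const_div_atTop_nhds_zero_nat 1)
        rw [add_zero] at h3
        refine h3.congr' ?_
        filter_upwards [eventually_ge_atTop 1] with n hn
        have hn0 : (n : ℂ) ≠ 0 := by exact_mod_cast (show n ≠ 0 by omega)
        rw [add_div, div_self hn0]
      · refine (Complex.continuous_exp.tendsto _).comp (Tendsto.add ?_ ?_)
        · exact ((Complex.continuous_ofReal.tendsto _).comp
            Real.tendsto_harmonic_sub_log).const_mul z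
        · have := (tendsto_const_div_atTop_nhds_zero_nat z).comp (tendsto_add_atTop_nat 1)
          refine this.congr (fun n => ?_)
          simp
    have h3 := tendsto_nhds_unique (h1.congr' (by
      filter_upwards [eventually_ge_atTop 1] with n hn
      exact inv_GammaSeq_one_add z hn)) h2
    rw [h3, one_mul, add_zero, mul_comm z]

/-- The Weierstrass product at $s/2$; its factor $e^{-\gamma s/2}$ contributes $-\gamma/2$ to the
constant $a$. -/
theorem tprod_neg_even (s : ℂ) :
    ∏' k : ℕ, (1 - s / (-2 * ((k : ℂ) + 1))) * Complex.exp (s / (-2 * ((k : ℂ) + 1))) =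
      Complex.exp (-(Real.eulerMascheroniConstant / 2) * s) / Complex.Gamma (1 + s / 2) := by
  have e : ∀ k : ℕ, (1 - s / (-2 * ((k : ℂ) + 1))) * Complex.exp (s / (-2 * ((k : ℂ) + 1))) =
      (1 + s / 2 / (k + 1)) * Complex.exp (-(s / 2 / (k + 1))) := by
    intro k
    have : s / (-2 * ((k : ℂ) + 1)) = -(s / 2 / (k + 1)) := by
      rw [neg_mul, div_neg, div_div]
    rw [this, sub_neg_eq_add]
  have hm : Multipliable fun k : ℕ =>
      (1 - s / (-2 * ((k : ℂ) + 1))) * Complex.exp (s / (-2 * ((k : ℂ) + 1))) :=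
    (multipliableLocallyUniformly_one_sub_mul_exp summable_inv_norm_sq_neg_even).multipliable
  simp only [e] at hm ⊢
  rw [div_eq_mul_inv _ (Complex.Gamma _), inv_Gamma_one_add_eq _ hm, ← mul_assoc, ← Complex.exp_add]
  rw [show -((Real.eulerMascheroniConstant : ℂ) / 2) * s + Real.eulerMascheroniConstant * (s / 2) = 0
    by ring, Complex.exp_zero, one_mul]

/-! ### Listing the zeros, and the factorization. -/

/-- The pairs of a point of `T` and a copy number below its multiplicity form a countably infinite
type; an enumeration of it is projected to `T`. -/
theorem exists_nat_enumeration {T : Set ℂ} (hc : T.Countable) (hi : T.Infinite) {m : ℂ → ℕ}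
    (hm : ∀ z ∈ T, 0 < m z) :
    ∃ ρ : ℕ → ℂ, (∀ n, ρ n ∈ T) ∧ ∀ z ∈ T, {n | ρ n = z}.encard = m z := by
  have := hc.to_subtype
  have := hi.to_subtype
  have hinf : Infinite (Σ z : T, Fin (m z)) :=
    Infinite.of_injective (fun z : T => (⟨z, ⟨0, hm z z.2⟩⟩ : Σ z : T, Fin (m z)))
      (fun a b hab => congrArg Sigma.fst hab)
  obtain ⟨e⟩ : Nonempty (ℕ ≃ Σ z : T, Fin (m z)) := nonempty_equiv_of_countable
  refine ⟨fun n => (e n).1, fun n => (e n).1.2, fun z hz => ?_⟩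
  have h : {n | ((e n).1 : ℂ) = z} = e.symm '' Set.range (Sigma.mk (⟨z, hz⟩ : T)) := by
    ext n
    constructor
    · intro hn
      refine ⟨e n, ?_, by simp⟩
      have hn' : (e n).1 = ⟨z, hz⟩ := Subtype.ext hn
      generalize e n = x at hn'
      obtain ⟨a, b⟩ := x
      subst hn'
      exact ⟨b, rfl⟩
    · rintro ⟨_, ⟨b, rfl⟩, rfl⟩
      simp
  change {n | ((e n).1 : ℂ) = z}.encard = _
  rw [h, e.symm.injective.encard_image, ← Set.image_univ,
    Function.Injective.encard_image (sigma_mk_injective), Set.encard_univ]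
  simp

theorem analyticOrderAt_riemannAux_ne_top (z : ℂ) : analyticOrderAt riemannAux z ≠ ⊤ := by
  intro h
  have h1 : AnalyticOnNhd ℂ riemannAux Set.univ := fun z _ => differentiable_riemannAux.analyticAt z
  rw [analyticOrderAt_eq_top] at h
  exact riemannAux_zero_ne_zero
    (h1.eqOn_zero_of_preconnected_of_eventuallyEq_zero isPreconnected_univ (Set.mem_univ z) h
      (Set.mem_univ 0))

theorem analyticOrderAt_riemannAux_eq_zero_iff {z : ℂ} :
    analyticOrderAt riemannAux z = 0 ↔ riemannAux z ≠ 0 := by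
  rw [(differentiable_riemannAux.analyticAt z).analyticOrderAt_eq_zero]

theorem countable_zeros_riemannAux : {z : ℂ | riemannAux z = 0}.Countable := by
  have h : ∀ n : ℕ, {z : {z : ℂ | riemannAux z = 0} | ‖(z : ℂ)‖ ≤ n}.Finite := by
    intro n
    refine finite_setOf_norm_le (ρ := fun z : {z : ℂ | riemannAux z = 0} => (z : ℂ)) ?_
      differentiable_riemannAux riemannAux_zero_ne_zero (fun z => ?_) n
    · rintro ⟨z, hz⟩ rfl
      exact riemannAux_zero_ne_zero hz
    · by_cases hz : riemannAux z = 0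
      · refine le_trans (Set.encard_le_one_iff.2 fun i j hi hj => Subtype.ext (hi.trans hj.symm)) ?_
        rw [Order.one_le_iff_ne_zero, Ne, analyticOrderAt_riemannAux_eq_zero_iff, not_not]
        exact hz
      · have : {i : {z : ℂ | riemannAux z = 0} | (i : ℂ) = z} = ∅ := by
          ext ⟨i, hi⟩
          simp only [Set.mem_ofPred_eq, Set.mem_empty_iff_false, iff_false]
          rintro rfl
          exact hz hi
        rw [this, Set.encard_empty]
        exact zero_le
  refine (Set.countable_iUnion fun n : ℕ => ((h n).image Subtype.val).countable).mono ?_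
  intro z hz
  obtain ⟨n, hn⟩ := exists_nat_ge ‖z‖
  exact Set.mem_iUnion.2 ⟨n, ⟨z, hz⟩, hn, rfl⟩

theorem im_eq_zero_of_mem_trivialZeros {z : ℂ} (hz : z ∈ trivialZeros) : z.im = 0 := by
  obtain ⟨k, rfl⟩ := hz
  simp

theorem exists_isZeroEnumeration : ∃ ρ : ℤ → ℂ, IsZeroEnumeration ρ := by
  have hord : ∀ z, ((analyticOrderAt riemannAux z).toNat : ℕ∞) = analyticOrderAt riemannAux z :=
    fun z => ENat.natCast_toNat (analyticOrderAt_riemannAux_ne_top z)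
  have hpos : ∀ z, riemannAux z = 0 → 0 < (analyticOrderAt riemannAux z).toNat := by
    intro z hz
    rw [Nat.pos_iff_ne_zero]
    intro h
    have := hord z
    rw [h, Nat.cast_zero, eq_comm, analyticOrderAt_riemannAux_eq_zero_iff] at this
    exact this hz
  obtain ⟨σ, hσ, hσ'⟩ := exists_nat_enumeration
    (T := {z | riemannAux z = 0 ∧ 0 < z.im}) (countable_zeros_riemannAux.mono fun z hz => hz.1)
    infinite_zeros_riemannAux_upper (m := fun z => (analyticOrderAt riemannAux z).toNat)
    (fun z hz => hpos z hz.1)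
  -- This list also takes any real zeros outside `trivialZeros`; it is infinite because of the zeros
  -- strictly below the axis.
  obtain ⟨τ, hτ, hτ'⟩ := exists_nat_enumeration
    (T := {z | riemannAux z = 0 ∧ z.im ≤ 0 ∧ z ∉ trivialZeros})
    (countable_zeros_riemannAux.mono fun z hz => hz.1)
    (infinite_zeros_riemannAux_lower.mono fun z hz => ⟨hz.1, hz.2.le, fun h =>
      hz.2.ne (im_eq_zero_of_mem_trivialZeros h)⟩)
    (m := fun z => (analyticOrderAt riemannAux z).toNat) (fun z hz => hpos z hz.1)
  -- The indices $1,2,\dots$ read `σ` from $0$, and $0,-1,\dots$ read `τ` from $0$.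
  obtain ⟨ρ, hρ⟩ : ∃ ρ : ℤ → ℂ, ρ = fun n => if 1 ≤ n then σ (n - 1).toNat else τ (-n).toNat :=
    ⟨_, rfl⟩
  have hρ1 : ∀ n, 1 ≤ n → ρ n = σ (n - 1).toNat := fun n hn => by rw [hρ]; exact if_pos hn
  have hρ2 : ∀ n, n ≤ 0 → ρ n = τ (-n).toNat := fun n hn => by rw [hρ]; exact if_neg (by omega)
  have him1 : ∀ n, 1 ≤ n → 0 < (ρ n).im := fun n hn => by rw [hρ1 n hn]; exact (hσ _).2
  have him2 : ∀ n, n ≤ 0 → (ρ n).im ≤ 0 := fun n hn => by rw [hρ2 n hn]; exact (hτ _).2.1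
  refine ⟨ρ, fun n => ?_, fun z hz => ?_, him1, him2⟩
  · rcases le_or_gt 1 n with h | h
    · intro ht
      have := him1 n h
      rw [im_eq_zero_of_mem_trivialZeros ht] at this
      exact lt_irrefl _ this
    · rw [hρ2 n (by omega)]
      exact (hτ _).2.2
  · by_cases h0 : riemannAux z = 0
    · rcases lt_or_ge 0 z.im with him | him
      · have : {n : ℤ | ρ n = z} = (fun k : ℕ => (k : ℤ) + 1) '' {k | σ k = z} := by
          ext n
          constructor
          · intro hn
            have h1 : 1 ≤ n := by
              by_contra! h
              have := him2 n (by omega)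
              rw [show ρ n = z from hn] at this
              linarith
            refine ⟨(n - 1).toNat, ?_, ?_⟩
            · rw [Set.mem_ofPred_eq, ← hρ1 n h1]; exact hn
            · simp only; omega
          · rintro ⟨k, hk, rfl⟩
            rw [Set.mem_ofPred_eq, hρ1 _ (show (1 : ℤ) ≤ (k : ℤ) + 1 by omega)]
            simpa using hk
        rw [this, Function.Injective.encard_image, hσ' z ⟨h0, him⟩, hord]
        intro a b hab
        simpa using hab
      · have : {n : ℤ | ρ n = z} = (fun k : ℕ => -(k : ℤ)) '' {k | τ k = z} := by
          ext n
          constructor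
          · intro hn
            have h1 : n ≤ 0 := by
              by_contra! h
              have := him1 n (by omega)
              rw [show ρ n = z from hn] at this
              linarith
            refine ⟨(-n).toNat, ?_, ?_⟩
            · rw [Set.mem_ofPred_eq, ← hρ2 n h1]; exact hn
            · simp only; omega
          · rintro ⟨k, hk, rfl⟩
            rw [Set.mem_ofPred_eq, hρ2 _ (show -(k : ℤ) ≤ 0 by omega)]
            simpa using hk
        rw [this, Function.Injective.encard_image, hτ' z ⟨h0, him, hz⟩, hord]
        intro a b hab
        simpa using hab
    · have : {n : ℤ | ρ n = z} = ∅ := by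
        ext n
        simp only [Set.mem_ofPred_eq, Set.mem_empty_iff_false, iff_false]
        rintro rfl
        rcases le_or_gt 1 n with h | h
        · rw [hρ1 n h] at h0
          exact h0 (hσ _).1
        · rw [hρ2 n (by omega)] at h0
          exact h0 (hτ _).1
      rw [this, Set.encard_empty, eq_comm, analyticOrderAt_riemannAux_eq_zero_iff]
      exact h0

theorem IsZeroEnumeration.ne_zero {ρ : ℤ → ℂ} (hρ : IsZeroEnumeration ρ) (n : ℤ) : ρ n ≠ 0 := by
  intro h
  have h1 : (0 : ℂ) ∉ trivialZeros := fun ⟨k, hk⟩ => neg_even_ne_zero k hk.symm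
  have h2 := hρ.multiplicity 0 h1
  rw [analyticOrderAt_riemannAux_eq_zero_iff.2 riemannAux_zero_ne_zero, Set.encard_eq_zero] at h2
  exact (h2 ▸ h : n ∈ (∅ : Set ℤ))

/-- Joins the listing to the trivial zeros, so that Hadamard's theorem sees every zero. Simplicity
of the trivial zeros is exactly what makes the multiplicities right. -/
theorem IsZeroEnumeration.encard_sumElim {ρ : ℤ → ℂ} (hρ : IsZeroEnumeration ρ) (z : ℂ) :
    {i | Sum.elim ρ (fun k : ℕ => -2 * ((k : ℂ) + 1)) i = z}.encard =
      analyticOrderAt riemannAux z := by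
  by_cases hz : z ∈ trivialZeros
  · obtain ⟨k, rfl⟩ := hz
    rw [analyticOrderAt_riemannAux_neg_even, Set.encard_eq_one]
    refine ⟨Sum.inr k, ?_⟩
    ext i
    rcases i with n | j
    · simp only [Set.mem_ofPred_eq, Sum.elim_inl, Set.mem_singleton_iff, reduceCtorEq, iff_false]
      exact fun h => hρ.ne_trivial n ⟨k, h⟩
    · simp only [Set.mem_ofPred_eq, Sum.elim_inr, Set.mem_singleton_iff, Sum.inr.injEq]
      exact ⟨fun h => injective_neg_even h, fun h => by rw [h]⟩
  · rw [← hρ.multiplicity z hz, ← Sum.inl_injective (α := ℤ) (β := ℕ) |>.encard_image]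
    congr 1
    ext i
    rcases i with n | j
    · simp
    · simp only [Set.mem_ofPred_eq, Sum.elim_inr, Set.mem_image, reduceCtorEq, and_false,
        exists_false, iff_false]
      exact fun h => hz ⟨j, h.symm⟩

theorem mainTheorem1 :
    Differentiable ℂ riemannAux ∧ entireOrder riemannAux = 1 ∧
    (∃ ρ : ℤ → ℂ, IsZeroEnumeration ρ) ∧
    ∃ a : ℂ, ∀ ρ : ℤ → ℂ, IsZeroEnumeration ρ →
      MultipliableLocallyUniformly
        (fun (n : ℤ) (s : ℂ) => (1 - s / ρ n) * Complex.exp (s / ρ n)) ∧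
      ∀ s : ℂ, riemannAux s =
        -(Complex.exp (a * s) / (2 * Complex.Gamma (1 + s / 2))) *
          ∏' n : ℤ, (1 - s / ρ n) * Complex.exp (s / ρ n) := by
  -- The constant is $\mathcal R'(0)/\mathcal R(0)$ from Hadamard's theorem and $-\gamma/2$ from the
  -- Gamma factor; neither depends on the listing.
  refine ⟨differentiable_riemannAux, entireOrder_riemannAux, exists_isZeroEnumeration,
    deriv riemannAux 0 / riemannAux 0 - Real.eulerMascheroniConstant / 2, fun ρ hρ => ?_⟩
  obtain ⟨C, hC0, hC⟩ := exists_norm_riemannAux_le_exp (show (1 : ℝ) < 3 / 2 by norm_num)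
  have hne : ∀ i, Sum.elim ρ (fun k : ℕ => -2 * ((k : ℂ) + 1)) i ≠ 0 := by
    rintro (n | k)
    · exact hρ.ne_zero n
    · exact neg_even_ne_zero k
  have hsum := summable_inv_norm_sq_of_growth hne differentiable_riemannAux
    riemannAux_zero_ne_zero (fun z => (hρ.encard_sumElim z).le) hC
  have hmul := multipliableLocallyUniformly_one_sub_mul_exp
    (hsum.comp_injective (Sum.inl_injective (α := ℤ) (β := ℕ)))
  refine ⟨hmul, fun s => ?_⟩
  have hmul2 := multipliableLocallyUniformly_one_sub_mul_exp summable_inv_norm_sq_neg_even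
  have hprod := Multipliable.tprod_sum
    (f := fun i => (1 - s / Sum.elim ρ (fun k : ℕ => -2 * ((k : ℂ) + 1)) i) *
      Complex.exp (s / Sum.elim ρ (fun k : ℕ => -2 * ((k : ℂ) + 1)) i))
    (hmul.multipliable (x := s)) (hmul2.multipliable (x := s))
  simp only [Sum.elim_inl, Sum.elim_inr] at hprod
  rw [tprod_neg_even] at hprod
  have key := eq_mul_exp_mul_tprod_of_growth hne differentiable_riemannAux
    riemannAux_zero_ne_zero hρ.encard_sumElim hC s
  rw [hprod] at key
  have hexp : Complex.exp ((deriv riemannAux 0 / riemannAux 0 -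
      Real.eulerMascheroniConstant / 2) * s) =
      Complex.exp (deriv riemannAux 0 / riemannAux 0 * s) *
        Complex.exp (-(Real.eulerMascheroniConstant / 2) * s) := by
    rw [← Complex.exp_add]
    congr 1
    ring
  generalize deriv riemannAux 0 / riemannAux 0 = b at key hexp ⊢
  rw [key, hexp, riemannAux_zero, mul_comm 2, ← div_div]
  ring
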